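/- Let $N\ge 1$, $0<\theta\le 2$, $p_\theta:=1+\theta/N$, and let $\Gamma_\theta$ be the fundamental solution of $\partial_t u+(-\Delta)^{\theta/2}u=0$ in $\mathbb R^N\times(0,\infty)$. For a nonnegative Radon measure $m$ put $[S(t)m](x)=\int\Gamma_\theta(x-y,t)\,dm(y)\in[0,\infty]$, and for a nonnegative measurable function $f$ let $S(t)f:=S(t)(f\,dx)$. A solution in $Q_T:=\mathbb R^N\times(0,T)$ of problem (P): $\partial_t u+(-\Delta)^{\theta/2}u=F(u)$, $u(0)=m$, is a nonnegative measurable function $u$, finite a.e. in $Q_T$, such that for a.a. $(x,t)\in Q_T$ $$u(x,t)=[S(t)m](x)+\int_0^t\int_{\mathbb R^N}\Gamma_\theta(x-y,t-s)F(u(y,s))\,dy\,ds .$$ For functions $f,g$ defined for large $\tau$, write $f\asymp g$ if there is $c>0$ with $c^{-1}g(\tau)\le f(\tau)\le c\,g(\tau)$ for all large $\tau$. **Theorem 4.2.** Let $F$ be an increasing, nonnegative, continuous function on $[0,\infty)$. Assume that there are $R>0$, $\alpha>0$ and positive functions $G\in C([R,\infty))$, $H\in C^1([R,\infty))$ such that,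 as $\tau\to\infty$, (B1) $\tau^{-p_\theta}F(\tau)\asymp G(\tau)$; (B2) (i) $G(a\tau^b)\asymp G(\tau)$ for all $a\ge1$, $b>0$; (ii) $\tau^{-\delta}G(\tau)\to0$ for all $\delta>0$; (B3) (i) $H'(\tau)\asymp\tau^{-1}G(\tau)$; (ii) $G(\tau H(\tau)^{-1})\asymp G(\tau)$; (iii) $H(\tau)\to\infty$; (iv) $\tau^{-\delta}H(\tau)\to0$ for all $\delta>0$; (B4) there is a strictly increasing convex function $\Phi_\alpha$ on $[R,\infty)$, with $\Phi_\alpha(R)\ge R$, such that $\Phi_\alpha^{-1}(\tau)=\tau H(\tau)^{-\alpha}$ for all $\tau\in[\Phi_\alpha(R),\infty)$; (B5) there is $\eta\in(0,\theta/N)$ such that $\tau\mapsto\tau^\eta H(\tau)^{-\alpha}G(\tau)$ is increasing on $(R,\infty)$. Then there are $\varepsilon>0$ and $C\ge R$, independent of $\mu$, such that the following holds, with the convention $\Phi_\alpha^{-1}(\infty)=\infty$. If $\mu$ is a nonnegative Lebesgue measurable function on $\mathbb R^N$ with $$\sup_{x\in\mathbb R^N}\Phi_\alpha^{-1}\!\left[\frac1{|B(x,\sigma)|}\int_{B(x,\sigma)}\Phi_\alpha(\mu(y)+R)\,dy\right]\le\varepsilon\,\sigma^{-N}H(\sigma^{-1})^{-N/\theta}\quad\text{for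 all small enough }\sigma>0,$$ then $\mu\,dx$ is a Radon measure and, for some $T\in(0,1/R]$, problem (P) with $u(0)=\mu\,dx$ has a solution $u$ in $Q_T$ with $$0\le u(x,t)\le 2\,\Phi_\alpha^{-1}\big[[S(t)\Phi_\alpha(\mu+C)](x)\big]\le C\,t^{-N/\theta}H(t^{-1})^{-N/\theta}\qquad\text{in }Q_T .$$ -/

import Mathlib

open MeasureTheory Filter Topology Set
open scoped ENNReal FourierTransform

noncomputable section

/-- `f ≍ g` as `τ → ∞`: there is `C > 0` with `C⁻¹ g(τ) ≤ f(τ) ≤ C g(τ)` for all large `τ`. -/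
def AsympEq (f g : ℝ → ℝ) : Prop :=
  ∃ C : ℝ, 0 < C ∧ ∀ᶠ τ in atTop, C⁻¹ * g τ ≤ f τ ∧ f τ ≤ C * g τ

/-- The fundamental solution `Γ_θ(x,t)` of `∂ₜ u + (-Δ)^{θ/2} u = 0` in `ℝᴺ × (0,∞)`:
the inverse Fourier transform of `exp (-t |ξ|^θ)`. Mathlib's Fourier transform has the phase
`2π⟨x, ξ⟩`, hence the frequency `2π ξ` in the symbol. The integral is real; `re` only changes
its type. -/
def fracHeatKernel {N : ℕ} (θ : ℝ) (x : EuclideanSpace ℝ (Fin N)) (t : ℝ) : ℝ :=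
  (𝓕⁻ (fun ξ : EuclideanSpace ℝ (Fin N) =>
    ((Real.exp (-t * (2 * Real.pi * ‖ξ‖) ^ θ) : ℝ) : ℂ)) x).re

/-- `[S(t)m](x) = ∫ Γ_θ(x - y, t) dm(y)`, with values in `[0,∞]`. -/
def fracHeatSemigroup {N : ℕ} (θ t : ℝ) (m : Measure (EuclideanSpace ℝ (Fin N)))
    (x : EuclideanSpace ℝ (Fin N)) : ℝ≥0∞ :=
  ∫⁻ y, ENNReal.ofReal (fracHeatKernel θ (x - y) t) ∂m

/-- The measure `f(x) dx` given by a nonnegative Lebesgue measurable function `f`. -/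
def densityMeasure {N : ℕ} (f : EuclideanSpace ℝ (Fin N) → ℝ) :
    Measure (EuclideanSpace ℝ (Fin N)) :=
  volume.withDensity (fun y => ENNReal.ofReal (f y))

/-- `u` is a solution in `Q_T = ℝᴺ × (0,T)` of the problem
`∂ₜ u + (-Δ)^{θ/2} u = F(u)`, `u(0) = m`, where `m` is a nonnegative Radon measure: `u` is a
nonnegative, (Lebesgue) measurable, finite function in `Q_T` that satisfies the integral equation
for almost all `(x,t) ∈ Q_T`. Values of `u` outside `Q_T` play no role. -/
structure IsSolutionP {N : ℕ} (θ : ℝ) (F : ℝ → ℝ) (m : Measure (EuclideanSpace ℝ (Fin N)))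
    (T : ℝ) (u : EuclideanSpace ℝ (Fin N) × ℝ → ℝ) : Prop where
  radon : IsLocallyFiniteMeasure m
  nonneg : ∀ x : EuclideanSpace ℝ (Fin N), ∀ t ∈ Ioo 0 T, 0 ≤ u (x, t)
  measurable : AEMeasurable u (volume.restrict (univ ×ˢ Ioo 0 T))
  eqn : ∀ᵐ z : EuclideanSpace ℝ (Fin N) × ℝ ∂(volume.restrict (univ ×ˢ Ioo 0 T)),
    ENNReal.ofReal (u z) = fracHeatSemigroup θ z.2 m z.1 +
      ∫⁻ s in Ioo 0 z.2, ∫⁻ y : EuclideanSpace ℝ (Fin N),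
        ENNReal.ofReal (fracHeatKernel θ (z.1 - y) (z.2 - s)) * ENNReal.ofReal (F (u (y, s)))

/-- The inverse of `Φ : [R,∞) → [Φ(R),∞)`, extended by `Φ⁻¹(∞) = ∞`. -/
def extInverse (Φ : ℝ → ℝ) (R : ℝ) (y : ℝ≥0∞) : ℝ≥0∞ :=
  if y = ∞ then ∞ else ENNReal.ofReal (Function.invFunOn Φ (Ici R) y.toReal)

end

/-! ### Completely monotone functions of `‖ξ‖²` as mixtures of Gaussians -/

/-! The supersolution is `w = 2v`, where `V(t) = S(t)Φ(μ + C)` and `v = Φ⁻¹(V) = V H(V)^(-α)`.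
Jensen's inequality gives `S(t)μ ≤ v`. For the reaction term it is enough that `F(2v(s)) ≤ B g(s)
V(s)` with `g` a function of time alone: since `S(t-s)V(s) = V(t)`, the Duhamel integral is then at
most `B V(t) ∫₀ᵗ g`. The right `g` is the derivative of `s ↦ H(1/s)^(-α)/α`, whose primitive
vanishes at `0` because `H → ∞`. If moreover `H(V) ≤ C₁ H(1/t)` and `B` is small, then `B V
H(1/t)^(-α)/α ≤ V H(V)^(-α) = v`. Hence the Duhamel map sends `2v` below itself, and monotone
iteration from `0` produces a solution (`duhamel_two_mul_extInverse_le`,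
`exists_duhamel_eq_of_supersolution`).

Both bounds follow from `v ≤ e Z` with `Z = (τ/H(τ))^(N/θ)`, `τ = 1/t` and `e` small
(`exists_reaction_bound`). At the extreme value of `v`, of order `Z`, the values of `G` and `H` at
`V` are comparable to those at `τ`, since `V` lies between powers of `τ`. Then `F(2v) ≲ V H(τ)^(-α)
Z^(θ/N) G(τ)`, and criticality makes `Z^(θ/N) = τ/H(τ)`; with `G(τ) ≍ τ H'(τ)` this is exactly `V
g(t)`. Smaller values of `v` reduce to this one by (B5), and the spare exponent `θ/N - η` also
yields the small factor `e^δ`.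

The bound on `v` comes from the ball condition: `S(t)f` is controlled by averages of `f` over balls
of radius `t^(1/θ)` (`lintegral_fracHeatKernel_mul_le_of_average_le`), `Φ` is doubling and `Φ⁻¹(KV)
≤ K Φ⁻¹(V)` for `K ≥ 1` and large `V`. Comparability of `G` and `H` over whole windows `[τ^(1/M),
τ^M]` is obtained from the pointwise hypothesis by Baire's theorem.

The kernel is known only as an inverse Fourier transform. Nonnegativity and radial monotonicity are
proved by approximating `exp(-t‖ξ‖^θ)` by mixtures of Gaussians; total mass and the convolution
identity come from Fourier inversion. -/

theorem integrableOn_one_sub_exp_mul_rpow {β : ℝ} (hβ0 : 0 < β) (hβ1 : β < 1) {l : ℝ}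
    (hl : 0 ≤ l) :
    IntegrableOn (fun s : ℝ => (1 - Real.exp (-(l * s))) * s ^ (-1 - β)) (Ioi 0) := by
  have hmeas : Measurable (fun s : ℝ => (1 - Real.exp (-(l * s))) * s ^ (-1 - β)) := by fun_prop
  have hbd : ∀ s : ℝ, 0 < s → 0 ≤ 1 - Real.exp (-(l * s)) := fun s hs => by
    have : Real.exp (-(l * s)) ≤ 1 := Real.exp_le_one_iff.2 (by have := mul_nonneg hl hs.le; linarith)
    linarith
  rw [← Ioc_union_Ioi_eq_Ioi (zero_le_one' ℝ)]
  refine IntegrableOn.union ?_ ?_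
  · have h1 : IntegrableOn (fun s : ℝ => l * s ^ (-β)) (Ioc 0 1) := by
      refine Integrable.const_mul ?_ l
      rw [← IntegrableOn, integrableOn_Ioc_iff_integrableOn_Ioo]
      exact (intervalIntegral.integrableOn_Ioo_rpow_iff one_pos).2 (by linarith)
    refine Integrable.mono' h1 hmeas.aestronglyMeasurable ?_
    filter_upwards [ae_restrict_mem measurableSet_Ioc] with s hs
    have hs0 := hs.1
    rw [Real.norm_eq_abs, abs_mul, abs_of_nonneg (hbd s hs0), abs_of_nonneg (by positivity)]
    have h2 : 1 - Real.exp (-(l * s)) ≤ l * s := by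
      have := Real.add_one_le_exp (-(l * s)); linarith
    calc _ ≤ (l * s) * s ^ (-1 - β) := by gcongr
      _ = l * s ^ (-β) := by
        rw [mul_assoc]; congr 1
        nth_rewrite 1 [← Real.rpow_one s]
        rw [← Real.rpow_add hs0]; ring_nf
  · refine Integrable.mono' (integrableOn_Ioi_rpow_of_lt (a := -1 - β) (by linarith) one_pos)
      hmeas.aestronglyMeasurable ?_
    filter_upwards [ae_restrict_mem measurableSet_Ioi] with s hs
    have hs0 : (0 : ℝ) < s := lt_trans one_pos hs
    rw [Real.norm_eq_abs, abs_mul, abs_of_nonneg (hbd s hs0), abs_of_nonneg (by positivity)]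
    have : 1 - Real.exp (-(l * s)) ≤ 1 := by linarith [Real.exp_pos (-(l * s))]
    exact mul_le_of_le_one_left (by positivity) this

/-- Substituting `s ↦ s / l` exhibits `l^β` as a multiple of an integral of `1 - exp(-ls)`, the
Bernstein representation. It will be used with `l = ‖ξ‖²` and `β = θ/2`. -/
theorem integral_one_sub_exp_mul_rpow {β : ℝ} (hβ0 : 0 < β) {l : ℝ}
    (hl : 0 ≤ l) :
    ∫ s in Ioi (0 : ℝ), (1 - Real.exp (-(l * s))) * s ^ (-1 - β) =
      l ^ β * ∫ s in Ioi (0 : ℝ), (1 - Real.exp (-s)) * s ^ (-1 - β) := by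
  rcases hl.eq_or_lt with rfl | hl
  · simp [Real.zero_rpow hβ0.ne']
  have h := integral_comp_mul_left_Ioi (fun s : ℝ => (1 - Real.exp (-s)) * s ^ (-1 - β)) 0 hl
  rw [mul_zero] at h
  have h2 : ∫ s in Ioi (0 : ℝ), (1 - Real.exp (-(l * s))) * s ^ (-1 - β) =
      l ^ (1 + β) * ∫ s in Ioi (0 : ℝ), (1 - Real.exp (-(l * s))) * (l * s) ^ (-1 - β) := by
    rw [← integral_const_mul]
    refine setIntegral_congr_fun measurableSet_Ioi fun s hs => ?_
    have hs : 0 < s := hs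
    rw [Real.mul_rpow hl.le hs.le]
    have : l ^ (1 + β) * l ^ (-1 - β) = 1 := by
      rw [← Real.rpow_add hl]; simp
    calc _ = (l ^ (1 + β) * l ^ (-1 - β)) * ((1 - Real.exp (-(l * s))) * s ^ (-1 - β)) := by
          rw [this, one_mul]
      _ = _ := by ring
  rw [h2, h, smul_eq_mul, ← mul_assoc]
  congr 1
  rw [add_comm, Real.rpow_add hl, Real.rpow_one, mul_assoc, mul_inv_cancel₀ hl.ne', mul_one]

theorem integral_one_sub_exp_mul_rpow_pos {β : ℝ} (hβ0 : 0 < β) (hβ1 : β < 1) :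
    0 < ∫ s in Ioi (0 : ℝ), (1 - Real.exp (-s)) * s ^ (-1 - β) := by
  have hpos : ∀ s ∈ Ioi (0 : ℝ), 0 < (1 - Real.exp (-s)) * s ^ (-1 - β) := fun s hs => by
    have hs : 0 < s := hs
    have : Real.exp (-s) < 1 := (by rw [← Real.exp_zero]; exact Real.exp_lt_exp.2 (by linarith))
    have : 0 < 1 - Real.exp (-s) := by linarith
    positivity
  rw [setIntegral_pos_iff_support_of_nonneg_ae]
  · have : Function.support (fun s : ℝ => (1 - Real.exp (-s)) * s ^ (-1 - β)) ∩ Ioi 0 = Ioi 0 :=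
      inter_eq_right.2 fun s hs => (hpos s hs).ne'
    rw [this]; simp
  · filter_upwards [ae_restrict_mem measurableSet_Ioi] with s hs using (hpos s hs).le
  · simpa using integrableOn_one_sub_exp_mul_rpow hβ0 hβ1 zero_le_one

section Mixture

variable {E : Type*} [NormedAddCommGroup E] [InnerProductSpace ℝ E] [FiniteDimensional ℝ E]
  [MeasurableSpace E] [BorelSpace E]

theorem integrable_exp_neg_mul_norm_sq {b : ℝ} (hb : 0 < b) :
    Integrable (fun ξ : E => Real.exp (-b * ‖ξ‖ ^ 2)) := by
  have := (GaussianFourier.integrable_cexp_neg_mul_sq_norm_add (V := E) (b := (b : ℂ))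
    (by simpa using hb) 0 0).norm
  refine this.congr (ae_of_all _ fun ξ => ?_)
  simp only [zero_mul, add_zero, Complex.norm_exp]
  congr 1
  norm_cast

/-- The bounded functions `g` of `‖ξ‖²` whose products with Gaussians integrate to nonnegative
numbers against `κ`. -/
structure GaussNonneg (κ : E → ℝ) (g : ℝ → ℝ) : Prop where
  measurable : Measurable g
  bounded : ∃ B, ∀ l, 0 ≤ l → |g l| ≤ B
  nonneg : ∀ b : ℝ, 0 < b → 0 ≤ ∫ ξ : E, g (‖ξ‖ ^ 2) * Real.exp (-b * ‖ξ‖ ^ 2) * κ ξ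

namespace GaussNonneg

variable {κ : E → ℝ} {g h : ℝ → ℝ} {K : ℝ}

theorem integrable (hκ : Measurable κ) (hK : ∀ ξ, |κ ξ| ≤ K) (hg : Measurable g)
    {B : ℝ} (hB : ∀ l, 0 ≤ l → |g l| ≤ B) {b : ℝ} (hb : 0 < b) :
    Integrable (fun ξ : E => g (‖ξ‖ ^ 2) * Real.exp (-b * ‖ξ‖ ^ 2) * κ ξ) := by
  have hm : Measurable (fun ξ : E => g (‖ξ‖ ^ 2) * Real.exp (-b * ‖ξ‖ ^ 2) * κ ξ) := by fun_prop
  refine Integrable.mono' ((integrable_exp_neg_mul_norm_sq (E := E) hb).const_mul (B * K))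
    hm.aestronglyMeasurable (ae_of_all _ fun ξ => ?_)
  have h1 := hB (‖ξ‖ ^ 2) (by positivity)
  have h2 := hK ξ
  have hB0 : 0 ≤ B := (abs_nonneg _).trans h1
  rw [Real.norm_eq_abs, abs_mul, abs_mul, abs_of_pos (Real.exp_pos _)]
  calc _ ≤ B * Real.exp (-b * ‖ξ‖ ^ 2) * K := by gcongr
    _ = _ := by ring

theorem add (hκ : Measurable κ) (hK : ∀ ξ, |κ ξ| ≤ K) (hg : GaussNonneg κ g)
    (hh : GaussNonneg κ h) : GaussNonneg κ (fun l => g l + h l) where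
  measurable := hg.measurable.add hh.measurable
  bounded := by
    obtain ⟨B, hB⟩ := hg.bounded
    obtain ⟨B', hB'⟩ := hh.bounded
    exact ⟨B + B', fun l hl => (abs_add_le _ _).trans (add_le_add (hB l hl) (hB' l hl))⟩
  nonneg b hb := by
    obtain ⟨B, hB⟩ := hg.bounded
    obtain ⟨B', hB'⟩ := hh.bounded
    simp only [add_mul]
    rw [integral_add (integrable hκ hK hg.measurable hB hb)
      (integrable hκ hK hh.measurable hB' hb)]
    exact add_nonneg (hg.nonneg b hb) (hh.nonneg b hb)

theorem const_mul {c : ℝ} (hc : 0 ≤ c) (hg : GaussNonneg κ g) :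
    GaussNonneg κ (fun l => c * g l) where
  measurable := hg.measurable.const_mul c
  bounded := by
    obtain ⟨B, hB⟩ := hg.bounded
    exact ⟨c * B, fun l hl => by rw [abs_mul, abs_of_nonneg hc]; gcongr; exact hB l hl⟩
  nonneg b hb := by
    simp only [mul_assoc c]
    rw [integral_const_mul]
    exact mul_nonneg hc (hg.nonneg b hb)

theorem of_tendsto (hκ : Measurable κ) (hK : ∀ ξ, |κ ξ| ≤ K) {f : ℕ → ℝ → ℝ}
    (hf : ∀ n, GaussNonneg κ (f n)) {B : ℝ} (hB : ∀ n l, 0 ≤ l → |f n l| ≤ B)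
    (hg : Measurable g) (hlim : ∀ l, 0 ≤ l → Tendsto (fun n => f n l) atTop (𝓝 (g l))) :
    GaussNonneg κ g where
  measurable := hg
  bounded := ⟨B, fun l hl => le_of_tendsto (hlim l hl).abs (Eventually.of_forall fun n => hB n l hl)⟩
  nonneg b hb := by
    refine ge_of_tendsto' (f := fun n => ∫ ξ : E, f n (‖ξ‖ ^ 2) * Real.exp (-b * ‖ξ‖ ^ 2) * κ ξ)
      (tendsto_integral_of_dominated_convergence (fun ξ => (B * K) * Real.exp (-b * ‖ξ‖ ^ 2))
        (fun n => (integrable hκ hK (hf n).measurable (hB n) hb).aestronglyMeasurable)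
        ((integrable_exp_neg_mul_norm_sq (E := E) hb).const_mul (B * K)) ?_ ?_)
      (fun n => (hf n).nonneg b hb)
    · refine fun n => ae_of_all _ fun ξ => ?_
      have h1 := hB n (‖ξ‖ ^ 2) (by positivity)
      have h2 := hK ξ
      have hB0 : 0 ≤ B := (abs_nonneg _).trans h1
      rw [Real.norm_eq_abs, abs_mul, abs_mul, abs_of_pos (Real.exp_pos _)]
      calc _ ≤ B * Real.exp (-b * ‖ξ‖ ^ 2) * K := by gcongr
        _ = _ := by ring
    · exact ae_of_all _ fun ξ => ((hlim _ (by positivity)).mul_const _).mul_const _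

/-- Multiplication by a Laplace transform of a finite measure on `(r, ∞)`. -/
theorem laplace_mul (hκ : Measurable κ) (hK : ∀ ξ, |κ ξ| ≤ K) (hg : GaussNonneg κ g)
    {r : ℝ} (hr : 0 < r) {w : ℝ → ℝ} (hw : IntegrableOn w (Ioi r)) (hwm : Measurable w)
    (hw0 : ∀ s, r < s → 0 ≤ w s) :
    GaussNonneg κ (fun l => (∫ s in Ioi r, Real.exp (-(l * s)) * w s) * g l) where
  measurable := by
    refine Measurable.mul ?_ hg.measurable
    have : StronglyMeasurable (fun l : ℝ => ∫ s in Ioi r, Real.exp (-(l * s)) * w s) := by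
      refine StronglyMeasurable.integral_prod_right (f := fun l s => Real.exp (-(l * s)) * w s) ?_
      exact Measurable.stronglyMeasurable (by fun_prop)
    exact this.measurable
  bounded := by
    obtain ⟨B, hB⟩ := hg.bounded
    refine ⟨(∫ s in Ioi r, w s) * B, fun l hl => ?_⟩
    rw [abs_mul]
    refine mul_le_mul ?_ (hB l hl) (abs_nonneg _) (setIntegral_nonneg measurableSet_Ioi hw0)
    rw [← Real.norm_eq_abs]
    refine norm_integral_le_of_norm_le hw ?_
    filter_upwards [ae_restrict_mem measurableSet_Ioi] with s hs
    rw [Real.norm_eq_abs, abs_mul, abs_of_pos (Real.exp_pos _), abs_of_nonneg (hw0 s hs)]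
    refine mul_le_of_le_one_left (hw0 s hs) (Real.exp_le_one_iff.2 ?_)
    have := mul_nonneg hl (hr.trans hs).le
    linarith
  nonneg b hb := by
    obtain ⟨B, hB⟩ := hg.bounded
    have hgm := hg.measurable
    have hB0 : 0 ≤ B := (abs_nonneg _).trans (hB 0 le_rfl)
    set F : E → ℝ → ℝ := fun ξ s =>
      w s * (g (‖ξ‖ ^ 2) * Real.exp (-(b + s) * ‖ξ‖ ^ 2) * κ ξ) with hF
    have hInt : Integrable (Function.uncurry F) (volume.prod (volume.restrict (Ioi r))) := by
      have h1 : Integrable (fun z : E × ℝ => Real.exp (-b * ‖z.1‖ ^ 2) * w z.2)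
          (volume.prod (volume.restrict (Ioi r))) :=
        (integrable_exp_neg_mul_norm_sq (E := E) hb).mul_prod hw
      refine Integrable.mono' (h1.const_mul (B * K)) ?_ ?_
      · exact Measurable.aestronglyMeasurable (by simp only [hF, Function.uncurry_def]; fun_prop)
      · have h2 : ∀ᵐ z : E × ℝ ∂(volume.prod (volume.restrict (Ioi r))), z.2 ∈ Ioi r := by
          have := Measure.quasiMeasurePreserving_snd (μ := (volume : Measure E))
            (ν := volume.restrict (Ioi r))
          exact this.ae (ae_restrict_mem measurableSet_Ioi)
        filter_upwards [h2] with z hz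
        have hz' : r < z.2 := hz
        have h3 := hB (‖z.1‖ ^ 2) (by positivity)
        have h4 := hK z.1
        have h5 : Real.exp (-(b + z.2) * ‖z.1‖ ^ 2) ≤ Real.exp (-b * ‖z.1‖ ^ 2) := by
          refine Real.exp_le_exp.2 ?_
          have := mul_nonneg (hr.trans hz').le (sq_nonneg ‖z.1‖)
          linarith
        simp only [hF, Function.uncurry_def, Real.norm_eq_abs, abs_mul,
          abs_of_pos (Real.exp_pos _), abs_of_nonneg (hw0 _ hz')]
        calc _ ≤ w z.2 * (B * Real.exp (-b * ‖z.1‖ ^ 2) * K) := by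
              have := hw0 _ hz'
              gcongr
          _ = _ := by ring
    have h1 : ∫ ξ : E, (∫ s in Ioi r, Real.exp (-(‖ξ‖ ^ 2 * s)) * w s) * g (‖ξ‖ ^ 2) *
        Real.exp (-b * ‖ξ‖ ^ 2) * κ ξ = ∫ ξ : E, ∫ s in Ioi r, F ξ s := by
      congr 1; ext ξ
      rw [mul_assoc, mul_assoc, ← integral_mul_const]
      congr 1; ext s
      simp only [hF]
      rw [show -(b + s) * ‖ξ‖ ^ 2 = -(‖ξ‖ ^ 2 * s) + -b * ‖ξ‖ ^ 2 by ring, Real.exp_add]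
      ring
    -- After Fubini the factor `exp(-s‖ξ‖²)` merges into the Gaussian weight, changing `b` to `b +
    -- s`; this is why the class tests every `b > 0`.
    rw [h1, integral_integral_swap hInt]
    refine setIntegral_nonneg measurableSet_Ioi fun s hs => ?_
    simp only [hF]
    rw [integral_const_mul]
    exact mul_nonneg (hw0 s hs) (hg.nonneg _ (by have := hr.trans hs; linarith))

/-- Powers of the Laplace transform stay in the class by `laplace_mul`, hence so do the partial sums
of the exponential series, whose coefficients are nonnegative for `t ≥ 0`. -/
theorem exp_laplace (hκ : Measurable κ) (hK : ∀ ξ, |κ ξ| ≤ K) (h1 : GaussNonneg κ (fun _ => 1))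
    {r : ℝ} (hr : 0 < r) {w : ℝ → ℝ} (hw : IntegrableOn w (Ioi r)) (hwm : Measurable w)
    (hw0 : ∀ s, r < s → 0 ≤ w s) {t : ℝ} (ht : 0 ≤ t) :
    GaussNonneg κ (fun l => Real.exp (t * ∫ s in Ioi r, Real.exp (-(l * s)) * w s)) := by
  set m : ℝ → ℝ := fun l => ∫ s in Ioi r, Real.exp (-(l * s)) * w s with hm
  have hpow : ∀ n : ℕ, GaussNonneg κ (fun l => m l ^ n) := by
    intro n
    induction n with
    | zero => simpa using h1
    | succ n ih =>
      have := laplace_mul hκ hK ih hr hw hwm hw0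
      simpa only [pow_succ'] using this
  have hsum : ∀ n : ℕ, GaussNonneg κ
      (fun l => ∑ k ∈ Finset.range n, (t * m l) ^ k / (k.factorial : ℝ)) := by
    intro n
    induction n with
    | zero =>
      simp only [Finset.range_zero, Finset.sum_empty]
      simpa using const_mul (c := 0) le_rfl h1
    | succ n ih =>
      simp only [Finset.sum_range_succ]
      refine add hκ hK ih ?_
      have := const_mul (c := t ^ n / n.factorial) (by positivity) (hpow n)
      have he : (fun l => (t * m l) ^ n / (n.factorial : ℝ)) =
          fun l => t ^ n / n.factorial * m l ^ n := by
        ext l; rw [mul_pow]; ring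
      rwa [he]
  obtain ⟨B, hB⟩ : ∃ B, ∀ l, 0 ≤ l → |m l| ≤ B := by simpa using (hpow 1).bounded
  have hmm : Measurable m := by simpa using (hpow 1).measurable
  refine of_tendsto hκ hK hsum (B := Real.exp (t * B)) ?_
    (Real.measurable_exp.comp (hmm.const_mul t)) ?_
  · intro n l hl
    calc _ ≤ ∑ k ∈ Finset.range n, |(t * m l) ^ k / (k.factorial : ℝ)| :=
          Finset.abs_sum_le_sum_abs _ _
      _ ≤ ∑ k ∈ Finset.range n, (t * B) ^ k / (k.factorial : ℝ) := by
          refine Finset.sum_le_sum fun k _ => ?_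
          rw [abs_div, abs_pow, abs_mul, abs_of_nonneg ht, Nat.abs_cast]
          gcongr
          exact hB l hl
      _ ≤ _ := Real.sum_le_exp_of_nonneg (mul_nonneg ht ((abs_nonneg _).trans (hB l hl))) n
  · intro l _
    have := (NormedSpace.expSeries_div_hasSum_exp (t * m l)).tendsto_sum_nat
    rwa [← Real.exp_eq_exp_ℝ] at this

/-- The measure `s^(-1-β) ds` is infinite near `0`. Cut off at `s > 1/(n+1)` it is finite, and
`exp(-∫(1 - e^(-ls)))` factors as a positive constant times the exponential of a Laplace transform.
The cutoff is then removed by bounded pointwise convergence. -/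
theorem exp_neg_rpow (hκ : Measurable κ) (hK : ∀ ξ, |κ ξ| ≤ K) (h1 : GaussNonneg κ (fun _ => 1))
    {β : ℝ} (hβ0 : 0 < β) (hβ1 : β < 1) {t : ℝ} (ht : 0 ≤ t) :
    GaussNonneg κ (fun l => Real.exp (-(t * l ^ β))) := by
  set I := ∫ s in Ioi (0 : ℝ), (1 - Real.exp (-s)) * s ^ (-1 - β) with hI
  have hI0 : 0 < I := integral_one_sub_exp_mul_rpow_pos hβ0 hβ1
  set r : ℕ → ℝ := fun n => 1 / ((n : ℝ) + 1) with hr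
  have hr0 : ∀ n, 0 < r n := fun n => by positivity
  set f : ℕ → ℝ → ℝ := fun n l =>
    t / I * ∫ s in Ioi (r n), (1 - Real.exp (-(l * s))) * s ^ (-1 - β) with hf
  have hw : ∀ n, IntegrableOn (fun s : ℝ => s ^ (-1 - β)) (Ioi (r n)) := fun n =>
    integrableOn_Ioi_rpow_of_lt (by linarith) (hr0 n)
  have hsub : ∀ n, Ioi (r n) ⊆ Ioi (0 : ℝ) := fun n => Ioi_subset_Ioi (hr0 n).le
  have hnn : ∀ n l, 0 ≤ l → 0 ≤ f n l := by
    intro n l hl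
    refine mul_nonneg (by positivity) (setIntegral_nonneg measurableSet_Ioi fun s hs => ?_)
    have hs : 0 < s := hsub n hs
    have : Real.exp (-(l * s)) ≤ 1 := Real.exp_le_one_iff.2 (by nlinarith)
    have : 0 ≤ 1 - Real.exp (-(l * s)) := by linarith
    positivity
  have hfn : ∀ n l, 0 ≤ l → f n l = t / I * (∫ s in Ioi (r n), s ^ (-1 - β)) -
      t / I * ∫ s in Ioi (r n), Real.exp (-(l * s)) * s ^ (-1 - β) := by
    intro n l hl
    have h2 : IntegrableOn (fun s : ℝ => Real.exp (-(l * s)) * s ^ (-1 - β)) (Ioi (r n)) := by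
      have := (hw n).sub ((integrableOn_one_sub_exp_mul_rpow hβ0 hβ1 hl).mono_set (hsub n))
      refine this.congr (ae_of_all _ fun s => ?_)
      simp only [Pi.sub_apply]; ring
    rw [← mul_sub, ← integral_sub (hw n) h2]
    simp only [hf]
    congr 2; ext s; ring
  have hlim : ∀ l, 0 ≤ l → Tendsto (fun n => f n l) atTop (𝓝 (t * l ^ β)) := by
    intro l hl
    have h3 : Tendsto (fun n => ∫ s in Ioi (r n), (1 - Real.exp (-(l * s))) * s ^ (-1 - β)) atTop
        (𝓝 (∫ s in ⋃ n, Ioi (r n), (1 - Real.exp (-(l * s))) * s ^ (-1 - β))) := by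
      refine tendsto_setIntegral_of_monotone (fun n => measurableSet_Ioi) ?_ ?_
      · intro a b hab
        refine Ioi_subset_Ioi ?_
        simp only [hr]
        gcongr
      · refine (integrableOn_one_sub_exp_mul_rpow hβ0 hβ1 hl).mono_set (iUnion_subset hsub)
    have h4 : ⋃ n, Ioi (r n) = Ioi (0 : ℝ) := by
      refine subset_antisymm (iUnion_subset hsub) fun s hs => ?_
      obtain ⟨n, hn⟩ := exists_nat_one_div_lt (show 0 < s from hs)
      exact mem_iUnion.2 ⟨n, hn⟩
    rw [h4, integral_one_sub_exp_mul_rpow hβ0 hl] at h3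
    have h5 := h3.const_mul (t / I)
    rwa [show t / I * (l ^ β * I) = t * l ^ β by field_simp] at h5
  have hclass : ∀ n, GaussNonneg κ (fun l => Real.exp (-(t / I * ∫ s in Ioi (r n), s ^ (-1 - β))) *
      Real.exp (t / I * ∫ s in Ioi (r n), Real.exp (-(l * s)) * s ^ (-1 - β))) := fun n =>
    const_mul (Real.exp_pos _).le (exp_laplace hκ hK h1 (hr0 n) (hw n) (by fun_prop)
      (fun s hs => Real.rpow_nonneg (hsub n hs).le _) (by positivity))
  have heq : ∀ n l, 0 ≤ l → Real.exp (-(t / I * ∫ s in Ioi (r n), s ^ (-1 - β))) *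
      Real.exp (t / I * ∫ s in Ioi (r n), Real.exp (-(l * s)) * s ^ (-1 - β)) =
      Real.exp (-f n l) := by
    intro n l hl
    rw [hfn n l hl, ← Real.exp_add]; congr 1; ring
  refine of_tendsto hκ hK hclass (B := 1) ?_ (by fun_prop) ?_
  · intro n l hl
    rw [heq n l hl, abs_of_pos (Real.exp_pos _)]
    exact Real.exp_le_one_iff.2 (by have := hnn n l hl; linarith)
  · intro l hl
    simp only [heq _ l hl]
    exact (Real.continuous_exp.tendsto _).comp (hlim l hl).neg

end GaussNonneg

theorem integrable_exp_neg_mul_norm_rpow {t θ : ℝ} (ht : 0 < t) (hθ : 0 < θ) :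
    Integrable (fun ξ : E => Real.exp (-t * (2 * Real.pi * ‖ξ‖) ^ θ)) := by
  obtain ⟨r, hr⟩ : ∃ r : ℝ, (Module.finrank ℝ E : ℝ) < r := exists_gt _
  have hr0 : 0 < r := lt_of_le_of_lt (by positivity) hr
  have hlim : Tendsto (fun x : ℝ => x ^ (r / θ) * Real.exp (-x)) atTop (𝓝 0) := by
    have := tendsto_rpow_mul_exp_neg_mul_atTop_nhds_zero (r / θ) 1 one_pos
    simpa using this
  have hcomp : Tendsto (fun x : ℝ => t * (2 * Real.pi * x) ^ θ) atTop atTop :=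
    ((tendsto_rpow_atTop hθ).comp (tendsto_id.const_mul_atTop (by positivity))).const_mul_atTop ht
  have hev := (hlim.comp hcomp).eventually (eventually_le_nhds zero_lt_one)
  obtain ⟨A, hA1, hA⟩ : ∃ A : ℝ, 1 ≤ A ∧ ∀ x, A ≤ x →
      (t * (2 * Real.pi * x) ^ θ) ^ (r / θ) * Real.exp (-(t * (2 * Real.pi * x) ^ θ)) ≤ 1 := by
    obtain ⟨A, hA⟩ := (hev.and (eventually_ge_atTop 1)).exists_forall_of_atTop
    exact ⟨max A 1, le_max_right _ _, fun x hx => (hA x ((le_max_left _ _).trans hx)).1⟩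
  set c := (t ^ (r / θ) * (2 * Real.pi) ^ r)⁻¹ with hc
  have hc0 : 0 < c := by positivity
  refine Integrable.mono' ((integrable_one_add_norm (E := E) (μ := volume) hr).const_mul
    (2 ^ r * c + (1 + A) ^ r)) (Measurable.aestronglyMeasurable (by fun_prop))
    (ae_of_all _ fun ξ => ?_)
  rw [Real.norm_eq_abs, abs_of_pos (Real.exp_pos _), add_mul]
  have hx0 := norm_nonneg ξ
  set x := ‖ξ‖
  rcases le_total A x with h | h
  · have hx1 : 1 ≤ x := hA1.trans h
    have h1 := hA x h
    have h2 : (t * (2 * Real.pi * x) ^ θ) ^ (r / θ) = c⁻¹ * x ^ r := by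
      rw [Real.mul_rpow ht.le (by positivity), ← Real.rpow_mul (by positivity),
        mul_div_cancel₀ _ hθ.ne', Real.mul_rpow (by positivity) hx0, hc, inv_inv]
      ring
    rw [h2] at h1
    have h3 : Real.exp (-(t * (2 * Real.pi * x) ^ θ)) ≤ c * x ^ (-r) := by
      rw [Real.rpow_neg hx0]
      have : 0 < x ^ r := by positivity
      rw [← div_eq_mul_inv, le_div_iff₀ this]
      calc _ = c * (c⁻¹ * x ^ r * Real.exp (-(t * (2 * Real.pi * x) ^ θ))) := by
            field_simp
        _ ≤ c * 1 := by gcongr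
        _ = c := mul_one c
    have h4 : x ^ (-r) ≤ 2 ^ r * (1 + x) ^ (-r) := by
      rw [Real.rpow_neg hx0, Real.rpow_neg (by positivity), ← div_eq_mul_inv,
        ← Real.div_rpow (by norm_num) (by positivity), ← Real.inv_rpow hx0]
      gcongr
      rw [inv_eq_one_div, div_le_div_iff₀ (by positivity) (by positivity)]
      linarith
    rw [neg_mul]
    have h5 : 0 ≤ (1 + A) ^ r * (1 + x) ^ (-r) := by positivity
    calc _ ≤ c * x ^ (-r) := h3
      _ ≤ c * (2 ^ r * (1 + x) ^ (-r)) := by gcongr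
      _ ≤ _ := by linarith
  · have h1 : Real.exp (-t * (2 * Real.pi * x) ^ θ) ≤ 1 := Real.exp_le_one_iff.2 (by
      have : 0 ≤ t * (2 * Real.pi * x) ^ θ := by positivity
      linarith)
    have h2 : 1 ≤ (1 + A) ^ r * (1 + x) ^ (-r) := by
      rw [Real.rpow_neg (by positivity), ← div_eq_mul_inv, one_le_div (by positivity)]
      gcongr
    have h3 : 0 ≤ 2 ^ r * c * (1 + x) ^ (-r) := by positivity
    linarith

/-- Subordination in weak form: a sign that holds against all Gaussians holds against
`exp(-t(2π‖ξ‖)^θ)`. It is applied with `κ` a cosine, for positivity of the kernel, and with a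
difference of cosines, for its monotonicity. -/
theorem integral_exp_neg_rpow_mul_nonneg {κ : E → ℝ} {K : ℝ} (hκ : Measurable κ)
    (hK : ∀ ξ, |κ ξ| ≤ K) (h1 : ∀ b : ℝ, 0 < b → 0 ≤ ∫ ξ : E, Real.exp (-b * ‖ξ‖ ^ 2) * κ ξ)
    {t θ : ℝ} (ht : 0 < t) (hθ0 : 0 < θ) (hθ2 : θ ≤ 2) :
    0 ≤ ∫ ξ : E, Real.exp (-t * (2 * Real.pi * ‖ξ‖) ^ θ) * κ ξ := by
  rcases hθ2.eq_or_lt with rfl | hθ2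
  · have := h1 (t * (2 * Real.pi) ^ 2) (by positivity)
    convert this using 5 with ξ
    rw [Real.rpow_two]; ring
  have hc : GaussNonneg κ (fun _ => 1) :=
    ⟨measurable_const, ⟨1, fun _ _ => by simp⟩, fun b hb => by simpa using h1 b hb⟩
  have h2 := GaussNonneg.exp_neg_rpow hκ hK hc (β := θ / 2) (by positivity) (by linarith)
    (t := t * (2 * Real.pi) ^ θ) (by positivity)
  have h3 : ∀ ξ : E, Real.exp (-(t * (2 * Real.pi) ^ θ * (‖ξ‖ ^ 2) ^ (θ / 2))) =
      Real.exp (-t * (2 * Real.pi * ‖ξ‖) ^ θ) := by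
    intro ξ
    rw [Real.mul_rpow (by positivity) (norm_nonneg _), ← Real.rpow_natCast, ← Real.rpow_mul
      (norm_nonneg _)]
    congr 1
    rw [show ((2 : ℕ) : ℝ) * (θ / 2) = θ by push_cast; ring]; ring
  -- The class gives the sign only with an extra Gaussian factor; its parameter `b n` is sent to
  -- `0`.
  set b : ℕ → ℝ := fun n => 1 / ((n : ℝ) + 1) with hb
  have hb0 : ∀ n, 0 < b n := fun n => by positivity
  refine ge_of_tendsto' (tendsto_integral_of_dominated_convergence
    (F := fun n ξ => Real.exp (-t * (2 * Real.pi * ‖ξ‖) ^ θ) * Real.exp (-b n * ‖ξ‖ ^ 2) * κ ξ)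
    (fun ξ => Real.exp (-t * (2 * Real.pi * ‖ξ‖) ^ θ) * K)
    (fun n => Measurable.aestronglyMeasurable (by fun_prop))
    ((integrable_exp_neg_mul_norm_rpow ht hθ0).mul_const K) ?_ ?_) (fun n => ?_)
  · refine fun n => ae_of_all _ fun ξ => ?_
    rw [Real.norm_eq_abs, abs_mul, abs_mul, abs_of_pos (Real.exp_pos _), abs_of_pos (Real.exp_pos _)]
    have h4 : Real.exp (-b n * ‖ξ‖ ^ 2) ≤ 1 := Real.exp_le_one_iff.2 (by
      have := mul_nonneg (hb0 n).le (sq_nonneg ‖ξ‖); linarith)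
    calc _ ≤ Real.exp (-t * (2 * Real.pi * ‖ξ‖) ^ θ) * 1 * K := by gcongr; exact hK ξ
      _ = _ := by rw [mul_one]
  · refine ae_of_all _ fun ξ => Tendsto.mul_const _ ?_
    have h5 : Tendsto (fun n => Real.exp (-b n * ‖ξ‖ ^ 2)) atTop (𝓝 (Real.exp (-0 * ‖ξ‖ ^ 2))) :=
      (Real.continuous_exp.tendsto _).comp
        ((tendsto_one_div_add_atTop_nhds_zero_nat.neg).mul_const _)
    simpa using h5.const_mul (Real.exp (-t * (2 * Real.pi * ‖ξ‖) ^ θ))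
  · have := h2.nonneg (b n) (hb0 n)
    simpa only [h3] using this

end Mixture

/-! ### The fractional heat kernel -/

section Kernel

variable {N : ℕ} {θ : ℝ}

theorem integral_exp_neg_mul_sq_mul_cos {b : ℝ} (hb : 0 < b) (x : EuclideanSpace ℝ (Fin N)) :
    ∫ ξ : EuclideanSpace ℝ (Fin N), Real.exp (-b * ‖ξ‖ ^ 2) * Real.cos (2 * Real.pi * inner ℝ ξ x) =
      (Real.pi / b) ^ ((N : ℝ) / 2) * Real.exp (-Real.pi ^ 2 * ‖x‖ ^ 2 / b) := by
  have h := fourier_gaussian_innerProductSpace (V := EuclideanSpace ℝ (Fin N)) (b := (b : ℂ))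
    (by simpa using hb) x
  rw [Real.fourier_eq'] at h
  have h2 : ((∫ v : EuclideanSpace ℝ (Fin N), Complex.exp (↑(-2 * Real.pi * inner ℝ v x) * Complex.I) •
      Complex.exp (-(b : ℂ) * (‖v‖ : ℂ) ^ 2))).re =
      ∫ ξ : EuclideanSpace ℝ (Fin N), Real.exp (-b * ‖ξ‖ ^ 2) *
        Real.cos (2 * Real.pi * inner ℝ ξ x) := by
    have hint : Integrable (fun v : EuclideanSpace ℝ (Fin N) =>
        Complex.exp (↑(-2 * Real.pi * inner ℝ v x) * Complex.I) •
          Complex.exp (-(b : ℂ) * (‖v‖ : ℂ) ^ 2)) := by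
      refine Integrable.mono' (integrable_exp_neg_mul_norm_sq hb)
        (Continuous.aestronglyMeasurable (by fun_prop)) (ae_of_all _ fun v => le_of_eq ?_)
      rw [norm_smul, Complex.norm_exp_ofReal_mul_I, one_mul, Complex.norm_exp]
      congr 1; norm_cast
    have := integral_re hint
    simp only [RCLike.re_to_complex] at this
    rw [← this]
    congr 1; ext v
    rw [show -(b : ℂ) * (‖v‖ : ℂ) ^ 2 = ((-b * ‖v‖ ^ 2 : ℝ) : ℂ) by push_cast; ring,
      ← Complex.ofReal_exp, smul_eq_mul, Complex.re_mul_ofReal, Complex.exp_ofReal_mul_I_re,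
      show -2 * Real.pi * inner ℝ v x = -(2 * Real.pi * inner ℝ v x) by ring, Real.cos_neg, mul_comm]
  rw [← h2, h, finrank_euclideanSpace_fin]
  rw [show ((Real.pi : ℂ) / b) ^ ((N : ℂ) / 2) * Complex.exp (-(Real.pi : ℂ) ^ 2 * (‖x‖ : ℂ) ^ 2 / b) =
    (((Real.pi / b) ^ ((N : ℝ) / 2) * Real.exp (-Real.pi ^ 2 * ‖x‖ ^ 2 / b) : ℝ) : ℂ) by
      push_cast
      rw [Complex.ofReal_cpow (by positivity)]
      push_cast
      rfl]
  exact Complex.ofReal_re _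

theorem fracHeatKernel_eq_integral_cos (hθ : 0 < θ) {t : ℝ} (ht : 0 < t)
    (x : EuclideanSpace ℝ (Fin N)) :
    fracHeatKernel θ x t = ∫ ξ : EuclideanSpace ℝ (Fin N),
      Real.exp (-t * (2 * Real.pi * ‖ξ‖) ^ θ) * Real.cos (2 * Real.pi * inner ℝ ξ x) := by
  rw [fracHeatKernel, Real.fourierInv_eq']
  have hint : Integrable (fun v : EuclideanSpace ℝ (Fin N) =>
      Complex.exp (↑(2 * Real.pi * inner ℝ v x) * Complex.I) •
        ((Real.exp (-t * (2 * Real.pi * ‖v‖) ^ θ) : ℝ) : ℂ)) := by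
    refine Integrable.mono' (integrable_exp_neg_mul_norm_rpow ht hθ)
      (Measurable.aestronglyMeasurable (by fun_prop)) (ae_of_all _ fun v => le_of_eq ?_)
    rw [norm_smul, Complex.norm_exp_ofReal_mul_I, one_mul, Complex.norm_real,
      Real.norm_of_nonneg (Real.exp_pos _).le]
  have := integral_re hint
  simp only [RCLike.re_to_complex] at this
  rw [← this]
  congr 1; ext v
  rw [smul_eq_mul, Complex.re_mul_ofReal, Complex.exp_ofReal_mul_I_re, mul_comm]

/-- The imaginary part is the integral of an odd function. Thus taking `re` loses nothing and
Fourier inversion becomes available. -/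
theorem ofReal_fracHeatKernel (hθ : 0 < θ) {t : ℝ} (ht : 0 < t) (x : EuclideanSpace ℝ (Fin N)) :
    (fracHeatKernel θ x t : ℂ) = 𝓕⁻ (fun ξ : EuclideanSpace ℝ (Fin N) =>
      ((Real.exp (-t * (2 * Real.pi * ‖ξ‖) ^ θ) : ℝ) : ℂ)) x := by
  refine Complex.ext (by rw [Complex.ofReal_re, fracHeatKernel]) ?_
  rw [Complex.ofReal_im, Real.fourierInv_eq']
  have hint : Integrable (fun v : EuclideanSpace ℝ (Fin N) =>
      Complex.exp (↑(2 * Real.pi * inner ℝ v x) * Complex.I) •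
        ((Real.exp (-t * (2 * Real.pi * ‖v‖) ^ θ) : ℝ) : ℂ)) := by
    refine Integrable.mono' (integrable_exp_neg_mul_norm_rpow ht hθ)
      (Measurable.aestronglyMeasurable (by fun_prop)) (ae_of_all _ fun v => le_of_eq ?_)
    rw [norm_smul, Complex.norm_exp_ofReal_mul_I, one_mul, Complex.norm_real,
      Real.norm_of_nonneg (Real.exp_pos _).le]
  have := integral_im hint
  simp only [RCLike.im_to_complex] at this
  rw [← this]
  have h2 := integral_neg_eq_self (fun v : EuclideanSpace ℝ (Fin N) =>
    (Complex.exp (↑(2 * Real.pi * inner ℝ v x) * Complex.I) •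
        ((Real.exp (-t * (2 * Real.pi * ‖v‖) ^ θ) : ℝ) : ℂ)).im) volume
  have h3 : ∀ v : EuclideanSpace ℝ (Fin N),
      (Complex.exp (↑(2 * Real.pi * inner ℝ (-v) x) * Complex.I) •
        ((Real.exp (-t * (2 * Real.pi * ‖-v‖) ^ θ) : ℝ) : ℂ)).im =
      -(Complex.exp (↑(2 * Real.pi * inner ℝ v x) * Complex.I) •
        ((Real.exp (-t * (2 * Real.pi * ‖v‖) ^ θ) : ℝ) : ℂ)).im := by
    intro v
    rw [inner_neg_left, norm_neg, smul_eq_mul, smul_eq_mul, Complex.im_mul_ofReal,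
      Complex.im_mul_ofReal, Complex.exp_ofReal_mul_I_im, Complex.exp_ofReal_mul_I_im, mul_neg,
      Real.sin_neg, neg_mul]
  simp only [h3] at h2
  rw [integral_neg] at h2
  linarith

theorem measurable_fracHeatKernel :
    Measurable (fun z : EuclideanSpace ℝ (Fin N) × ℝ => fracHeatKernel θ z.1 z.2) := by
  simp only [fracHeatKernel, Real.fourierInv_eq']
  refine Complex.measurable_re.comp ?_
  refine StronglyMeasurable.measurable ?_
  refine StronglyMeasurable.integral_prod_right
    (f := fun (z : EuclideanSpace ℝ (Fin N) × ℝ) (v : EuclideanSpace ℝ (Fin N)) =>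
      Complex.exp (↑(2 * Real.pi * inner ℝ v z.1) * Complex.I) •
        ((Real.exp (-z.2 * (2 * Real.pi * ‖v‖) ^ θ) : ℝ) : ℂ)) ?_
  refine Measurable.stronglyMeasurable ?_
  simp only [Function.uncurry_def]
  fun_prop

attribute [local irreducible] fracHeatKernel

theorem fracHeatKernel_nonneg (hθ : 0 < θ) (hθ2 : θ ≤ 2) {t : ℝ} (ht : 0 < t)
    (x : EuclideanSpace ℝ (Fin N)) : 0 ≤ fracHeatKernel θ x t := by
  rw [fracHeatKernel_eq_integral_cos hθ ht]
  refine integral_exp_neg_rpow_mul_nonneg (K := 1) (by fun_prop) (fun ξ => Real.abs_cos_le_one _)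
    (fun b hb => ?_) ht hθ hθ2
  rw [integral_exp_neg_mul_sq_mul_cos hb]
  positivity

theorem integrable_exp_mul_cos (hθ : 0 < θ) {t : ℝ} (ht : 0 < t) (x : EuclideanSpace ℝ (Fin N)) :
    Integrable (fun ξ : EuclideanSpace ℝ (Fin N) =>
      Real.exp (-t * (2 * Real.pi * ‖ξ‖) ^ θ) * Real.cos (2 * Real.pi * inner ℝ ξ x)) := by
  refine Integrable.mono' (integrable_exp_neg_mul_norm_rpow ht hθ)
    (Measurable.aestronglyMeasurable (by fun_prop)) (ae_of_all _ fun v => ?_)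
  rw [Real.norm_eq_abs, abs_mul, abs_of_pos (Real.exp_pos _)]
  exact mul_le_of_le_one_right (Real.exp_pos _).le (Real.abs_cos_le_one _)

/-- The Gaussian transform of `cos⟨ξ,x⟩ - cos⟨ξ,y⟩` is a difference of Gaussians in `‖x‖` and `‖y‖`,
hence nonnegative; subordination carries the sign over to `θ < 2`. -/
theorem fracHeatKernel_antitone_norm (hθ : 0 < θ) (hθ2 : θ ≤ 2) {t : ℝ} (ht : 0 < t)
    {x y : EuclideanSpace ℝ (Fin N)} (hxy : ‖x‖ ≤ ‖y‖) :
    fracHeatKernel θ y t ≤ fracHeatKernel θ x t := by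
  rw [fracHeatKernel_eq_integral_cos hθ ht, fracHeatKernel_eq_integral_cos hθ ht, ← sub_nonneg,
    ← integral_sub (integrable_exp_mul_cos hθ ht x) (integrable_exp_mul_cos hθ ht y)]
  simp only [← mul_sub]
  refine integral_exp_neg_rpow_mul_nonneg (K := 2) (by fun_prop) (fun ξ => ?_)
    (fun b hb => ?_) ht hθ hθ2
  · refine (abs_sub _ _).trans ?_
    have h1 := Real.abs_cos_le_one (2 * Real.pi * inner ℝ ξ x)
    have h2 := Real.abs_cos_le_one (2 * Real.pi * inner ℝ ξ y)
    linarith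
  · have hi : ∀ x : EuclideanSpace ℝ (Fin N), Integrable (fun ξ : EuclideanSpace ℝ (Fin N) =>
        Real.exp (-b * ‖ξ‖ ^ 2) * Real.cos (2 * Real.pi * inner ℝ ξ x)) := by
      intro x
      refine Integrable.mono' (integrable_exp_neg_mul_norm_sq hb)
        (Measurable.aestronglyMeasurable (by fun_prop)) (ae_of_all _ fun v => ?_)
      rw [Real.norm_eq_abs, abs_mul, abs_of_pos (Real.exp_pos _)]
      exact mul_le_of_le_one_right (Real.exp_pos _).le (Real.abs_cos_le_one _)
    simp only [mul_sub]
    rw [integral_sub (hi x) (hi y), integral_exp_neg_mul_sq_mul_cos hb,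
      integral_exp_neg_mul_sq_mul_cos hb, ← mul_sub]
    refine mul_nonneg (by positivity) (sub_nonneg.2 (Real.exp_le_exp.2 ?_))
    rw [neg_mul, neg_mul, neg_div, neg_div]
    gcongr

theorem fracHeatKernel_neg (hθ : 0 < θ) {t : ℝ} (ht : 0 < t) (x : EuclideanSpace ℝ (Fin N)) :
    fracHeatKernel θ (-x) t = fracHeatKernel θ x t := by
  simp only [fracHeatKernel_eq_integral_cos hθ ht, inner_neg_right, mul_neg, Real.cos_neg]

/-- Integrability of the kernel must precede Fourier inversion. A Gaussian factor in `x` allows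
Fubini and turns the integral into that of the symbol, which is at most `1`, against a Gaussian of
mass one; the factor is then removed by monotone convergence. -/
theorem lintegral_fracHeatKernel_le_one (hθ : 0 < θ) (hθ2 : θ ≤ 2) {t : ℝ} (ht : 0 < t) :
    ∫⁻ x : EuclideanSpace ℝ (Fin N), ENNReal.ofReal (fracHeatKernel θ x t) ≤ 1 := by
  set b : ℕ → ℝ := fun n => 1 / ((n : ℝ) + 1) with hb
  have hb0 : ∀ n, 0 < b n := fun n => by positivity
  have hmeas : Measurable (fun x : EuclideanSpace ℝ (Fin N) => fracHeatKernel θ x t) :=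
    measurable_fracHeatKernel.comp measurable_prodMk_right
  have hle : ∀ n, ∫⁻ x : EuclideanSpace ℝ (Fin N),
      ENNReal.ofReal (fracHeatKernel θ x t * Real.exp (-b n * ‖x‖ ^ 2)) ≤ 1 := by
    intro n
    set F : EuclideanSpace ℝ (Fin N) → EuclideanSpace ℝ (Fin N) → ℝ := fun x ξ =>
      Real.exp (-b n * ‖x‖ ^ 2) * (Real.exp (-t * (2 * Real.pi * ‖ξ‖) ^ θ) *
        Real.cos (2 * Real.pi * inner ℝ ξ x)) with hF
    have hInt : Integrable (Function.uncurry F) (volume.prod volume) := by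
      refine Integrable.mono' ((integrable_exp_neg_mul_norm_sq (hb0 n)).mul_prod
        (integrable_exp_neg_mul_norm_rpow ht hθ)) (Measurable.aestronglyMeasurable
          (by simp only [hF, Function.uncurry_def]; fun_prop)) (ae_of_all _ fun z => ?_)
      simp only [hF, Function.uncurry_def, Real.norm_eq_abs, abs_mul, abs_of_pos (Real.exp_pos _)]
      rw [← mul_assoc]
      exact mul_le_of_le_one_right (by positivity) (Real.abs_cos_le_one _)
    have h1 : ∀ x, ∫ ξ, F x ξ = fracHeatKernel θ x t * Real.exp (-b n * ‖x‖ ^ 2) := by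
      intro x
      simp only [hF]
      rw [integral_const_mul, ← fracHeatKernel_eq_integral_cos hθ ht, mul_comm]
    have h2 := hInt.integral_prod_left
    simp only [Function.uncurry_apply_pair, h1] at h2
    rw [← ofReal_integral_eq_lintegral_ofReal h2 (ae_of_all _ fun x =>
      mul_nonneg (fracHeatKernel_nonneg hθ hθ2 ht x) (Real.exp_pos _).le)]
    refine ENNReal.ofReal_le_one.2 ?_
    simp only [← h1]
    rw [integral_integral_swap hInt]
    have h3 : ∀ ξ : EuclideanSpace ℝ (Fin N), ∫ x, F x ξ = Real.exp (-t * (2 * Real.pi * ‖ξ‖) ^ θ) *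
        ((Real.pi / b n) ^ ((N : ℝ) / 2) * Real.exp (-(Real.pi ^ 2 / b n) * ‖ξ‖ ^ 2)) := by
      intro ξ
      have := integral_exp_neg_mul_sq_mul_cos (hb0 n) ξ
      rw [show -(Real.pi ^ 2 / b n) * ‖ξ‖ ^ 2 = -Real.pi ^ 2 * ‖ξ‖ ^ 2 / b n by ring, ← this,
        ← integral_const_mul]
      congr 1; ext x
      simp only [hF, real_inner_comm]
      ring
    simp only [h3]
    have hpb : 0 < Real.pi ^ 2 / b n := by have := hb0 n; positivity
    calc _ ≤ ∫ ξ : EuclideanSpace ℝ (Fin N),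
          ((Real.pi / b n) ^ ((N : ℝ) / 2) * Real.exp (-(Real.pi ^ 2 / b n) * ‖ξ‖ ^ 2)) := by
          refine integral_mono_of_nonneg (ae_of_all _ fun ξ => ?_)
            ((integrable_exp_neg_mul_norm_sq hpb).const_mul _) (ae_of_all _ fun ξ => ?_)
          · have := (hb0 n).le
            simp only [Pi.zero_apply]; positivity
          · refine mul_le_of_le_one_left (by have := (hb0 n).le; positivity)
              (Real.exp_le_one_iff.2 ?_)
            have : 0 ≤ t * (2 * Real.pi * ‖ξ‖) ^ θ := by positivity
            linarith
      _ = 1 := by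
          rw [integral_const_mul, GaussianFourier.integral_rexp_neg_mul_sq_norm hpb,
            finrank_euclideanSpace_fin, ← Real.mul_rpow (by have := (hb0 n).le; positivity)
              (by positivity)]
          have : Real.pi / b n * (Real.pi / (Real.pi ^ 2 / b n)) = 1 := by
            have := (hb0 n).ne'
            field_simp
          rw [this, Real.one_rpow]
  refine le_of_tendsto' (lintegral_tendsto_of_tendsto_of_monotone (fun n =>
    (Measurable.aemeasurable (by fun_prop))) (ae_of_all _ fun x => ?_) (ae_of_all _ fun x => ?_)) hle
  · intro m n hmn
    refine ENNReal.ofReal_le_ofReal (mul_le_mul_of_nonneg_left (Real.exp_le_exp.2 ?_)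
      (fracHeatKernel_nonneg hθ hθ2 ht x))
    have : b n ≤ b m := by simp only [hb]; gcongr
    have := mul_le_mul_of_nonneg_right this (sq_nonneg ‖x‖)
    linarith
  · refine ENNReal.tendsto_ofReal ?_
    have h5 : Tendsto (fun n => Real.exp (-b n * ‖x‖ ^ 2)) atTop (𝓝 (Real.exp (-0 * ‖x‖ ^ 2))) :=
      (Real.continuous_exp.tendsto _).comp
        ((tendsto_one_div_add_atTop_nhds_zero_nat.neg).mul_const _)
    simpa using h5.const_mul (fracHeatKernel θ x t)

theorem integrable_fracHeatKernel (hθ : 0 < θ) (hθ2 : θ ≤ 2) {t : ℝ} (ht : 0 < t) :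
    Integrable (fun x : EuclideanSpace ℝ (Fin N) => fracHeatKernel θ x t) := by
  have hmeas : Measurable (fun x : EuclideanSpace ℝ (Fin N) => fracHeatKernel θ x t) :=
    measurable_fracHeatKernel.comp measurable_prodMk_right
  refine ⟨hmeas.aestronglyMeasurable, ?_⟩
  rw [hasFiniteIntegral_iff_ofReal (ae_of_all _ fun x => fracHeatKernel_nonneg hθ hθ2 ht x)]
  exact (lintegral_fracHeatKernel_le_one hθ hθ2 ht).trans_lt ENNReal.one_lt_top

/-! ### Fourier inversion: mass, convolution and scaling of the kernel. -/

theorem integral_fracHeatKernel_mul_cos (hθ : 0 < θ) (hθ2 : θ ≤ 2) {t : ℝ} (ht : 0 < t)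
    (ξ : EuclideanSpace ℝ (Fin N)) :
    ∫ y : EuclideanSpace ℝ (Fin N), fracHeatKernel θ y t * Real.cos (2 * Real.pi * inner ℝ ξ y) =
      Real.exp (-t * (2 * Real.pi * ‖ξ‖) ^ θ) := by
  set f : EuclideanSpace ℝ (Fin N) → ℂ := fun ξ =>
    ((Real.exp (-t * (2 * Real.pi * ‖ξ‖) ^ θ) : ℝ) : ℂ) with hf
  have hfi : Integrable f := (integrable_exp_neg_mul_norm_rpow ht hθ).ofReal
  have hfc : Continuous f := by
    refine Complex.continuous_ofReal.comp (Real.continuous_exp.comp (continuous_const.mul ?_))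
    exact (continuous_const.mul continuous_norm).rpow_const
      (fun _ => Or.inr hθ.le)
  have hinv : (fun x => (fracHeatKernel θ x t : ℂ)) = 𝓕⁻ f := by
    ext x; exact ofReal_fracHeatKernel hθ ht x
  have hΓ : Integrable (𝓕⁻ f) := hinv ▸ (integrable_fracHeatKernel hθ hθ2 ht).ofReal
  have hFf : Integrable (𝓕 f) := by
    have h1 : 𝓕 f = fun x => 𝓕⁻ f (-x) := by
      ext x; rw [Real.fourierInv_eq_fourier_neg, neg_neg]
    rw [h1]; exact hΓ.comp_neg
  have h := congrFun (hfc.fourier_fourierInv_eq hfi hFf) ξ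
  rw [← hinv, Real.fourier_eq'] at h
  have h2 := congrArg Complex.re h
  rw [hf, Complex.ofReal_re, ← RCLike.re_to_complex, ← integral_re] at h2
  · rw [← h2]
    congr 1; ext y
    rw [RCLike.re_to_complex, smul_eq_mul, Complex.re_mul_ofReal, Complex.exp_ofReal_mul_I_re, mul_comm,
      show -2 * Real.pi * inner ℝ y ξ = -(2 * Real.pi * inner ℝ ξ y) by
        rw [real_inner_comm]; ring, Real.cos_neg]
  · refine Integrable.mono' (integrable_fracHeatKernel hθ hθ2 ht).norm ?_ (ae_of_all _ fun v => ?_)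
    · have hc : Continuous (fun v : EuclideanSpace ℝ (Fin N) =>
          Complex.exp (↑(-2 * Real.pi * inner ℝ v ξ) * Complex.I)) := by fun_prop
      exact hc.aestronglyMeasurable.smul
        (integrable_fracHeatKernel hθ hθ2 ht).ofReal.aestronglyMeasurable
    · rw [norm_smul, Complex.norm_exp_ofReal_mul_I, one_mul, Complex.norm_real]

theorem lintegral_fracHeatKernel (hθ : 0 < θ) (hθ2 : θ ≤ 2) {t : ℝ} (ht : 0 < t) :
    ∫⁻ x : EuclideanSpace ℝ (Fin N), ENNReal.ofReal (fracHeatKernel θ x t) = 1 := by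
  have h := integral_fracHeatKernel_mul_cos hθ hθ2 ht (0 : EuclideanSpace ℝ (Fin N))
  simp only [inner_zero_left, mul_zero, Real.cos_zero, mul_one, norm_zero, Real.zero_rpow hθ.ne',
    Real.exp_zero] at h
  rw [← ofReal_integral_eq_lintegral_ofReal (integrable_fracHeatKernel hθ hθ2 ht)
    (ae_of_all _ fun x => fracHeatKernel_nonneg hθ hθ2 ht x), h, ENNReal.ofReal_one]

theorem integral_fracHeatKernel_mul_sin (hθ : 0 < θ) {t : ℝ} (ht : 0 < t)
    (ξ : EuclideanSpace ℝ (Fin N)) :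
    ∫ y : EuclideanSpace ℝ (Fin N), fracHeatKernel θ y t * Real.sin (2 * Real.pi * inner ℝ ξ y) =
      0 := by
  have h := integral_neg_eq_self (fun y : EuclideanSpace ℝ (Fin N) =>
    fracHeatKernel θ y t * Real.sin (2 * Real.pi * inner ℝ ξ y)) volume
  simp only [fracHeatKernel_neg hθ ht, inner_neg_right, mul_neg, Real.sin_neg, integral_neg] at h
  linarith

/-- Write the second factor as a cosine integral and swap. By the addition formula the sine part
vanishes by symmetry, and the cosine part multiplies the two symbols. -/
theorem integral_fracHeatKernel_mul_fracHeatKernel (hθ : 0 < θ) (hθ2 : θ ≤ 2) {t s : ℝ}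
    (ht : 0 < t) (hs : 0 < s) (x : EuclideanSpace ℝ (Fin N)) :
    ∫ y : EuclideanSpace ℝ (Fin N), fracHeatKernel θ y t * fracHeatKernel θ (x - y) s =
      fracHeatKernel θ x (t + s) := by
  have hi := integrable_fracHeatKernel (N := N) hθ hθ2 ht
  have hm : Measurable (fun x : EuclideanSpace ℝ (Fin N) => fracHeatKernel θ x t) :=
    measurable_fracHeatKernel.comp measurable_prodMk_right
  set F : EuclideanSpace ℝ (Fin N) → EuclideanSpace ℝ (Fin N) → ℝ := fun y ξ =>
    fracHeatKernel θ y t * (Real.exp (-s * (2 * Real.pi * ‖ξ‖) ^ θ) *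
      Real.cos (2 * Real.pi * inner ℝ ξ (x - y))) with hF
  have hInt : Integrable (Function.uncurry F) (volume.prod volume) := by
    refine Integrable.mono' (hi.mul_prod
      (integrable_exp_neg_mul_norm_rpow hs hθ)) (Measurable.aestronglyMeasurable
        (by simp only [hF, Function.uncurry_def]; fun_prop)) (ae_of_all _ fun z => ?_)
    simp only [hF, Function.uncurry_def, Real.norm_eq_abs, abs_mul, abs_of_pos (Real.exp_pos _),
      abs_of_nonneg (fracHeatKernel_nonneg hθ hθ2 ht z.1)]
    rw [← mul_assoc]
    exact mul_le_of_le_one_right (mul_nonneg (fracHeatKernel_nonneg hθ hθ2 ht z.1)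
      (Real.exp_pos _).le) (Real.abs_cos_le_one _)
  have h1 : ∀ y, ∫ ξ, F y ξ = fracHeatKernel θ y t * fracHeatKernel θ (x - y) s := by
    intro y
    simp only [hF]
    rw [integral_const_mul, ← fracHeatKernel_eq_integral_cos hθ hs]
  simp only [← h1]
  rw [integral_integral_swap hInt, fracHeatKernel_eq_integral_cos hθ (add_pos ht hs)]
  congr 1; ext ξ
  have hbd : ∀ g : EuclideanSpace ℝ (Fin N) → ℝ, Measurable g → (∀ y, |g y| ≤ 1) →
      Integrable (fun y => fracHeatKernel θ y t * g y) := by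
    intro g hg h
    refine Integrable.mono' hi.norm (hm.mul hg).aestronglyMeasurable (ae_of_all _ fun y => ?_)
    rw [norm_mul]
    exact mul_le_of_le_one_right (norm_nonneg _) (h y)
  have h2 : ∀ y, F y ξ = Real.exp (-s * (2 * Real.pi * ‖ξ‖) ^ θ) *
      (Real.cos (2 * Real.pi * inner ℝ ξ x) *
        (fracHeatKernel θ y t * Real.cos (2 * Real.pi * inner ℝ ξ y)) +
      Real.sin (2 * Real.pi * inner ℝ ξ x) *
        (fracHeatKernel θ y t * Real.sin (2 * Real.pi * inner ℝ ξ y))) := by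
    intro y
    simp only [hF]
    rw [inner_sub_right, mul_sub, Real.cos_sub]; ring
  simp only [h2]
  rw [integral_const_mul, integral_add, integral_const_mul, integral_const_mul,
    integral_fracHeatKernel_mul_cos hθ hθ2 ht, integral_fracHeatKernel_mul_sin hθ ht,
    show -(t + s) * (2 * Real.pi * ‖ξ‖) ^ θ = -t * (2 * Real.pi * ‖ξ‖) ^ θ +
      -s * (2 * Real.pi * ‖ξ‖) ^ θ by ring, Real.exp_add]
  · ring
  · exact (hbd _ (by fun_prop) fun y => Real.abs_cos_le_one _).const_mul _
  · exact (hbd _ (by fun_prop) fun y => Real.abs_sin_le_one _).const_mul _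

theorem lintegral_fracHeatKernel_mul_fracHeatKernel (hθ : 0 < θ) (hθ2 : θ ≤ 2) {t s : ℝ}
    (ht : 0 < t) (hs : 0 < s) (x z : EuclideanSpace ℝ (Fin N)) :
    ∫⁻ y : EuclideanSpace ℝ (Fin N), ENNReal.ofReal (fracHeatKernel θ (x - y) t) *
      ENNReal.ofReal (fracHeatKernel θ (y - z) s) =
      ENNReal.ofReal (fracHeatKernel θ (x - z) (t + s)) := by
  have hm : ∀ t, Measurable (fun x : EuclideanSpace ℝ (Fin N) => fracHeatKernel θ x t) := fun t =>
    measurable_fracHeatKernel.comp measurable_prodMk_right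
  have h0 := lintegral_sub_left_eq_self (μ := volume) (fun y : EuclideanSpace ℝ (Fin N) =>
    ENNReal.ofReal (fracHeatKernel θ (x - y) t) * ENNReal.ofReal (fracHeatKernel θ (y - z) s)) x
  rw [← h0]
  have h1 : ∀ y, ENNReal.ofReal (fracHeatKernel θ (x - (x - y)) t) *
      ENNReal.ofReal (fracHeatKernel θ (x - y - z) s) =
      ENNReal.ofReal (fracHeatKernel θ y t * fracHeatKernel θ (x - z - y) s) := by
    intro y
    rw [sub_sub_cancel, ← ENNReal.ofReal_mul (fracHeatKernel_nonneg hθ hθ2 ht _), sub_right_comm]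
  simp only [h1]
  rw [← integral_fracHeatKernel_mul_fracHeatKernel hθ hθ2 ht hs, ofReal_integral_eq_lintegral_ofReal]
  · refine Integrable.mono' ((integrable_fracHeatKernel hθ hθ2 ht).mul_const (fracHeatKernel θ
      (0 : EuclideanSpace ℝ (Fin N)) s)) (((hm t).mul ((hm s).comp (by fun_prop))).aestronglyMeasurable)
      (ae_of_all _ fun y => ?_)
    rw [Real.norm_of_nonneg (mul_nonneg (fracHeatKernel_nonneg hθ hθ2 ht _)
      (fracHeatKernel_nonneg hθ hθ2 hs _))]
    exact mul_le_mul_of_nonneg_left (fracHeatKernel_antitone_norm hθ hθ2 hs (by simp))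
      (fracHeatKernel_nonneg hθ hθ2 ht _)
  · exact ae_of_all _ fun y => mul_nonneg (fracHeatKernel_nonneg hθ hθ2 ht _)
      (fracHeatKernel_nonneg hθ hθ2 hs _)

theorem fracHeatKernel_zero_eq (hθ : 0 < θ) {t : ℝ} (ht : 0 < t) :
    fracHeatKernel θ (0 : EuclideanSpace ℝ (Fin N)) t =
      t ^ (-((N : ℝ) / θ)) * fracHeatKernel θ (0 : EuclideanSpace ℝ (Fin N)) 1 := by
  rw [fracHeatKernel_eq_integral_cos hθ ht, fracHeatKernel_eq_integral_cos hθ one_pos]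
  simp only [inner_zero_right, mul_zero, Real.cos_zero, mul_one]
  have h := Measure.integral_comp_smul (volume : Measure (EuclideanSpace ℝ (Fin N)))
    (fun ξ => Real.exp (-1 * (2 * Real.pi * ‖ξ‖) ^ θ)) (t ^ (1 / θ))
  have h1 : ∀ ξ : EuclideanSpace ℝ (Fin N), Real.exp (-1 * (2 * Real.pi * ‖t ^ (1 / θ) • ξ‖) ^ θ) =
      Real.exp (-t * (2 * Real.pi * ‖ξ‖) ^ θ) := by
    intro ξ
    have h0 : 0 ≤ t ^ (1 / θ) := by positivity
    rw [norm_smul, Real.norm_of_nonneg h0, show 2 * Real.pi * (t ^ (1 / θ) * ‖ξ‖) =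
      t ^ (1 / θ) * (2 * Real.pi * ‖ξ‖) by ring, Real.mul_rpow h0 (by positivity),
      ← Real.rpow_mul ht.le, one_div_mul_cancel hθ.ne', Real.rpow_one]
    congr 1; ring
  simp only [h1] at h
  rw [h, finrank_euclideanSpace_fin, smul_eq_mul]
  congr 1
  rw [abs_of_pos (by positivity), ← Real.rpow_natCast, ← Real.rpow_mul ht.le, ← Real.rpow_neg ht.le]
  congr 1; ring

end Kernel

section Semigroup

variable {N : ℕ} {θ : ℝ}

attribute [local irreducible] fracHeatKernel

theorem measurable_ofReal_fracHeatKernel_sub (x : EuclideanSpace ℝ (Fin N)) (t : ℝ) :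
    Measurable (fun y => ENNReal.ofReal (fracHeatKernel θ (x - y) t)) :=
  ENNReal.measurable_ofReal.comp (measurable_fracHeatKernel.comp
    (by fun_prop : Measurable fun y : EuclideanSpace ℝ (Fin N) => (x - y, t)))

/-! ### Bounds by averages over balls -/

/-- The kernel is replaced by a majorant `k` that dominates it on whole `σ`-balls, `σ = t^(1/θ)`.
Writing the volume of a `σ`-ball as an integral over centres `z` and swapping turns the left side
into `k` integrated against ball integrals of `f`. By scaling, `∫ k` does not depend on `t`. -/
theorem lintegral_fracHeatKernel_mul_le_of_average_le (hθ : 0 < θ) (hθ2 : θ ≤ 2) {t : ℝ} (ht : 0 < t)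
    {f : EuclideanSpace ℝ (Fin N) → ℝ≥0∞} (hf : AEMeasurable f) {A : ℝ≥0∞}
    (hA : ∀ z, ⨍⁻ y in Metric.ball z (t ^ (1 / θ)), f y ∂volume ≤ A)
    (x : EuclideanSpace ℝ (Fin N)) :
    ∫⁻ y, ENNReal.ofReal (fracHeatKernel θ (x - y) t) * f y ≤
      (ENNReal.ofReal (2 ^ N) + ENNReal.ofReal (fracHeatKernel θ (0 : EuclideanSpace ℝ (Fin N)) 1) *
        volume (Metric.ball (0 : EuclideanSpace ℝ (Fin N)) 2)) * A := by
  set σ := t ^ (1 / θ) with hσ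
  have hσ0 : 0 < σ := by positivity
  have hm : Measurable (fun x : EuclideanSpace ℝ (Fin N) => fracHeatKernel θ x t) :=
    measurable_fracHeatKernel.comp measurable_prodMk_right
  set b := volume (Metric.ball (0 : EuclideanSpace ℝ (Fin N)) σ) with hb
  have hb0 : b ≠ 0 := (Metric.measure_ball_pos _ _ hσ0).ne'
  have hbt : b ≠ ∞ := measure_ball_lt_top.ne
  have hbz : ∀ z : EuclideanSpace ℝ (Fin N), volume (Metric.ball z σ) = b := fun z =>
    Measure.addHaar_ball_center _ z σ
  have hA' : ∀ z, ∫⁻ y in Metric.ball z σ, f y ≤ A * b := by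
    intro z
    have := hA z
    rw [setLAverage_eq, hbz] at this
    exact (ENNReal.div_le_iff hb0 hbt).1 this
  -- If `‖w'‖ ≥ 2σ` and `w` is within `σ` of `w'`, then `‖w‖ ≥ ‖w'‖/2` and radial monotonicity
  -- applies; near the origin the maximum of the kernel is used. The dilation by `2` accounts for
  -- `2^N`.
  set k : EuclideanSpace ℝ (Fin N) → ℝ≥0∞ := fun w =>
    ENNReal.ofReal (fracHeatKernel θ ((2 : ℝ)⁻¹ • w) t) +
      (Metric.ball (0 : EuclideanSpace ℝ (Fin N)) (2 * σ)).indicator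
        (fun _ => ENNReal.ofReal (fracHeatKernel θ (0 : EuclideanSpace ℝ (Fin N)) t)) w with hk
  have hkm : Measurable k := by
    refine Measurable.add (ENNReal.measurable_ofReal.comp (hm.comp (by fun_prop))) ?_
    exact measurable_const.indicator measurableSet_ball
  have hkey : ∀ w w' : EuclideanSpace ℝ (Fin N), dist w w' < σ →
      ENNReal.ofReal (fracHeatKernel θ w t) ≤ k w' := by
    intro w w' h
    rw [dist_eq_norm] at h
    by_cases hw : ‖w'‖ < 2 * σ
    · refine le_trans ?_ le_add_self
      rw [indicator_of_mem (by simpa using hw)]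
      exact ENNReal.ofReal_le_ofReal (fracHeatKernel_antitone_norm hθ hθ2 ht (by simp))
    · refine le_trans (ENNReal.ofReal_le_ofReal
        (fracHeatKernel_antitone_norm hθ hθ2 ht ?_)) le_self_add
      rw [norm_smul, norm_inv, Real.norm_ofNat]
      have : ‖w'‖ ≤ ‖w‖ + ‖w - w'‖ := by
        have := norm_sub_le w (w - w'); rwa [sub_sub_cancel] at this
      linarith
  have hkint : ∫⁻ w, k w = ENNReal.ofReal (2 ^ N) +
      ENNReal.ofReal (fracHeatKernel θ (0 : EuclideanSpace ℝ (Fin N)) 1) *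
        volume (Metric.ball (0 : EuclideanSpace ℝ (Fin N)) 2) := by
    simp only [hk]
    rw [lintegral_add_right _ (measurable_const.indicator measurableSet_ball),
      lintegral_indicator_const measurableSet_ball]
    congr 1
    · have h1 := Measure.integral_comp_inv_smul (volume : Measure (EuclideanSpace ℝ (Fin N)))
        (fun w => fracHeatKernel θ w t) 2
      have hint := integrable_fracHeatKernel (N := N) hθ hθ2 ht
      have h2 : ∫ w : EuclideanSpace ℝ (Fin N), fracHeatKernel θ w t = 1 := by
        have := lintegral_fracHeatKernel (N := N) hθ hθ2 ht
        rw [← ofReal_integral_eq_lintegral_ofReal hint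
          (ae_of_all _ fun x => fracHeatKernel_nonneg hθ hθ2 ht x)] at this
        simpa using this
      rw [← ofReal_integral_eq_lintegral_ofReal (hint.comp_smul (by norm_num))
          (ae_of_all _ fun x => fracHeatKernel_nonneg hθ hθ2 ht _), h1, h2]
      simp
    · rw [fracHeatKernel_zero_eq hθ ht, mul_comm 2 σ,
        Measure.addHaar_ball_mul_of_pos _ _ hσ0, ← mul_assoc,
        ← ENNReal.ofReal_mul (mul_nonneg (by positivity) (fracHeatKernel_nonneg hθ hθ2 one_pos _)),
        finrank_euclideanSpace_fin]
      congr 2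
      rw [mul_right_comm, hσ, ← Real.rpow_natCast, ← Real.rpow_mul ht.le, ← Real.rpow_add ht,
        show -((N : ℝ) / θ) + 1 / θ * (N : ℝ) = 0 by ring, Real.rpow_zero, one_mul]
  have hmain : (∫⁻ y, ENNReal.ofReal (fracHeatKernel θ (x - y) t) * f y) * b ≤
      ((∫⁻ w, k w) * A) * b := by
    calc (∫⁻ y, ENNReal.ofReal (fracHeatKernel θ (x - y) t) * f y) * b
        = ∫⁻ y, ∫⁻ z, (Metric.ball y σ).indicator (fun _ =>
            ENNReal.ofReal (fracHeatKernel θ (x - y) t) * f y) z := by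
          rw [← lintegral_mul_const' _ _ hbt]
          congr 1; ext y
          rw [lintegral_indicator_const measurableSet_ball, hbz]
      _ ≤ ∫⁻ y, ∫⁻ z, {p : EuclideanSpace ℝ (Fin N) × EuclideanSpace ℝ (Fin N) |
            dist p.1 p.2 < σ}.indicator (fun p => k (x - p.2) * f p.1) (y, z) := by
          refine lintegral_mono fun y => lintegral_mono fun z => ?_
          by_cases h : dist y z < σ
          · rw [indicator_of_mem (by rwa [Metric.mem_ball, dist_comm]), indicator_of_mem (by exact h)]
            refine mul_le_mul_left (hkey _ _ ?_) _
            rwa [dist_sub_left]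
          · rw [indicator_of_notMem (by rwa [Metric.mem_ball, dist_comm])]
            exact zero_le
      _ = ∫⁻ z, ∫⁻ y, {p : EuclideanSpace ℝ (Fin N) × EuclideanSpace ℝ (Fin N) |
            dist p.1 p.2 < σ}.indicator (fun p => k (x - p.2) * f p.1) (y, z) := by
          refine lintegral_lintegral_swap ?_
          refine AEMeasurable.indicator ?_ (measurableSet_lt (by fun_prop) (by fun_prop))
          refine AEMeasurable.mul ?_ hf.comp_fst
          exact (hkm.comp (by fun_prop)).aemeasurable
      _ = ∫⁻ z, k (x - z) * ∫⁻ y in Metric.ball z σ, f y := by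
          congr 1; ext z
          rw [← lintegral_const_mul'' _ hf.restrict, ← lintegral_indicator measurableSet_ball]
          congr 1
      _ ≤ ∫⁻ z, k (x - z) * (A * b) := by
          gcongr with z
          exact hA' z
      _ = (∫⁻ w, k w) * A * b := by
          have hkx : Measurable fun z => k (x - z) := hkm.comp (by fun_prop)
          rw [lintegral_mul_const _ hkx, lintegral_sub_left_eq_self k x,
            mul_assoc]
  rw [← hkint]
  exact (ENNReal.mul_le_mul_iff_left hb0 hbt).1 hmain

/-! ### The semigroup property and Jensen's inequality -/

theorem lintegral_fracHeatKernel_mul_fracHeatSemigroup (hθ : 0 < θ) (hθ2 : θ ≤ 2) {s t : ℝ}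
    (hs : 0 < s) (hst : s < t) (m : Measure (EuclideanSpace ℝ (Fin N))) [SFinite m]
    (x : EuclideanSpace ℝ (Fin N)) :
    ∫⁻ y, ENNReal.ofReal (fracHeatKernel θ (x - y) (t - s)) * fracHeatSemigroup θ s m y =
      fracHeatSemigroup θ t m x := by
  simp only [fracHeatSemigroup]
  have h1 : ∀ y, ENNReal.ofReal (fracHeatKernel θ (x - y) (t - s)) *
      ∫⁻ z, ENNReal.ofReal (fracHeatKernel θ (y - z) s) ∂m =
      ∫⁻ z, ENNReal.ofReal (fracHeatKernel θ (x - y) (t - s)) *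
        ENNReal.ofReal (fracHeatKernel θ (y - z) s) ∂m := fun y =>
    (lintegral_const_mul _ (measurable_ofReal_fracHeatKernel_sub y s)).symm
  simp only [h1]
  rw [lintegral_lintegral_swap]
  · congr 1; ext z
    rw [lintegral_fracHeatKernel_mul_fracHeatKernel hθ hθ2 (sub_pos.2 hst) hs, sub_add_cancel]
  · refine Measurable.aemeasurable ?_
    have hk : ∀ r : ℝ, Measurable
        (fun z : EuclideanSpace ℝ (Fin N) => ENNReal.ofReal (fracHeatKernel θ z r)) := fun r =>
      ENNReal.measurable_ofReal.comp (measurable_fracHeatKernel.comp measurable_prodMk_right)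
    exact ((hk _).comp (by fun_prop : Measurable
      fun p : EuclideanSpace ℝ (Fin N) × EuclideanSpace ℝ (Fin N) => x - p.1)).mul
      ((hk _).comp (by fun_prop : Measurable
      fun p : EuclideanSpace ℝ (Fin N) × EuclideanSpace ℝ (Fin N) => p.1 - p.2))

theorem fracHeatSemigroup_densityMeasure {f : EuclideanSpace ℝ (Fin N) → ℝ}
    (hf : AEMeasurable f) (t : ℝ) (x : EuclideanSpace ℝ (Fin N)) :
    fracHeatSemigroup θ t (densityMeasure f) x =
      ∫⁻ y, ENNReal.ofReal (fracHeatKernel θ (x - y) t) * ENNReal.ofReal (f y) := by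
  rw [fracHeatSemigroup, densityMeasure, lintegral_withDensity_eq_lintegral_mul₀ hf.ennreal_ofReal
    (measurable_ofReal_fracHeatKernel_sub x t).aemeasurable]
  simp only [Pi.mul_apply, mul_comm]

theorem lintegral_fracHeatKernel_sub (hθ : 0 < θ) (hθ2 : θ ≤ 2) {t : ℝ} (ht : 0 < t)
    (x : EuclideanSpace ℝ (Fin N)) :
    ∫⁻ y, ENNReal.ofReal (fracHeatKernel θ (x - y) t) = 1 := by
  rw [lintegral_sub_left_eq_self (fun y => ENNReal.ofReal (fracHeatKernel θ y t)) x,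
    lintegral_fracHeatKernel hθ hθ2 ht]

end Semigroup

/-- The slope is the infimum of the difference quotients to the right of `v`. It dominates every
quotient to the left, and the one from `R` is positive because `R < v`. -/
theorem ConvexOn.exists_pos_supporting_slope {Φ : ℝ → ℝ} {R v : ℝ} (hΦ : ConvexOn ℝ (Ici R) Φ)
    (hmono : StrictMonoOn Φ (Ici R)) (hv : R < v) :
    ∃ c : ℝ, 0 < c ∧ ∀ τ, R ≤ τ → Φ v + c * (τ - v) ≤ Φ τ := by
  set S := (fun τ => (Φ τ - Φ v) / (τ - v)) '' Ioi v with hS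
  have hne : S.Nonempty := nonempty_Ioi.image _
  have hlow : ∀ τ, R ≤ τ → τ < v → ∀ y ∈ S, (Φ v - Φ τ) / (v - τ) ≤ y := by
    rintro τ hτ hτv _ ⟨z, hz, rfl⟩
    exact hΦ.slope_mono_adjacent hτ (hv.le.trans (le_of_lt hz)) hτv hz
  have hbdd : BddBelow S := ⟨_, fun y hy => hlow R le_rfl hv y hy⟩
  refine ⟨sInf S, ?_, fun τ hτ => ?_⟩
  · refine lt_of_lt_of_le ?_ (le_csInf hne (hlow R le_rfl hv))
    exact div_pos (sub_pos.2 (hmono (self_mem_Ici) hv.le hv)) (sub_pos.2 hv)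
  · rcases lt_trichotomy τ v with h | rfl | h
    · have h1 := le_csInf hne (hlow τ hτ h)
      rw [div_le_iff₀ (sub_pos.2 h)] at h1
      nlinarith
    · simp
    · have h1 : sInf S ≤ (Φ τ - Φ v) / (τ - v) := csInf_le hbdd ⟨τ, h, rfl⟩
      rw [le_div_iff₀ (sub_pos.2 h)] at h1
      linarith

/-- Jensen's inequality obtained by integrating the supporting line at `v`. No integrability of `f`
is assumed. -/
theorem ConvexOn.lintegral_mul_ofReal_le {X : Type*} [MeasurableSpace X] {ν : Measure X}
    {Φ : ℝ → ℝ} {R v : ℝ} (hΦ : ConvexOn ℝ (Ici R) Φ)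
    (hmono : StrictMonoOn Φ (Ici R)) (hR : 0 < R) (hΦR : 0 < Φ R) (hv : R < v) {k : X → ℝ≥0∞}
    (hk : Measurable k) (hk1 : ∫⁻ y, k y ∂ν = 1) {f : X → ℝ}
    (hfR : ∀ y, R ≤ f y)
    (hV : ∫⁻ y, k y * ENNReal.ofReal (Φ (f y)) ∂ν ≤ ENNReal.ofReal (Φ v)) :
    ∫⁻ y, k y * ENNReal.ofReal (f y) ∂ν ≤ ENNReal.ofReal v := by
  obtain ⟨c, hc0, hc⟩ := hΦ.exists_pos_supporting_slope hmono hv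
  have hΦv : 0 < Φ v := hΦR.trans (hmono self_mem_Ici hv.le hv)
  -- The supporting line is arranged with sums only, so that nothing is subtracted in `[0,∞]`; the
  -- finite term `Φ v` is cancelled at the end.
  have hpt : ∀ y, ENNReal.ofReal (Φ v) * k y + ENNReal.ofReal c * (k y * ENNReal.ofReal (f y)) ≤
      k y * ENNReal.ofReal (Φ (f y)) + ENNReal.ofReal (c * v) * k y := by
    intro y
    have h1 : ENNReal.ofReal (Φ v) + ENNReal.ofReal c * ENNReal.ofReal (f y) ≤
        ENNReal.ofReal (Φ (f y)) + ENNReal.ofReal (c * v) := by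
      have hf0 : 0 < f y := hR.trans_le (hfR y)
      rw [← ENNReal.ofReal_mul hc0.le, ← ENNReal.ofReal_add hΦv.le (by positivity),
        ← ENNReal.ofReal_add (hΦR.le.trans (hmono.monotoneOn self_mem_Ici (hfR y) (hfR y)))
          (mul_pos hc0 (hR.trans hv)).le]
      refine ENNReal.ofReal_le_ofReal ?_
      have := hc _ (hfR y)
      linarith
    calc _ = k y * (ENNReal.ofReal (Φ v) + ENNReal.ofReal c * ENNReal.ofReal (f y)) := by ring
      _ ≤ k y * (ENNReal.ofReal (Φ (f y)) + ENNReal.ofReal (c * v)) := by gcongr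
      _ = _ := by ring
  have h2 := lintegral_mono (μ := ν) hpt
  rw [lintegral_add_left (hk.const_mul _), lintegral_add_right _ (hk.const_mul _),
    lintegral_const_mul _ hk, lintegral_const_mul _ hk, hk1, mul_one, mul_one,
    lintegral_const_mul' _ _ ENNReal.ofReal_ne_top] at h2
  have h3 := (h2.trans (add_le_add_left hV _))
  rw [ENNReal.add_le_add_iff_left ENNReal.ofReal_ne_top, ENNReal.ofReal_mul hc0.le] at h3
  exact (ENNReal.mul_le_mul_iff_right (by simpa using hc0) ENNReal.ofReal_ne_top).1 h3

/-! ### Monotone iteration below a supersolution -/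

section Iteration

variable {N : ℕ} {θ : ℝ}

attribute [local irreducible] fracHeatKernel

/-- The Duhamel map `U ↦ S(t)m + ∫₀ᵗ S(t - s) F(U(s)) ds`. -/
noncomputable def duhamel (θ : ℝ) (F : ℝ → ℝ) (m : Measure (EuclideanSpace ℝ (Fin N)))
    (U : EuclideanSpace ℝ (Fin N) × ℝ → ℝ≥0∞) (z : EuclideanSpace ℝ (Fin N) × ℝ) : ℝ≥0∞ :=
  fracHeatSemigroup θ z.2 m z.1 +
    ∫⁻ s in Ioo 0 z.2, ∫⁻ y : EuclideanSpace ℝ (Fin N),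
      ENNReal.ofReal (fracHeatKernel θ (z.1 - y) (z.2 - s)) *
        ENNReal.ofReal (F (U (y, s)).toReal)

theorem measurable_fracHeatSemigroup (m : Measure (EuclideanSpace ℝ (Fin N))) [SFinite m] :
    Measurable (fun z : EuclideanSpace ℝ (Fin N) × ℝ => fracHeatSemigroup θ z.2 m z.1) := by
  simp only [fracHeatSemigroup]
  refine Measurable.lintegral_prod_right (f := fun (z : EuclideanSpace ℝ (Fin N) × ℝ)
    (y : EuclideanSpace ℝ (Fin N)) => ENNReal.ofReal (fracHeatKernel θ (z.1 - y) z.2)) ?_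
  exact ENNReal.measurable_ofReal.comp (measurable_fracHeatKernel.comp (by fun_prop :
    Measurable fun p : (EuclideanSpace ℝ (Fin N) × ℝ) × EuclideanSpace ℝ (Fin N) =>
      (p.1.1 - p.2, p.1.2)))

theorem measurable_comp_toReal {X : Type*} [MeasurableSpace X] {F : ℝ → ℝ}
    (hF : ContinuousOn F (Ici 0)) {U : X → ℝ≥0∞} (hU : Measurable U) :
    Measurable (fun z => F (U z).toReal) := by
  have h1 : Continuous (fun τ : ℝ => F (max τ 0)) :=
    hF.comp_continuous (by fun_prop) fun τ => mem_Ici.2 (le_max_right _ _)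
  have h2 : (fun z => F (U z).toReal) = fun z => F (max (U z).toReal 0) := by
    ext z; rw [max_eq_left ENNReal.toReal_nonneg]
  rw [h2]
  exact h1.measurable.comp hU.ennreal_toReal

theorem measurable_duhamel {F : ℝ → ℝ} (hF : ContinuousOn F (Ici 0))
    (m : Measure (EuclideanSpace ℝ (Fin N))) [SFinite m]
    {U : EuclideanSpace ℝ (Fin N) × ℝ → ℝ≥0∞} (hU : Measurable U) :
    Measurable (duhamel θ F m U) := by
  refine (measurable_fracHeatSemigroup m).add ?_
  have h1 : ∀ z : EuclideanSpace ℝ (Fin N) × ℝ,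
      ∫⁻ s in Ioo 0 z.2, ∫⁻ y : EuclideanSpace ℝ (Fin N),
        ENNReal.ofReal (fracHeatKernel θ (z.1 - y) (z.2 - s)) *
          ENNReal.ofReal (F (U (y, s)).toReal) =
      ∫⁻ s, {p : (EuclideanSpace ℝ (Fin N) × ℝ) × ℝ | 0 < p.2 ∧ p.2 < p.1.2}.indicator (fun p =>
        ∫⁻ y : EuclideanSpace ℝ (Fin N),
          ENNReal.ofReal (fracHeatKernel θ (p.1.1 - y) (p.1.2 - p.2)) *
            ENNReal.ofReal (F (U (y, p.2)).toReal)) (z, s) := by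
    intro z
    rw [← lintegral_indicator measurableSet_Ioo]
    congr 1
  simp only [h1]
  refine Measurable.lintegral_prod_right' (f := {p : (EuclideanSpace ℝ (Fin N) × ℝ) × ℝ |
    0 < p.2 ∧ p.2 < p.1.2}.indicator (fun p => ∫⁻ y : EuclideanSpace ℝ (Fin N),
      ENNReal.ofReal (fracHeatKernel θ (p.1.1 - y) (p.1.2 - p.2)) *
        ENNReal.ofReal (F (U (y, p.2)).toReal))) ?_
  have hset : MeasurableSet {p : (EuclideanSpace ℝ (Fin N) × ℝ) × ℝ | 0 < p.2 ∧ p.2 < p.1.2} :=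
    (measurableSet_lt measurable_const measurable_snd).inter
      (measurableSet_lt measurable_snd (measurable_snd.comp measurable_fst))
  refine Measurable.indicator ?_ hset
  refine Measurable.lintegral_prod_right (f := fun (p : (EuclideanSpace ℝ (Fin N) × ℝ) × ℝ)
    (y : EuclideanSpace ℝ (Fin N)) => ENNReal.ofReal (fracHeatKernel θ (p.1.1 - y) (p.1.2 - p.2)) *
      ENNReal.ofReal (F (U (y, p.2)).toReal)) ?_
  refine Measurable.mul (f := fun q : ((EuclideanSpace ℝ (Fin N) × ℝ) × ℝ) ×
      EuclideanSpace ℝ (Fin N) => ENNReal.ofReal (fracHeatKernel θ (q.1.1.1 - q.2) (q.1.1.2 - q.1.2)))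
    (g := fun q => ENNReal.ofReal (F (U (q.2, q.1.2)).toReal)) ?_ ?_
  · exact ENNReal.measurable_ofReal.comp (measurable_fracHeatKernel.comp (by fun_prop :
      Measurable fun q : ((EuclideanSpace ℝ (Fin N) × ℝ) × ℝ) × EuclideanSpace ℝ (Fin N) =>
        (q.1.1.1 - q.2, q.1.1.2 - q.1.2)))
  · exact ENNReal.measurable_ofReal.comp ((measurable_comp_toReal hF hU).comp (by fun_prop :
      Measurable fun q : ((EuclideanSpace ℝ (Fin N) × ℝ) × ℝ) × EuclideanSpace ℝ (Fin N) =>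
        (q.2, q.1.2)))

/-- Since `toReal` sends `∞` to `0`, monotonicity requires the larger function to be finite on the
strip. -/
theorem duhamel_mono {F : ℝ → ℝ} (hFm : MonotoneOn F (Ici 0))
    (m : Measure (EuclideanSpace ℝ (Fin N))) {T : ℝ}
    {U W : EuclideanSpace ℝ (Fin N) × ℝ → ℝ≥0∞}
    (hUW : ∀ y, ∀ s ∈ Ioo 0 T, U (y, s) ≤ W (y, s)) (hW : ∀ y, ∀ s ∈ Ioo 0 T, W (y, s) ≠ ∞)
    (x : EuclideanSpace ℝ (Fin N)) {t : ℝ} (ht : t ∈ Ioo 0 T) :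
    duhamel θ F m U (x, t) ≤ duhamel θ F m W (x, t) := by
  refine add_le_add le_rfl (setLIntegral_mono_ae' measurableSet_Ioo (ae_of_all _ fun s hs =>
    lintegral_mono fun y => ?_))
  have hs' : s ∈ Ioo 0 T := ⟨hs.1, hs.2.trans ht.2⟩
  gcongr
  exact hFm ENNReal.toReal_nonneg ENNReal.toReal_nonneg
    (ENNReal.toReal_mono (hW y s hs') (hUW y s hs'))

/-- The iterates from `0` increase and stay below `w`. Their supremum is a fixed point by monotone
convergence, `F` being continuous and `w` finite. -/
theorem exists_duhamel_eq_of_supersolution {F : ℝ → ℝ} (hFc : ContinuousOn F (Ici 0))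
    (hFm : MonotoneOn F (Ici 0)) (m : Measure (EuclideanSpace ℝ (Fin N))) [SFinite m] {T : ℝ}
    {w : EuclideanSpace ℝ (Fin N) × ℝ → ℝ≥0∞} (hw : ∀ y, ∀ s ∈ Ioo 0 T, w (y, s) ≠ ∞)
    (hsuper : ∀ x, ∀ t ∈ Ioo 0 T, duhamel θ F m w (x, t) ≤ w (x, t)) :
    ∃ U : EuclideanSpace ℝ (Fin N) × ℝ → ℝ≥0∞, Measurable U ∧
      (∀ x, ∀ t ∈ Ioo 0 T, U (x, t) ≤ w (x, t)) ∧
      ∀ x, ∀ t ∈ Ioo 0 T, U (x, t) = duhamel θ F m U (x, t) := by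
  set V : ℕ → EuclideanSpace ℝ (Fin N) × ℝ → ℝ≥0∞ := fun n => (duhamel θ F m)^[n] 0 with hV
  have hVs : ∀ n, V (n + 1) = duhamel θ F m (V n) := fun n => Function.iterate_succ_apply' _ _ _
  have hVm : ∀ n, Measurable (V n) := by
    intro n
    induction n with
    | zero => exact measurable_const
    | succ n ih => rw [hVs]; exact measurable_duhamel hFc m ih
  have hVw : ∀ n x, ∀ t ∈ Ioo 0 T, V n (x, t) ≤ w (x, t) := by
    intro n
    induction n with
    | zero => exact fun x t _ => zero_le
    | succ n ih =>
      intro x t ht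
      rw [hVs]
      exact (duhamel_mono hFm m ih hw x ht).trans (hsuper x t ht)
  have hVfin : ∀ n x, ∀ t ∈ Ioo 0 T, V n (x, t) ≠ ∞ := fun n x t ht =>
    ne_top_of_le_ne_top (hw x t ht) (hVw n x t ht)
  have hVmono : ∀ n x, ∀ t ∈ Ioo 0 T, V n (x, t) ≤ V (n + 1) (x, t) := by
    intro n
    induction n with
    | zero => exact fun x t _ => zero_le
    | succ n ih =>
      intro x t ht
      rw [hVs, hVs (n + 1)]
      exact duhamel_mono hFm m ih (hVfin _) x ht
  have hmono : ∀ x, ∀ t ∈ Ioo 0 T, Monotone fun n => V n (x, t) := fun x t ht =>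
    monotone_nat_of_le_succ fun n => hVmono n x t ht
  have hUw : ∀ x, ∀ t ∈ Ioo 0 T, (⨆ n, V n (x, t)) ≤ w (x, t) := fun x t ht =>
    iSup_le fun n => hVw n x t ht
  refine ⟨fun z => ⨆ n, V n z, Measurable.iSup hVm, hUw, fun x t ht => ?_⟩
  have hF : ∀ y, ∀ s ∈ Ioo 0 T, Tendsto (fun n => ENNReal.ofReal (F (V n (y, s)).toReal)) atTop
      (𝓝 (ENNReal.ofReal (F (⨆ n, V n (y, s)).toReal))) := by
    intro y s hs
    have h1 : Tendsto (fun n => (V n (y, s)).toReal) atTop (𝓝 (⨆ n, V n (y, s)).toReal) :=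
      (ENNReal.tendsto_toReal (ne_top_of_le_ne_top (hw y s hs) (hUw y s hs))).comp
        (tendsto_atTop_iSup (hmono y s hs))
    refine ENNReal.tendsto_ofReal ((hFc _ ENNReal.toReal_nonneg).tendsto.comp
      (tendsto_nhdsWithin_iff.2 ⟨h1, Eventually.of_forall fun n => ENNReal.toReal_nonneg⟩))
  have hFmono : ∀ y, ∀ s ∈ Ioo 0 T, Monotone fun n => ENNReal.ofReal (F (V n (y, s)).toReal) :=
    fun y s hs i j hij => ENNReal.ofReal_le_ofReal (hFm ENNReal.toReal_nonneg ENNReal.toReal_nonneg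
      (ENNReal.toReal_mono (hVfin j y s hs) (hmono y s hs hij)))
  have hmeas : ∀ n, Measurable (fun p : ℝ × EuclideanSpace ℝ (Fin N) =>
      ENNReal.ofReal (fracHeatKernel θ (x - p.2) (t - p.1)) *
        ENNReal.ofReal (F (V n (p.2, p.1)).toReal)) := by
    intro n
    refine Measurable.mul (f := fun p : ℝ × EuclideanSpace ℝ (Fin N) =>
      ENNReal.ofReal (fracHeatKernel θ (x - p.2) (t - p.1)))
      (g := fun p => ENNReal.ofReal (F (V n (p.2, p.1)).toReal)) ?_ ?_
    · exact ENNReal.measurable_ofReal.comp (measurable_fracHeatKernel.comp (by fun_prop :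
        Measurable fun p : ℝ × EuclideanSpace ℝ (Fin N) => (x - p.2, t - p.1)))
    · exact ENNReal.measurable_ofReal.comp ((measurable_comp_toReal hFc (hVm n)).comp (by fun_prop :
        Measurable fun p : ℝ × EuclideanSpace ℝ (Fin N) => (p.2, p.1)))
  have hlim : Tendsto (fun n => duhamel θ F m (V n) (x, t)) atTop
      (𝓝 (duhamel θ F m (fun z => ⨆ n, V n z) (x, t))) := by
    refine Tendsto.const_add _ ?_
    refine lintegral_tendsto_of_tendsto_of_monotone (fun n => ?_) ?_ ?_
    · exact ((hmeas n).lintegral_prod_right').aemeasurable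
    · filter_upwards [ae_restrict_mem measurableSet_Ioo] with s hs i j hij
      refine lintegral_mono fun y => ?_
      exact mul_le_mul_right (hFmono y s ⟨hs.1, hs.2.trans ht.2⟩ hij) _
    · filter_upwards [ae_restrict_mem measurableSet_Ioo] with s hs
      have hs' : s ∈ Ioo 0 T := ⟨hs.1, hs.2.trans ht.2⟩
      refine lintegral_tendsto_of_tendsto_of_monotone
        (fun n => ((hmeas n).comp measurable_prodMk_left).aemeasurable)
        (ae_of_all _ fun y i j hij => ?_) (ae_of_all _ fun y => ?_)
      · exact mul_le_mul_right (hFmono y s hs' hij) _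
      · exact ENNReal.Tendsto.const_mul (hF y s hs') (Or.inr ENNReal.ofReal_ne_top)
  have h2 := (tendsto_atTop_iSup (hmono x t ht)).comp (tendsto_add_atTop_nat 1)
  refine tendsto_nhds_unique h2 ?_
  convert hlim using 2 with n
  exact congrFun (hVs n) (x, t)

end Iteration

/-! ### Functions comparable along power scales -/

/-- For every `M ≥ 1`, the values of `G` on `[τ^(1/M), τ^M]` are comparable to `G τ`, uniformly for
large `τ`. -/
def PowerComparable (G : ℝ → ℝ) : Prop :=
  ∀ M : ℝ, 1 ≤ M → ∃ C : ℝ, 1 ≤ C ∧ ∀ᶠ τ in atTop, ∀ σ, τ ^ (1 / M) ≤ σ → σ ≤ τ ^ M →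
    G σ ≤ C * G τ ∧ G τ ≤ C * G σ

theorem AsympEq.exists_le {f g : ℝ → ℝ} (h : AsympEq f g) (hg : ∀ᶠ τ in atTop, 0 ≤ g τ) :
    ∃ C : ℝ, 1 ≤ C ∧ ∀ᶠ τ in atTop, f τ ≤ C * g τ ∧ g τ ≤ C * f τ := by
  obtain ⟨C, hC, h⟩ := h
  refine ⟨max C 1, le_max_right _ _, ?_⟩
  filter_upwards [h, hg] with τ ⟨h1, h2⟩ h3
  have h4 : g τ ≤ C * f τ := by rwa [inv_mul_le_iff₀ hC] at h1
  have h5 : 0 ≤ f τ := le_trans (by positivity) h1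
  exact ⟨h2.trans (by gcongr; exact le_max_left _ _), h4.trans (by gcongr; exact le_max_left _ _)⟩

theorem PowerComparable.of_one_side {G : ℝ → ℝ}
    (h : ∀ M : ℝ, 1 ≤ M → ∃ C : ℝ, 1 ≤ C ∧ ∀ᶠ τ in atTop, ∀ σ, τ ≤ σ → σ ≤ τ ^ M →
      G σ ≤ C * G τ ∧ G τ ≤ C * G σ) : PowerComparable G := by
  intro M hM
  obtain ⟨C, hC, hA⟩ := h M hM
  obtain ⟨A, hA⟩ := eventually_atTop.1 hA
  refine ⟨C, hC, ?_⟩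
  have hM0 : 0 < M := by linarith
  filter_upwards [eventually_ge_atTop A, eventually_ge_atTop 1,
    (tendsto_rpow_atTop (y := 1 / M) (by positivity)).eventually_ge_atTop A] with τ h1 h2 h3 σ h4 h5
  rcases le_total τ σ with h6 | h6
  · exact hA τ h1 σ h6 h5
  · refine (hA σ (h3.trans h4) τ h6 ?_).symm
    calc τ = (τ ^ (1 / M)) ^ M := by
          rw [← Real.rpow_mul (by linarith), one_div_mul_cancel hM0.ne', Real.rpow_one]
      _ ≤ σ ^ M := by gcongr

/-- Pointwise comparability `G(τ^b) ≍ G(τ)` is uniform in `b`, by Baire's theorem. -/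
theorem PowerComparable.of_asympEq {G : ℝ → ℝ} {R : ℝ} (hGc : ContinuousOn G (Ici R))
    (hGpos : ∀ τ, R ≤ τ → 0 < G τ) (h : ∀ b : ℝ, 0 < b → AsympEq (fun τ => G (τ ^ b)) G) :
    PowerComparable G := by
  set A₀ := max R 1 with hA₀
  have hG0 : ∀ᶠ τ in atTop, 0 ≤ G τ := by
    filter_upwards [eventually_ge_atTop R] with τ hτ using (hGpos τ hτ).le
  -- The exponents are `b = 1 + exp c`, so that `c` ranges over the complete space `ℝ` and `τ ^ b`
  -- stays in the domain of `G`.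
  set S : ℕ → Set ℝ := fun n => {c | ∀ τ, A₀ + n ≤ τ →
    G (τ ^ (1 + Real.exp c)) ≤ n * G τ ∧ G τ ≤ n * G (τ ^ (1 + Real.exp c))} with hS
  have hge : ∀ τ, A₀ ≤ τ → ∀ b : ℝ, 1 ≤ b → R ≤ τ ^ b := by
    intro τ hτ b hb
    have h1 : 1 ≤ τ := (le_max_right _ _).trans hτ
    calc R ≤ τ := (le_max_left _ _).trans hτ
      _ = τ ^ (1 : ℝ) := (Real.rpow_one τ).symm
      _ ≤ τ ^ b := Real.rpow_le_rpow_of_exponent_le h1 hb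
  have hcont : ∀ τ, A₀ ≤ τ → Continuous fun c => G (τ ^ (1 + Real.exp c)) := by
    intro τ hτ
    have h1 : 0 < τ := lt_of_lt_of_le one_pos ((le_max_right _ _).trans hτ)
    refine hGc.comp_continuous ?_ fun c => hge τ hτ _ (by linarith [Real.exp_pos c])
    exact Continuous.rpow continuous_const (by fun_prop) fun c => Or.inl h1.ne'
  have hclosed : ∀ n, IsClosed (S n) := by
    intro n
    have : S n = ⋂ τ ∈ Ici (A₀ + n), {c | G (τ ^ (1 + Real.exp c)) ≤ n * G τ} ∩
        {c | G τ ≤ n * G (τ ^ (1 + Real.exp c))} := by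
      ext c; simp [hS]
    rw [this]
    refine isClosed_biInter fun τ hτ => ?_
    have hτ' : A₀ ≤ τ := le_trans (by simp) (mem_Ici.1 hτ)
    exact (isClosed_le (hcont τ hτ') continuous_const).inter
      (isClosed_le continuous_const ((hcont τ hτ').const_mul _))
  have hunion : ⋃ n, S n = univ := by
    refine eq_univ_of_forall fun c => mem_iUnion.2 ?_
    obtain ⟨C, hC, hev⟩ := (h (1 + Real.exp c) (by positivity)).exists_le hG0
    obtain ⟨A, hA⟩ := eventually_atTop.1 hev
    obtain ⟨n, hn⟩ := exists_nat_ge (max C A)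
    refine ⟨n, fun τ hτ => ?_⟩
    have hA₀1 : 1 ≤ A₀ := le_max_right _ _
    have hτA : A ≤ τ := by linarith [(le_max_right C A).trans hn]
    have hτ₀ : A₀ ≤ τ := by linarith [(Nat.cast_nonneg n : (0 : ℝ) ≤ n)]
    have hCn : C ≤ n := (le_max_left C A).trans hn
    have h1 := hGpos τ ((le_max_left _ _).trans hτ₀)
    have h2 := hGpos _ (hge τ hτ₀ (1 + Real.exp c) (by linarith [Real.exp_pos c]))
    have h3 := hA τ hτA
    exact ⟨h3.1.trans (by gcongr), h3.2.trans (by gcongr)⟩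
  obtain ⟨n, c₀, hc₀⟩ := nonempty_interior_of_iUnion_of_closed hclosed hunion
  obtain ⟨r, hr0, hr⟩ := Metric.isOpen_iff.1 isOpen_interior c₀ hc₀
  set b₁ := 1 + Real.exp c₀ with hb₁
  set b₂ := 1 + Real.exp (c₀ + r / 2) with hb₂
  have hb₁1 : 1 < b₁ := by linarith [Real.exp_pos c₀]
  have hb12 : b₁ < b₂ := by
    have : Real.exp c₀ < Real.exp (c₀ + r / 2) := Real.exp_lt_exp.2 (by linarith)
    linarith
  have hb : ∀ b, b₁ ≤ b → b ≤ b₂ → ∀ τ, A₀ + n ≤ τ → G (τ ^ b) ≤ n * G τ ∧ G τ ≤ n * G (τ ^ b) := by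
    intro b h1 h2 τ hτ
    have hb1 : 0 < b - 1 := by linarith
    have hc : Real.log (b - 1) ∈ S n := by
      refine interior_subset (hr ?_)
      rw [Metric.mem_ball, Real.dist_eq, abs_of_nonneg]
      · have : Real.log (b - 1) ≤ c₀ + r / 2 := by
          rw [Real.log_le_iff_le_exp hb1]; linarith
        linarith
      · have : c₀ ≤ Real.log (b - 1) := by
          rw [Real.le_log_iff_exp_le hb1]; linarith
        linarith
    have := hc τ hτ
    rwa [Real.exp_log hb1, add_sub_cancel] at this
  -- Uniformity on `[b₁, b₂]` gives it on `[1, q]`: with `ρ = τ^(1/b₁)`, both `τ = ρ^b₁` and `σ =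
  -- τ^l = ρ^(b₁ l)` are compared with `ρ`. Iteration then reaches any exponent, because `q > 1`.
  set q := b₂ / b₁ with hq
  have hq1 : 1 < q := by rw [hq, one_lt_div (by linarith)]; exact hb12
  have hn0 : (0 : ℝ) ≤ n := Nat.cast_nonneg n
  have hstep : ∀ᶠ τ in atTop, ∀ σ, τ ≤ σ → σ ≤ τ ^ q →
      G σ ≤ (n * n) * G τ ∧ G τ ≤ (n * n) * G σ := by
    have hb0 : 0 < b₁ := by linarith
    filter_upwards [eventually_gt_atTop 1,
      (tendsto_rpow_atTop (y := 1 / b₁) (by positivity)).eventually_ge_atTop (A₀ + n)] with τ h1 h2 σ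
      h3 h4
    have hτ0 : 0 < τ := by linarith
    have hρ : (τ ^ (1 / b₁)) ^ b₁ = τ := by
      rw [← Real.rpow_mul hτ0.le, one_div_mul_cancel hb0.ne', Real.rpow_one]
    have hρ0 : 0 < τ ^ (1 / b₁) := by positivity
    set l := Real.log σ / Real.log τ with hl
    have hlτ : 0 < Real.log τ := Real.log_pos h1
    have hσ : τ ^ l = σ := by
      rw [Real.rpow_def_of_pos hτ0, hl, mul_div_cancel₀ _ hlτ.ne', Real.exp_log (by linarith)]
    have hl1 : 1 ≤ l := by
      rw [hl, one_le_div hlτ]; exact Real.log_le_log hτ0 h3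
    have hlq : l ≤ q := by
      rw [hl, div_le_iff₀ hlτ, ← Real.log_rpow hτ0]; exact Real.log_le_log (by linarith) h4
    have h5 := hb b₁ le_rfl hb12.le _ h2
    have h6 := hb (b₁ * l) (by nlinarith) (by
      rw [hq, le_div_iff₀ hb0] at hlq; linarith) _ h2
    rw [Real.rpow_mul hρ0.le, hρ, hσ] at h6
    rw [hρ] at h5
    constructor
    · calc G σ ≤ n * G (τ ^ (1 / b₁)) := h6.1
        _ ≤ n * (n * G τ) := by gcongr; exact h5.2
        _ = _ := by ring
    · calc G τ ≤ n * G (τ ^ (1 / b₁)) := h5.1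
        _ ≤ n * (n * G σ) := by gcongr; exact h6.2
        _ = _ := by ring
  have hiter : ∀ k : ℕ, ∃ C : ℝ, 1 ≤ C ∧ ∀ᶠ τ in atTop, ∀ σ, τ ≤ σ → σ ≤ τ ^ (q ^ k) →
      G σ ≤ C * G τ ∧ G τ ≤ C * G σ := by
    intro k
    induction k with
    | zero =>
      refine ⟨1, le_rfl, ?_⟩
      filter_upwards with τ σ h1 h2
      rw [pow_zero, Real.rpow_one] at h2
      rw [le_antisymm h2 h1]; simp
    | succ k ih =>
      obtain ⟨C, hC, hev⟩ := ih
      have hqk : 0 < q ^ k := by positivity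
      refine ⟨max C (C * (n * n)), hC.trans (le_max_left _ _), ?_⟩
      filter_upwards [hev, (tendsto_rpow_atTop hqk).eventually hstep, eventually_ge_atTop A₀]
        with τ h1 h2 h3 σ h4 h5
      have hτ1 : 1 ≤ τ := (le_max_right _ _).trans h3
      have hGτ := hGpos τ ((le_max_left _ _).trans h3)
      have hGσ := hGpos σ ((le_max_left _ _).trans (h3.trans h4))
      have hCn0 : 0 ≤ C * (n * n) := by positivity
      rcases le_total σ (τ ^ (q ^ k)) with h6 | h6
      · have := h1 σ h4 h6
        exact ⟨this.1.trans (by gcongr; exact le_max_left _ _),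
          this.2.trans (by gcongr; exact le_max_left _ _)⟩
      · have hm : τ ≤ τ ^ (q ^ k) := by
          conv_lhs => rw [← Real.rpow_one τ]
          exact Real.rpow_le_rpow_of_exponent_le hτ1 (one_le_pow₀ hq1.le)
        have h7 := h1 _ hm le_rfl
        have h8 := h2 σ h6 (by rwa [← Real.rpow_mul (by linarith), ← pow_succ])
        constructor
        · calc G σ ≤ n * n * G (τ ^ (q ^ k)) := h8.1
            _ ≤ n * n * (C * G τ) := by gcongr; exact h7.1
            _ = C * (n * n) * G τ := by ring
            _ ≤ _ := by gcongr; exact le_max_right _ _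
        · calc G τ ≤ C * G (τ ^ (q ^ k)) := h7.2
            _ ≤ C * (n * n * G σ) := by gcongr; exact h8.2
            _ = C * (n * n) * G σ := by ring
            _ ≤ _ := by gcongr; exact le_max_right _ _
  refine PowerComparable.of_one_side fun M hM => ?_
  obtain ⟨k, hk⟩ := pow_unbounded_of_one_lt M hq1
  obtain ⟨C, hC, hev⟩ := hiter k
  refine ⟨C, hC, ?_⟩
  filter_upwards [hev, eventually_ge_atTop 1] with τ h1 h2 σ h3 h4
  exact h1 σ h3 (h4.trans (Real.rpow_le_rpow_of_exponent_le h2 hk.le))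

section SlowGrowth

variable {G H : ℝ → ℝ} {R : ℝ}

theorem exists_monotoneOn_of_asympEq_deriv (hGpos : ∀ τ, R ≤ τ → 0 < G τ)
    (hHc : ContDiffOn ℝ 1 H (Ici R)) (hder : AsympEq (deriv H) (fun τ => τ⁻¹ * G τ)) :
    ∃ A, R < A ∧ 1 ≤ A ∧ MonotoneOn H (Ici A) ∧ (∀ τ, A ≤ τ → 0 < deriv H τ) ∧
      ∀ τ, A ≤ τ → HasDerivAt H (deriv H τ) τ := by
  obtain ⟨C, hC, hev⟩ := hder
  obtain ⟨A₁, hA₁⟩ := eventually_atTop.1 hev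
  set A := max A₁ (max (R + 1) 1) with hA
  have hAR : R < A := by
    have : R + 1 ≤ A := (le_max_left _ _).trans (le_max_right _ _)
    linarith
  have hA1 : 1 ≤ A := (le_max_right _ _).trans (le_max_right _ _)
  have hpos : ∀ τ, A ≤ τ → 0 < deriv H τ := by
    intro τ hτ
    refine lt_of_lt_of_le ?_ (hA₁ τ ((le_max_left _ _).trans hτ)).1
    have h1 := hGpos τ (hAR.le.trans hτ)
    have h2 : 0 < τ := by linarith
    positivity
  have hd : ∀ τ, A ≤ τ → HasDerivAt H (deriv H τ) τ := fun τ hτ =>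
    ((hHc.differentiableOn one_ne_zero).differentiableAt (Ici_mem_nhds (hAR.trans_le hτ))).hasDerivAt
  refine ⟨A, hAR, hA1, ?_, hpos, hd⟩
  refine monotoneOn_of_deriv_nonneg (convex_Ici A)
    (fun τ hτ => (hd τ hτ).continuousAt.continuousWithinAt) (fun τ hτ => ?_) (fun τ hτ => ?_)
  · rw [interior_Ici] at hτ
    exact (hd τ (le_of_lt hτ)).differentiableAt.differentiableWithinAt
  · rw [interior_Ici] at hτ
    exact (hpos τ (le_of_lt hτ)).le

/-- The derivative of `τ ↦ H(τ^M)` is `Mτ^(M-1) H'(τ^M) ≍ τ⁻¹G(τ^M) ≍ τ⁻¹G(τ) ≍ H'(τ)`, so `B H(τ) -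
H(τ^M)` is eventually increasing for a suitable `B`. -/
theorem PowerComparable.of_asympEq_deriv (hGpos : ∀ τ, R ≤ τ → 0 < G τ) (hG : PowerComparable G)
    (hHc : ContDiffOn ℝ 1 H (Ici R)) (hder : AsympEq (deriv H) (fun τ => τ⁻¹ * G τ))
    (hH : Tendsto H atTop atTop) : PowerComparable H := by
  obtain ⟨A₁, hAR, hA1, hmono, hpos, hd⟩ := exists_monotoneOn_of_asympEq_deriv hGpos hHc hder
  have hg0 : ∀ᶠ τ in atTop, 0 ≤ τ⁻¹ * G τ := by
    filter_upwards [eventually_ge_atTop R, eventually_ge_atTop 0] with τ h1 h2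
    have := hGpos τ h1
    positivity
  obtain ⟨c, hc, hcev⟩ := hder.exists_le hg0
  refine PowerComparable.of_one_side fun M hM => ?_
  obtain ⟨cG, hcG, hGev⟩ := hG M hM
  have hM0 : 0 < M := by linarith
  set B := M * c * c * cG with hB
  have hB1 : 1 ≤ B := by
    have h1 : 1 ≤ M * c := one_le_mul_of_one_le_of_one_le hM hc
    exact one_le_mul_of_one_le_of_one_le (one_le_mul_of_one_le_of_one_le h1 hc) hcG
  obtain ⟨A₂, hA₂⟩ := eventually_atTop.1 (hcev.and hGev)
  set A := max A₁ A₂ with hA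
  have hpow : ∀ τ, A ≤ τ → τ ≤ τ ^ M := by
    intro τ hτ
    conv_lhs => rw [← Real.rpow_one τ]
    exact Real.rpow_le_rpow_of_exponent_le (hA1.trans ((le_max_left _ _).trans hτ)) hM
  set D : ℝ → ℝ := fun τ => B * H τ - H (τ ^ M) with hD
  have hDd : ∀ τ, A ≤ τ → HasDerivAt D
      (B * deriv H τ - deriv H (τ ^ M) * (M * τ ^ (M - 1))) τ := by
    intro τ hτ
    have h1 : A₁ ≤ τ := (le_max_left _ _).trans hτ
    have h2 : 0 < τ := by linarith
    exact ((hd τ h1).const_mul B).sub ((hd _ (h1.trans (hpow τ hτ))).comp τ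
      (Real.hasDerivAt_rpow_const (Or.inl h2.ne')))
  have hDmono : MonotoneOn D (Ici A) := by
    refine monotoneOn_of_deriv_nonneg (convex_Ici A)
      (fun τ hτ => (hDd τ hτ).continuousAt.continuousWithinAt) (fun τ hτ => ?_) (fun τ hτ => ?_)
    · rw [interior_Ici] at hτ
      exact (hDd τ (le_of_lt hτ)).differentiableAt.differentiableWithinAt
    · rw [interior_Ici] at hτ
      have hτ : A ≤ τ := le_of_lt hτ
      rw [(hDd τ hτ).deriv, sub_nonneg]
      have h1 : A₁ ≤ τ := (le_max_left _ _).trans hτ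
      have h2 : 0 < τ := by linarith
      have h3 := hA₂ τ ((le_max_right _ _).trans hτ)
      have h4 := hA₂ (τ ^ M) ((le_max_right _ _).trans (hτ.trans (hpow τ hτ)))
      have h5 : τ ^ (1 / M) ≤ τ ^ M := Real.rpow_le_rpow_of_exponent_le (by linarith)
        ((div_le_one hM0).2 hM |>.trans hM)
      have h6 := (h3.2 (τ ^ M) h5 le_rfl).1
      have h7 : (τ ^ M)⁻¹ * (M * τ ^ (M - 1)) = M * τ⁻¹ := by
        rw [Real.rpow_sub_one h2.ne']
        field_simp
      calc deriv H (τ ^ M) * (M * τ ^ (M - 1))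
          ≤ c * ((τ ^ M)⁻¹ * G (τ ^ M)) * (M * τ ^ (M - 1)) := by gcongr; exact h4.1.1
        _ = c * (M * τ⁻¹) * G (τ ^ M) := by rw [← h7]; ring
        _ ≤ c * (M * τ⁻¹) * (cG * G τ) := by gcongr
        _ = M * c * cG * (τ⁻¹ * G τ) := by ring
        _ ≤ M * c * cG * (c * deriv H τ) :=
            mul_le_mul_of_nonneg_left h3.1.2 (by positivity)
        _ = B * deriv H τ := by rw [hB]; ring
  -- The extra `1` absorbs the initial value `D A`, because `H → ∞`.
  refine ⟨B + 1, by linarith, ?_⟩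
  filter_upwards [eventually_ge_atTop A, hH.eventually_ge_atTop (-D A), hH.eventually_ge_atTop 0]
    with τ h1 h2 h3 σ h4 h5
  have h6 := hDmono self_mem_Ici h1 h1
  have hA₁τ : A₁ ≤ τ := (le_max_left _ _).trans h1
  have h7 : H σ ≤ H (τ ^ M) := hmono (hA₁τ.trans h4) (hA₁τ.trans (h4.trans h5)) h5
  have h8 : H τ ≤ H σ := hmono hA₁τ (hA₁τ.trans h4) h4
  simp only [hD] at h6 h2
  constructor
  · linarith
  · nlinarith

theorem eventually_le_rpow (hH : ∀ δ : ℝ, 0 < δ → Tendsto (fun τ => τ ^ (-δ) * H τ) atTop (𝓝 0))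
    {δ : ℝ} (hδ : 0 < δ) : ∀ᶠ τ in atTop, H τ ≤ τ ^ δ := by
  filter_upwards [(hH δ hδ).eventually (eventually_le_nhds zero_lt_one), eventually_gt_atTop 0]
    with τ h1 h2
  rw [Real.rpow_neg h2.le, inv_mul_le_iff₀ (by positivity), mul_one] at h1
  exact h1

/-- Up to a constant, `τ^δ H(τ)^(-k)` is increasing. For `σ ≥ √τ` the values of `H` are comparable;
for `σ ≤ √τ` the gain `τ^(δ/2)` beats `H(τ)^k`. -/
theorem exists_rpow_mul_rpow_neg_le (hH : PowerComparable H) (hHt : Tendsto H atTop atTop)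
    (hHs : ∀ δ : ℝ, 0 < δ → Tendsto (fun τ => τ ^ (-δ) * H τ) atTop (𝓝 0))
    {δ k : ℝ} (hδ : 0 < δ) (hk : 0 < k) :
    ∃ C : ℝ, 1 ≤ C ∧ ∃ A : ℝ, ∀ σ τ, A ≤ σ → σ ≤ τ →
      σ ^ δ * H σ ^ (-k) ≤ C * (τ ^ δ * H τ ^ (-k)) := by
  obtain ⟨c, hc, hcev⟩ := hH 2 one_le_two
  obtain ⟨A, hA⟩ := eventually_atTop.1 (hcev.and ((hHt.eventually_ge_atTop 1).and
    ((eventually_le_rpow hHs (δ := δ / (2 * k)) (by positivity)).and (eventually_ge_atTop 1))))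
  refine ⟨c ^ k, Real.one_le_rpow hc hk.le, A, fun σ τ h1 h2 => ?_⟩
  obtain ⟨-, hσ1, -, hσ⟩ := hA σ h1
  obtain ⟨hτc, hτ1, hτs, hτ⟩ := hA τ (h1.trans h2)
  have hτ0 : 0 < τ := by linarith
  have hσ0 : 0 < σ := by linarith
  have hck : 1 ≤ c ^ k := Real.one_le_rpow hc hk.le
  have hHτ0 : 0 < H τ := by linarith
  have hHσ0 : 0 < H σ := by linarith
  rcases le_total σ (τ ^ ((1 : ℝ) / 2)) with h3 | h3
  · have h4 : H τ ^ k ≤ τ ^ (δ / 2) := by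
      calc H τ ^ k ≤ (τ ^ (δ / (2 * k))) ^ k := by gcongr
        _ = τ ^ (δ / 2) := by rw [← Real.rpow_mul hτ0.le]; congr 1; field_simp
    calc σ ^ δ * H σ ^ (-k) ≤ σ ^ δ * 1 := by
          gcongr
          exact Real.rpow_le_one_of_one_le_of_nonpos hσ1 (by linarith)
      _ ≤ (τ ^ ((1 : ℝ) / 2)) ^ δ := by rw [mul_one]; gcongr
      _ = τ ^ (δ / 2) := by rw [← Real.rpow_mul hτ0.le]; congr 1; ring
      _ ≤ τ ^ δ * H τ ^ (-k) := by
          rw [Real.rpow_neg hHτ0.le, ← div_eq_mul_inv, le_div_iff₀ (by positivity)]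
          calc τ ^ (δ / 2) * H τ ^ k ≤ τ ^ (δ / 2) * τ ^ (δ / 2) := by gcongr
            _ = τ ^ δ := by rw [← Real.rpow_add hτ0]; congr 1; ring
      _ ≤ _ := le_mul_of_one_le_left (by positivity) hck
  · have h4 := (hτc σ h3 (h2.trans (by
      conv_lhs => rw [← Real.rpow_one τ]
      exact Real.rpow_le_rpow_of_exponent_le hτ one_le_two))).2
    have h5 : H σ ^ (-k) ≤ c ^ k * H τ ^ (-k) := by
      rw [Real.rpow_neg hHσ0.le, Real.rpow_neg hHτ0.le, ← div_eq_mul_inv,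
        le_div_iff₀ (by positivity), inv_mul_le_iff₀ (by positivity),
        mul_comm, ← Real.mul_rpow (by linarith) hHσ0.le]
      gcongr
    calc σ ^ δ * H σ ^ (-k) ≤ τ ^ δ * (c ^ k * H τ ^ (-k)) := by gcongr
      _ = _ := by ring

end SlowGrowth

/-! ### Pointwise bound of the reaction term. -/

/-- Dividing by a power of a slowly growing `h` keeps the value between `√V` and `V`, within the
windows of `PowerComparable`. -/
theorem rpow_half_le_mul_rpow_neg {V h α : ℝ} (hV : 0 < V) (h1 : 1 ≤ h) (hα : 0 < α)
    (hh : h ≤ V ^ (1 / (2 * α))) : V ^ ((1 : ℝ) / 2) ≤ V * h ^ (-α) ∧ V * h ^ (-α) ≤ V := by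
  have h0 : 0 < h := by linarith
  have h2 : h ^ α ≤ V ^ ((1 : ℝ) / 2) := by
    calc h ^ α ≤ (V ^ (1 / (2 * α))) ^ α := by gcongr
      _ = V ^ ((1 : ℝ) / 2) := by rw [← Real.rpow_mul hV.le]; congr 1; field_simp
  have h3 : V ^ ((1 : ℝ) / 2) * V ^ ((1 : ℝ) / 2) = V := by
    rw [← Real.rpow_add hV]; norm_num
  rw [Real.rpow_neg h0.le, ← div_eq_mul_inv]
  constructor
  · rw [le_div_iff₀ (by positivity)]
    calc _ ≤ V ^ ((1 : ℝ) / 2) * V ^ ((1 : ℝ) / 2) := by gcongr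
      _ = V := h3
  · exact div_le_self hV.le (Real.one_le_rpow h1 hα.le)

theorem mul_rpow_neg_mul_rpow {V h α : ℝ} (h0 : 0 < h) : V * h ^ (-α) * h ^ α = V := by
  rw [mul_assoc, ← Real.rpow_add h0]; simp

/-- The power `V^(1+q)` is split into four factors: `V` is kept, `V^η` goes with `hV^(-α) gV` as in
(B5), one `V^δ` goes with `hV^(-αq)` by almost monotonicity, and the other `V^δ` yields `e^δ`. The
letters stand for values of `H` and `G` at `V`, `U` and `τ`, and `X` for `τ H'(τ)`. -/
theorem reaction_algebra {α q η δ V U e hV hU hτ gV gU X c c₄ c₅ c₇ : ℝ} (hα : 0 < α) (hq : 0 < q)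
    (hδ : 1 + q = 1 + η + δ + δ) (hδ0 : 0 < δ) (hV0 : 0 < V) (hU0 : 0 < U) (he : 0 < e)
    (hhV : 0 < hV) (hhU : 0 < hU) (hhτ : 0 < hτ) (hgU : 0 < gU) (hc₄ : 0 < c₄)
    (hc₇ : 0 < c₇) (hVU : V ≤ e * U)
    (h5 : V ^ η * hV ^ (-α) * gV ≤ U ^ η * hU ^ (-α) * gU)
    (h7 : V ^ δ * hV ^ (-(α * q)) ≤ c₇ * (U ^ δ * hU ^ (-(α * q))))
    (hτU : hτ ≤ c₄ * hU) (hUq : U ^ q * hτ ^ (-(α * (1 + q))) = c₅) (hgUX : gU ≤ c * X) :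
    (V * hV ^ (-α)) ^ (1 + q) * gV ≤
      c₇ * (c₄ ^ (α * (1 + q)) * c) * e ^ δ * V * (c₅ * X) := by
  have h1 : V ^ (1 + q) = V * V ^ η * V ^ δ * V ^ δ := by
    rw [hδ, Real.rpow_add hV0, Real.rpow_add hV0, Real.rpow_add hV0, Real.rpow_one]
  have h2 : (hV ^ (-α)) ^ (1 + q) = hV ^ (-α) * hV ^ (-(α * q)) := by
    rw [← Real.rpow_mul hhV.le, ← Real.rpow_add hhV]; congr 1; ring
  have hsplit : (V * hV ^ (-α)) ^ (1 + q) * gV =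
      V * (V ^ η * hV ^ (-α) * gV) * V ^ δ * (V ^ δ * hV ^ (-(α * q))) := by
    rw [Real.mul_rpow hV0.le (by positivity), h1, h2]; ring
  have hjoin : (U ^ η * hU ^ (-α) * gU) * U ^ δ * (U ^ δ * hU ^ (-(α * q))) =
      U ^ q * hU ^ (-(α * (1 + q))) * gU := by
    rw [show q = η + δ + δ by linarith, Real.rpow_add hU0, Real.rpow_add hU0,
      show -(α * (1 + (η + δ + δ))) = -α + -(α * (η + δ + δ)) by ring, Real.rpow_add hhU]
    ring
  have hHUneg : hU ^ (-(α * (1 + q))) ≤ c₄ ^ (α * (1 + q)) * hτ ^ (-(α * (1 + q))) := by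
    rw [Real.rpow_neg hhU.le, Real.rpow_neg hhτ.le, ← div_eq_mul_inv,
      le_div_iff₀ (by positivity), inv_mul_le_iff₀ (by positivity),
      mul_comm (hU ^ _), ← Real.mul_rpow hc₄.le hhU.le]
    gcongr
  have h6 : V ^ δ ≤ e ^ δ * U ^ δ := by
    rw [← Real.mul_rpow he.le hU0.le]; gcongr
  calc _ = V * (V ^ η * hV ^ (-α) * gV) * V ^ δ * (V ^ δ * hV ^ (-(α * q))) := hsplit
    _ ≤ V * (U ^ η * hU ^ (-α) * gU) * (e ^ δ * U ^ δ) * (c₇ * (U ^ δ * hU ^ (-(α * q)))) := by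
        gcongr
    _ = c₇ * e ^ δ * V * ((U ^ η * hU ^ (-α) * gU) * U ^ δ * (U ^ δ * hU ^ (-(α * q)))) := by ring
    _ = c₇ * e ^ δ * V * (U ^ q * hU ^ (-(α * (1 + q))) * gU) := by rw [hjoin]
    _ ≤ c₇ * e ^ δ * V * (U ^ q * (c₄ ^ (α * (1 + q)) * hτ ^ (-(α * (1 + q)))) * (c * X)) := by
        gcongr
    _ = c₇ * (c₄ ^ (α * (1 + q)) * c) * e ^ δ * V * ((U ^ q * hτ ^ (-(α * (1 + q)))) * X) := by ring
    _ = _ := by rw [hUq]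

section Reaction

variable {F G H : ℝ → ℝ} {R α q d η : ℝ}

/-- Bound of `F(2v)` by `V` times the derivative of `s ↦ H(1/s)^(-α)` at `s = 1/τ`,
where `v = V H(V)^(-α)`. -/
theorem exists_reaction_bound (hα : 0 < α) (hq : 0 < q) (hd : 0 < d) (hdq : d * q = 1)
    (hη1 : η < q) (hGpos : ∀ τ, R ≤ τ → 0 < G τ) (hG : PowerComparable G)
    (hHc : ContDiffOn ℝ 1 H (Ici R)) (hF : AsympEq (fun τ => τ ^ (-(1 + q)) * F τ) G)
    (hder : AsympEq (deriv H) (fun τ => τ⁻¹ * G τ)) (hHt : Tendsto H atTop atTop)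
    (hHs : ∀ δ : ℝ, 0 < δ → Tendsto (fun τ => τ ^ (-δ) * H τ) atTop (𝓝 0))
    (hmono : MonotoneOn (fun τ => τ ^ η * H τ ^ (-α) * G τ) (Ioi R)) :
    ∃ C : ℝ, 1 ≤ C ∧ ∃ A : ℝ, ∀ V τ e : ℝ, A ≤ V → A ≤ τ → 0 < e → e ≤ 1 →
      V * H V ^ (-α) ≤ e * (τ ^ d * H τ ^ (-d)) →
      F (2 * (V * H V ^ (-α))) ≤
        C * e ^ ((q - η) / 2) * V * (τ ^ 2 * deriv H τ * H τ ^ (-1 - α)) ∧ H V ≤ C * H τ := by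
  have hH : PowerComparable H := PowerComparable.of_asympEq_deriv hGpos hG hHc hder hHt
  obtain ⟨A₀, hA₀R, hA₀1, hHmono, hHpos', hHd⟩ := exists_monotoneOn_of_asympEq_deriv hGpos hHc hder
  have hG0 : ∀ᶠ τ in atTop, 0 ≤ G τ := by
    filter_upwards [eventually_ge_atTop R] with τ hτ using (hGpos τ hτ).le
  have hg0 : ∀ᶠ τ in atTop, 0 ≤ τ⁻¹ * G τ := by
    filter_upwards [hG0, eventually_ge_atTop 0] with τ h1 h2
    positivity
  set δ := (q - η) / 2 with hδ
  have hδ0 : 0 < δ := by rw [hδ]; linarith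
  -- With this `M` the window `[τ^(1/M), τ^M]` contains `[τ^(d/2), τ^(2d)]`, where `Z` and `U` will
  -- lie.
  set M := 2 * d + 2 / d + 1 with hM
  have h2d : 0 < 2 / d := by positivity
  have hM1 : 1 ≤ M := by linarith
  have hM0 : 0 < M := by linarith
  have hMd : 1 / M ≤ d / 2 := by
    rw [div_le_div_iff₀ hM0 two_pos]
    have : d * (2 / d) = 2 := by field_simp
    nlinarith
  have hMd2 : 2 * d ≤ M := by linarith
  obtain ⟨c₁, hc₁, hF₁⟩ := hF.exists_le hG0
  obtain ⟨c₂, hc₂, hG₂⟩ := hG 2 one_le_two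
  obtain ⟨c₃, hc₃, hH₃⟩ := hH 2 one_le_two
  obtain ⟨c₄, hc₄, hH₄⟩ := hH M hM1
  obtain ⟨c₆, hc₆, hG₆⟩ := hG M hM1
  obtain ⟨c₇, hc₇, A₇, h₇⟩ := exists_rpow_mul_rpow_neg_le hH hHt hHs (δ := δ) (k := α * q) hδ0
    (by positivity)
  obtain ⟨c₈, hc₈, h₈⟩ := hder.exists_le hg0
  set c₅ := (c₃ * c₄) ^ α with hc₅
  have hc₃₄ : 1 ≤ c₃ * c₄ := one_le_mul_of_one_le_of_one_le hc₃ hc₄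
  have hc₅1 : 1 ≤ c₅ := Real.one_le_rpow hc₃₄ hα.le
  set K := c₁ * 2 ^ (1 + q) * c₂ * c₇ * (c₄ ^ (α * (1 + q)) * c₆ * c₈ * c₅ ^ q) with hK
  have hhalf : Tendsto (fun V : ℝ => V ^ ((1 : ℝ) / 2)) atTop atTop := tendsto_rpow_atTop (by norm_num)
  have hbase := (hHt.eventually_ge_atTop 1).and (eventually_ge_atTop (max A₀ 2))
  have hVev := ((hbase.and (eventually_le_rpow hHs (δ := 1 / (2 * α)) (by positivity))).and
    (hG₂.and hH₃)).and ((hhalf.eventually_ge_atTop A₀).and ((hhalf.eventually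
      (eventually_forall_ge_atTop.2 hF₁)).and (eventually_ge_atTop A₇)))
  have hτev := ((hbase.and (eventually_le_rpow hHs (δ := 1 / 2) (by positivity))).and
    (eventually_le_rpow hHs (δ := d / (2 * α)) (by positivity))).and ((hG₆.and hH₄).and
      (((tendsto_rpow_atTop (y := d / 2) (by positivity)).eventually_ge_atTop (max A₀ c₅)).and h₈))
  obtain ⟨A₁, hA₁⟩ := eventually_atTop.1 hVev
  obtain ⟨A₂, hA₂⟩ := eventually_atTop.1 hτev
  refine ⟨max K (c₃ * c₄), hc₃₄.trans (le_max_right _ _), max A₁ A₂, ?_⟩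
  intro V τ e hV hτ he0 he1 hve
  obtain ⟨⟨⟨⟨hHV1, hV2⟩, hHVs⟩, hGV, hHV⟩, hVA, hFV, hVA₇⟩ := hA₁ V ((le_max_left _ _).trans hV)
  obtain ⟨⟨⟨⟨hHτ1, hτ2⟩, hHτs⟩, hHτs'⟩, ⟨hGτ, hHτ⟩, hτA, hG8⟩ :=
    hA₂ τ ((le_max_right _ _).trans hτ)
  have hV0 : 0 < V := by linarith [(le_max_right _ _).trans hV2]
  have hτ0 : 0 < τ := by linarith [(le_max_right _ _).trans hτ2]
  have hV1 : 1 ≤ V := by linarith [(le_max_right _ _).trans hV2]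
  have hτ1 : 1 ≤ τ := by linarith [(le_max_right _ _).trans hτ2]
  have hHV0 : 0 < H V := by linarith
  have hHτ0 : 0 < H τ := by linarith
  set v := V * H V ^ (-α) with hv
  have hv0 : 0 < v := by positivity
  have hvV : v * H V ^ α = V := mul_rpow_neg_mul_rpow hHV0
  obtain ⟨hv1, hv2⟩ := rpow_half_le_mul_rpow_neg hV0 hHV1 hα hHVs
  have hVsq : 2 * V ≤ V ^ (2 : ℝ) := by
    rw [Real.rpow_two, sq]
    gcongr
    exact (le_max_right _ _).trans hV2
  -- bound of the nonlinearity by `v^(1+q) G(V)`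
  have hFv : F (2 * v) ≤ c₁ * 2 ^ (1 + q) * c₂ * (v ^ (1 + q) * G V) := by
    have h1 := (hFV (2 * v) (by linarith)).1
    rw [Real.rpow_neg (by positivity), inv_mul_le_iff₀ (by positivity)] at h1
    have h2 := (hGV (2 * v) (by linarith) (by linarith)).1
    calc F (2 * v) ≤ (2 * v) ^ (1 + q) * (c₁ * G (2 * v)) := h1
      _ ≤ (2 * v) ^ (1 + q) * (c₁ * (c₂ * G V)) := by gcongr
      _ = _ := by rw [Real.mul_rpow two_pos.le hv0.le]; ring
  set Z := τ ^ d * H τ ^ (-d) with hZ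
  have hZ0 : 0 < Z := by positivity
  have hdd : τ ^ (d / 2) * τ ^ (d / 2) = τ ^ d := by
    rw [← Real.rpow_add hτ0]; congr 1; ring
  obtain ⟨hZ1, hZ2⟩ := rpow_half_le_mul_rpow_neg (V := τ ^ d) (by positivity) hHτ1 hd (by
    rw [← Real.rpow_mul hτ0.le, show d * (1 / (2 * d)) = 1 / 2 by field_simp]; exact hHτs)
  rw [← Real.rpow_mul hτ0.le, mul_one_div] at hZ1
  have hvZ : v ≤ Z := hve.trans (mul_le_of_le_one_left hZ0.le he1)
  have hMlow : τ ^ (1 / M) ≤ τ ^ (d / 2) := Real.rpow_le_rpow_of_exponent_le hτ1 hMd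
  have hMup : τ ^ (2 * d) ≤ τ ^ M := Real.rpow_le_rpow_of_exponent_le hτ1 hMd2
  have hdM : τ ^ d ≤ τ ^ M := Real.rpow_le_rpow_of_exponent_le hτ1 (by linarith)
  have hHVτ : H V ≤ c₃ * c₄ * H τ := by
    have h1 := (hHV v hv1 (by linarith)).2
    have h2 : H v ≤ H Z := hHmono (hVA.trans hv1) (hVA.trans (hv1.trans hvZ)) hvZ
    have h3 := (hHτ Z (hMlow.trans hZ1) (hZ2.trans hdM)).1
    calc H V ≤ c₃ * H v := h1
      _ ≤ c₃ * (c₄ * H τ) := by gcongr; exact h2.trans h3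
      _ = _ := by ring
  refine ⟨?_, hHVτ.trans (by gcongr; exact le_max_right _ _)⟩
  -- `U` is, up to a constant, the largest `V` allowed: `V = v H(V)^α` with `v ≤ e Z` and `H(V) ≲
  -- H(τ)` gives `V ≤ e U`.
  set U := c₅ * (Z * H τ ^ α) with hU
  have hU0 : 0 < U := by positivity
  have hVU : V ≤ e * U := by
    calc V = v * H V ^ α := hvV.symm
      _ ≤ (e * Z) * (c₃ * c₄ * H τ) ^ α := by gcongr
      _ = e * U := by
          rw [Real.mul_rpow (by positivity) hHτ0.le, hU, hc₅]; ring
  have hVU' : V ≤ U := hVU.trans (mul_le_of_le_one_left hU0.le he1)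
  have hU1 : τ ^ (d / 2) ≤ U := by
    have h1 : 1 ≤ H τ ^ α := Real.one_le_rpow hHτ1 hα.le
    calc τ ^ (d / 2) ≤ Z := hZ1
      _ ≤ Z * H τ ^ α := le_mul_of_one_le_right hZ0.le h1
      _ ≤ U := le_mul_of_one_le_left (by positivity) hc₅1
  have hU2 : U ≤ τ ^ (2 * d) := by
    have h1 : H τ ^ α ≤ τ ^ (d / 2) := by
      calc H τ ^ α ≤ (τ ^ (d / (2 * α))) ^ α := by gcongr
        _ = τ ^ (d / 2) := by rw [← Real.rpow_mul hτ0.le]; congr 1; field_simp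
    calc U ≤ τ ^ (d / 2) * (τ ^ d * τ ^ (d / 2)) := by
          rw [hU]; gcongr
          exact (le_max_right _ _).trans hτA
      _ = (τ ^ (d / 2) * τ ^ (d / 2)) * τ ^ d := by ring
      _ = τ ^ (2 * d) := by rw [hdd, ← Real.rpow_add hτ0]; congr 1; ring
  have hGU := (hGτ U (hMlow.trans hU1) (hU2.trans hMup)).1
  have hHU := (hHτ U (hMlow.trans hU1) (hU2.trans hMup)).2
  have hUA₀ : A₀ ≤ U := (le_max_left _ _).trans (hτA.trans hU1)
  have hHU0 : 0 < H U :=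
    (mul_pos_iff_of_pos_left (zero_lt_one.trans_le hc₄)).1 (hHτ0.trans_le hHU)
  have hVR : R < V := hA₀R.trans_le ((le_max_left _ _).trans hV2)
  have hGU0 : 0 < G U := hGpos U (hVR.le.trans hVU')
  have hGτ0 : 0 < G τ := hGpos τ (hA₀R.le.trans ((le_max_left _ _).trans hτ2))
  have hGV0 : 0 < G V := hGpos V hVR.le
  have hH'0 : 0 < deriv H τ := hHpos' τ ((le_max_left _ _).trans hτ2)
  -- Criticality enters here: `d q = 1` gives `Z^q = τ / H(τ)`.
  have hUq : U ^ q * H τ ^ (-(α * (1 + q))) = c₅ ^ q * (τ * H τ ^ (-1 - α)) := by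
    rw [hU, hZ, Real.mul_rpow (by positivity) (by positivity), Real.mul_rpow (by positivity)
      (by positivity), Real.mul_rpow (by positivity) (by positivity), ← Real.rpow_mul hτ0.le, hdq,
      Real.rpow_one, ← Real.rpow_mul hHτ0.le, ← Real.rpow_mul hHτ0.le,
      show H τ ^ (-1 - α) = H τ ^ (-d * q) * H τ ^ (α * q) * H τ ^ (-(α * (1 + q))) by
        rw [← Real.rpow_add hHτ0, ← Real.rpow_add hHτ0]; congr 1; rw [neg_mul, hdq]; ring]
    ring
  have hGH : G τ ≤ c₈ * (τ * deriv H τ) := by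
    have := hG8.2
    rw [inv_mul_le_iff₀ hτ0] at this
    linarith
  have hGUX : G U ≤ c₆ * c₈ * (τ * deriv H τ) := by
    calc G U ≤ c₆ * G τ := hGU
      _ ≤ c₆ * (c₈ * (τ * deriv H τ)) := by gcongr
      _ = _ := by ring
  have hmain := reaction_algebra hα hq (show 1 + q = 1 + η + δ + δ by rw [hδ]; ring) hδ0 hV0 hU0 he0
    hHV0 hHU0 hHτ0 hGU0 (by linarith) (by linarith) hVU (hmono hVR (hVR.trans_le hVU') hVU')
    (h₇ V U hVA₇ hVU') hHU hUq hGUX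
  have he0' : 0 < e ^ δ := by positivity
  calc F (2 * v) ≤ c₁ * 2 ^ (1 + q) * c₂ * (v ^ (1 + q) * G V) := hFv
    _ ≤ c₁ * 2 ^ (1 + q) * c₂ * (c₇ * (c₄ ^ (α * (1 + q)) * (c₆ * c₈)) * e ^ δ * V *
          (c₅ ^ q * (τ * H τ ^ (-1 - α)) * (τ * deriv H τ))) := by gcongr
    _ = K * e ^ δ * V * (τ ^ 2 * deriv H τ * H τ ^ (-1 - α)) := by rw [hK]; ring
    _ ≤ _ := by
        gcongr
        exact le_max_left _ _

end Reaction

/-! ### The inverse of `Φ`, doubling and sublinearity. -/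

section InverseFunction

variable {Φ H : ℝ → ℝ} {R α : ℝ}

/-- Convexity gives continuity only in the interior; at the endpoint `Φ` is squeezed between `Φ R`
and a chord. -/
theorem ConvexOn.continuousOn_Ici_of_strictMonoOn (hc : ConvexOn ℝ (Ici R) Φ)
    (hm : StrictMonoOn Φ (Ici R)) : ContinuousOn Φ (Ici R) := by
  intro x hx
  rcases (mem_Ici.1 hx).eq_or_lt with rfl | hx'
  · have hup : ∀ τ ∈ Icc R (R + 1), Φ τ ≤ Φ R + (τ - R) * (Φ (R + 1) - Φ R) := by
      intro τ hτ
      have := hc.2 (show R ∈ Ici R from self_mem_Ici) (show R + 1 ∈ Ici R by simp)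
        (show 0 ≤ 1 - (τ - R) by linarith [hτ.2])
        (show 0 ≤ τ - R by linarith [hτ.1]) (by ring)
      simp only [smul_eq_mul] at this
      rw [show (1 - (τ - R)) * R + (τ - R) * (R + 1) = τ by ring] at this
      linarith
    have hmem : Icc R (R + 1) ∈ 𝓝[≥] R := Icc_mem_nhdsGE (by linarith)
    refine tendsto_of_tendsto_of_tendsto_of_le_of_le' (g := fun _ => Φ R)
      (h := fun τ => Φ R + (τ - R) * (Φ (R + 1) - Φ R)) tendsto_const_nhds ?_ ?_ ?_
    · have : Continuous fun τ => Φ R + (τ - R) * (Φ (R + 1) - Φ R) := by fun_prop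
      have h := (this.tendsto R).mono_left (nhdsWithin_le_nhds (s := Ici R))
      simpa using h
    · filter_upwards [hmem] with τ hτ using hm.monotoneOn self_mem_Ici hτ.1 hτ.1
    · filter_upwards [hmem] with τ hτ using hup τ hτ
  · have h1 := hc.continuousOn_interior
    rw [interior_Ici] at h1
    exact ((h1 x hx').continuousAt (Ioi_mem_nhds hx')).continuousWithinAt

/-- A supporting line of positive slope forces `Φ` to be unbounded, and the intermediate value
theorem does the rest. -/
theorem ConvexOn.surjOn_Ici_of_strictMonoOn (hc : ConvexOn ℝ (Ici R) Φ)
    (hm : StrictMonoOn Φ (Ici R)) : SurjOn Φ (Ici R) (Ici (Φ R)) := by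
  intro V hV
  obtain ⟨c, hc0, hsl⟩ := hc.exists_pos_supporting_slope hm (v := R + 1) (by linarith)
  set b := max R (R + 1 + (V - Φ (R + 1)) / c) with hb
  have hRb : R ≤ b := le_max_left _ _
  have hVb : V ≤ Φ b := by
    refine le_trans ?_ (hsl b hRb)
    have h1 : R + 1 + (V - Φ (R + 1)) / c ≤ b := le_max_right _ _
    have h2 : (V - Φ (R + 1)) / c ≤ b - (R + 1) := by linarith
    rw [div_le_iff₀ hc0] at h2
    linarith
  obtain ⟨z, hz, rfl⟩ := intermediate_value_Icc hRb
    ((hc.continuousOn_Ici_of_strictMonoOn hm).mono Icc_subset_Ici_self) ⟨hV, hVb⟩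
  exact ⟨z, hz.1, rfl⟩

theorem ConvexOn.invFunOn_spec (hc : ConvexOn ℝ (Ici R) Φ) (hm : StrictMonoOn Φ (Ici R)) {V : ℝ}
    (hV : Φ R ≤ V) : R ≤ Function.invFunOn Φ (Ici R) V ∧ Φ (Function.invFunOn Φ (Ici R) V) = V :=
  ⟨Function.invFunOn_mem (hc.surjOn_Ici_of_strictMonoOn hm hV),
    Function.invFunOn_eq (hc.surjOn_Ici_of_strictMonoOn hm hV)⟩

theorem StrictMonoOn.invFunOn_apply (hm : StrictMonoOn Φ (Ici R)) {z : ℝ} (hz : R ≤ z) :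
    Function.invFunOn Φ (Ici R) (Φ z) = z :=
  hm.injOn.leftInvOn_invFunOn hz

theorem ConvexOn.invFunOn_le_iff (hc : ConvexOn ℝ (Ici R) Φ) (hm : StrictMonoOn Φ (Ici R)) {V z : ℝ}
    (hV : Φ R ≤ V) (hz : R ≤ z) : Function.invFunOn Φ (Ici R) V ≤ z ↔ V ≤ Φ z := by
  have h := hc.invFunOn_spec hm hV
  conv_rhs => rw [← h.2]
  exact (hm.le_iff_le h.1 hz).symm

theorem ConvexOn.monotoneOn_invFunOn (hc : ConvexOn ℝ (Ici R) Φ) (hm : StrictMonoOn Φ (Ici R)) :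
    MonotoneOn (Function.invFunOn Φ (Ici R)) (Ici (Φ R)) := by
  intro V hV W hW h
  rw [hc.invFunOn_le_iff hm hV (hc.invFunOn_spec hm hW).1, (hc.invFunOn_spec hm hW).2]
  exact h

/-- Inverting (B4) gives `Φ(z) = z H(Φ(z))^α` with `√Φ(z) ≤ z ≤ Φ(z)`, so `H(Φ(2z))` is bounded by a
multiple of `H(z) ≤ H(Φ(z))`. -/
theorem exists_doubling (hα : 0 < α) (hc : ConvexOn ℝ (Ici R) Φ) (hm : StrictMonoOn Φ (Ici R))
    (hR : 0 < R)
    (hinv : ∀ τ, Φ R ≤ τ → Function.invFunOn Φ (Ici R) τ = τ * H τ ^ (-α))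
    (hH : PowerComparable H) (hHt : Tendsto H atTop atTop)
    (hHs : ∀ δ : ℝ, 0 < δ → Tendsto (fun τ => τ ^ (-δ) * H τ) atTop (𝓝 0))
    {A₀ : ℝ} (hHm : MonotoneOn H (Ici A₀)) :
    ∃ C : ℝ, 1 ≤ C ∧ ∃ A : ℝ, ∀ z, A ≤ z → Φ (2 * z) ≤ C * Φ z ∧ z ≤ Φ z := by
  obtain ⟨c, hc1, hcev⟩ := hH 2 one_le_two
  obtain ⟨A₁, hA₁⟩ := eventually_atTop.1 (((hHt.eventually_ge_atTop 1).and
    (eventually_le_rpow hHs (δ := 1 / (2 * α)) (by positivity))).and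
    (hcev.and (eventually_ge_atTop (max (max A₀ (Φ R)) 2))))
  obtain ⟨z₁, hz₁R, hz₁⟩ := hc.surjOn_Ici_of_strictMonoOn hm (mem_Ici.2 (le_max_right A₁ (Φ R)))
  have hcc : 1 ≤ c * c := one_le_mul_of_one_le_of_one_le hc1 hc1
  refine ⟨2 * (c * c) ^ α, by linarith [Real.one_le_rpow hcc hα.le], max z₁ (max A₁ 2), ?_⟩
  -- for large `V = Φ z`: `V = z H(V)^α`, `√V ≤ z ≤ V`
  have hfact : ∀ z, z₁ ≤ z → A₁ ≤ Φ z ∧ Φ z = z * H (Φ z) ^ α ∧ Φ z ^ ((1 : ℝ) / 2) ≤ z ∧ z ≤ Φ z := by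
    intro z hz
    have hzR : R ≤ z := hz₁R.trans hz
    have hz0 : 0 < z := hR.trans_le hzR
    have h1 : A₁ ≤ Φ z := by
      refine le_trans ?_ (hm.monotoneOn hz₁R hzR hz)
      rw [hz₁]; exact le_max_left _ _
    obtain ⟨⟨hH1, hHr⟩, -, h2⟩ := hA₁ _ h1
    have hV0 : 0 < Φ z := by linarith [(le_max_right _ _).trans h2]
    have hH0 : 0 < H (Φ z) := by linarith
    have h3 := hinv (Φ z) (hm.monotoneOn self_mem_Ici hzR hzR)
    rw [hm.invFunOn_apply hzR] at h3
    have h4 : z * H (Φ z) ^ α = Φ z := by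
      calc z * H (Φ z) ^ α = Φ z * H (Φ z) ^ (-α) * H (Φ z) ^ α := congrArg (· * _) h3
        _ = Φ z := mul_rpow_neg_mul_rpow hH0
    have h5 := rpow_half_le_mul_rpow_neg hV0 hH1 hα hHr
    rw [← h3] at h5
    exact ⟨h1, h4.symm, h5⟩
  intro z hz
  have hz₁z : z₁ ≤ z := (le_max_left _ _).trans hz
  have hzR : R ≤ z := hz₁R.trans hz₁z
  have hz0 : 0 < z := hR.trans_le hzR
  have hA₁z : A₁ ≤ z := (le_max_left _ _).trans ((le_max_right _ _).trans hz)
  have hz2 : 2 ≤ z := (le_max_right _ _).trans ((le_max_right _ _).trans hz)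
  obtain ⟨hV1, hV2, -, hV4⟩ := hfact z hz₁z
  obtain ⟨hW1, hW2, hW3, hW4⟩ := hfact (2 * z) (by linarith)
  refine ⟨?_, hV4⟩
  obtain ⟨-, hWc, -⟩ := hA₁ _ hW1
  obtain ⟨⟨hHz1, -⟩, hzc, hzm⟩ := hA₁ z hA₁z
  have hW0 : 1 ≤ Φ (2 * z) := by linarith
  have h1 : H (Φ (2 * z)) ≤ c * H (2 * z) := (hWc (2 * z) hW3 (hW4.trans (by
    conv_lhs => rw [← Real.rpow_one (Φ (2 * z))]
    exact Real.rpow_le_rpow_of_exponent_le hW0 one_le_two))).2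
  have h2 : H (2 * z) ≤ c * H z := (hzc (2 * z) (by
    calc z ^ ((1 : ℝ) / 2) ≤ z ^ (1 : ℝ) := Real.rpow_le_rpow_of_exponent_le (by linarith) (by norm_num)
      _ ≤ 2 * z := by rw [Real.rpow_one]; linarith) (by rw [Real.rpow_two]; nlinarith)).1
  have hA₀z : A₀ ≤ z := (le_max_left _ _).trans ((le_max_left _ _).trans hzm)
  have h3 : H z ≤ H (Φ z) := hHm hA₀z (hA₀z.trans hV4) hV4
  have hHW0 : 0 < H (Φ (2 * z)) := by linarith [(hA₁ _ hW1).1.1]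
  calc Φ (2 * z) = 2 * z * H (Φ (2 * z)) ^ α := hW2
    _ ≤ 2 * z * (c * (c * H (Φ z))) ^ α := by
        gcongr
        exact h1.trans (by gcongr; exact h2.trans (by gcongr))
    _ = 2 * (c * c) ^ α * (z * H (Φ z) ^ α) := by
        rw [← mul_assoc c c, Real.mul_rpow (by positivity) (by linarith)]; ring
    _ = 2 * (c * c) ^ α * Φ z := by rw [← hV2]

/-- Since `H` increases, the factor `H^(-α)` in `Φ⁻¹` only decreases when the argument is multiplied
by `K`. -/
theorem invFunOn_le_mul (hα : 0 < α) (hc : ConvexOn ℝ (Ici R) Φ) (hm : StrictMonoOn Φ (Ici R))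
    (hR : 0 < R) (hHpos : ∀ τ, R ≤ τ → 0 < H τ)
    (hinv : ∀ τ, Φ R ≤ τ → Function.invFunOn Φ (Ici R) τ = τ * H τ ^ (-α))
    {A₀ : ℝ} (hRA₀ : R ≤ A₀) (hHm : MonotoneOn H (Ici A₀)) {K V z : ℝ} (hK : 1 ≤ K)
    (hz : R ≤ z) (hzA : A₀ ≤ Φ z) (hV : Φ R ≤ V) (hVz : V ≤ K * Φ z) :
    Function.invFunOn Φ (Ici R) V ≤ K * z := by
  have hΦ0 : 0 < Φ z := hR.trans_le (hRA₀.trans hzA)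
  have h1 : Φ z ≤ K * Φ z := le_mul_of_one_le_left hΦ0.le hK
  have h2 : Φ R ≤ Φ z := hm.monotoneOn self_mem_Ici hz hz
  have h3 := hc.monotoneOn_invFunOn hm hV (h2.trans h1) hVz
  have h4 : H (Φ z) ≤ H (K * Φ z) := hHm hzA (hzA.trans h1) h1
  have h5 := hHpos _ (hRA₀.trans hzA)
  have h6 := hinv (Φ z) h2
  rw [hm.invFunOn_apply hz] at h6
  calc _ ≤ Function.invFunOn Φ (Ici R) (K * Φ z) := h3
    _ = K * Φ z * H (K * Φ z) ^ (-α) := hinv _ (h2.trans h1)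
    _ ≤ K * Φ z * H (Φ z) ^ (-α) := by
        gcongr ?_ * ?_
        exact Real.rpow_le_rpow_of_nonpos h5 h4 (by linarith)
    _ = K * z := by rw [mul_assoc, ← h6]

end InverseFunction

/-! ### Consequences of the smallness condition -/

/-- The integrand is the derivative of `s ↦ H(1/s)^(-α)/α`, which tends to `0` as `s → 0`. -/
theorem lintegral_deriv_comp_inv_le {H : ℝ → ℝ} {α A t : ℝ} (hα : 0 < α) (ht : 0 < t)
    (htA : A ≤ t⁻¹) (hpos : ∀ τ, A ≤ τ → 0 < H τ) (hd : ∀ τ, A ≤ τ → HasDerivAt H (deriv H τ) τ)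
    (hd0 : ∀ τ, A ≤ τ → 0 < deriv H τ) (hHt : Tendsto H atTop atTop) :
    ∫⁻ s in Ioo 0 t, ENNReal.ofReal (s⁻¹ ^ 2 * deriv H s⁻¹ * H s⁻¹ ^ (-1 - α)) ≤
      ENNReal.ofReal (H t⁻¹ ^ (-α) / α) := by
  set g : ℝ → ℝ := fun s => s⁻¹ ^ 2 * deriv H s⁻¹ * H s⁻¹ ^ (-1 - α) with hg
  -- Setting `P` to `0` for `s ≤ 0` makes it continuous on `[0,t]`, where `H s⁻¹` itself would
  -- involve `0⁻¹ = 0`. Integrability of the nonnegative derivative is then automatic.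
  set P : ℝ → ℝ := fun s => if s ≤ 0 then 0 else H s⁻¹ ^ (-α) / α with hP
  have hPpos : ∀ s, 0 < s → P s = H s⁻¹ ^ (-α) / α := fun s hs => if_neg (not_le.2 hs)
  have hinv : ∀ s ∈ Ioc 0 t, A ≤ s⁻¹ := fun s hs => htA.trans (inv_anti₀ hs.1 hs.2)
  have hder : ∀ s ∈ Ioc 0 t, HasDerivAt P (g s) s := by
    intro s hs
    have hs0 : s ≠ 0 := hs.1.ne'
    have h1 := ((hd s⁻¹ (hinv s hs)).comp s (hasDerivAt_inv hs0)).rpow_const (p := -α)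
      (Or.inl (hpos _ (hinv s hs)).ne')
    have h2 := h1.div_const α
    have h3 : P =ᶠ[𝓝 s] fun s => (H ∘ Inv.inv) s ^ (-α) / α := by
      filter_upwards [Ioi_mem_nhds hs.1] with r hr using hPpos r hr
    refine (h2.congr_of_eventuallyEq h3).congr_deriv ?_
    simp only [hg, Function.comp_apply]
    rw [show -α - 1 = -1 - α by ring]
    field_simp
  have hcont : ContinuousOn P (Icc 0 t) := by
    intro s hs
    rcases hs.1.eq_or_lt with rfl | hs0
    · refine ContinuousWithinAt.mono (t := Ici 0) ?_ Icc_subset_Ici_self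
      rw [← Ioi_insert, continuousWithinAt_insert_self]
      have h0 : P 0 = 0 := if_pos le_rfl
      have h1 : Tendsto (fun s => H s⁻¹ ^ (-α) / α) (𝓝[>] 0) (𝓝 (0 / α)) :=
        (((tendsto_rpow_neg_atTop hα).comp hHt).comp tendsto_inv_nhdsGT_zero).div_const α
      rw [ContinuousWithinAt, h0]
      rw [zero_div] at h1
      refine h1.congr' ?_
      filter_upwards [self_mem_nhdsWithin] with r hr using (hPpos r hr).symm
    · exact (hder s ⟨hs0, hs.2⟩).continuousAt.continuousWithinAt
  have hg0 : ∀ s ∈ Ioc 0 t, 0 ≤ g s := by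
    intro s hs
    have h1 := (hpos _ (hinv s hs)).le
    have h2 := (hd0 _ (hinv s hs)).le
    have h3 := hs.1.le
    simp only [hg]
    positivity
  have hint : IntegrableOn g (Ioc 0 t) := intervalIntegral.integrableOn_deriv_of_nonneg hcont
    (fun s hs => hder s ⟨hs.1, hs.2.le⟩) (fun s hs => hg0 s ⟨hs.1, hs.2.le⟩)
  have hval := intervalIntegral.integral_eq_sub_of_hasDerivAt_of_le ht.le hcont
    (fun s hs => hder s ⟨hs.1, hs.2.le⟩)
    ((intervalIntegrable_iff_integrableOn_Ioc_of_le ht.le).2 hint)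
  rw [hPpos t ht, show P 0 = 0 from if_pos le_rfl, sub_zero,
    intervalIntegral.integral_of_le ht.le] at hval
  rw [← hval, ofReal_integral_eq_lintegral_ofReal hint]
  · exact lintegral_mono_set Ioo_subset_Ioc_self
  · filter_upwards [ae_restrict_mem measurableSet_Ioc] with s hs using hg0 s hs

theorem StrictMonoOn.aemeasurable_comp {X : Type*} [MeasurableSpace X] {ν : Measure X} {Φ : ℝ → ℝ}
    {R : ℝ} (hm : StrictMonoOn Φ (Ici R)) {f : X → ℝ} (hf : AEMeasurable f ν) (hfR : ∀ y, R ≤ f y) :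
    AEMeasurable (fun y => Φ (f y)) ν := by
  have h1 : Monotone fun τ => Φ (max τ R) := fun a b hab =>
    hm.monotoneOn (mem_Ici.2 (le_max_right _ _)) (mem_Ici.2 (le_max_right _ _))
      (max_le_max_right R hab)
  have h2 : (fun y => Φ (f y)) = fun y => Φ (max (f y) R) := by
    ext y; rw [max_eq_left (hfR y)]
  rw [h2]
  exact h1.measurable.comp_aemeasurable hf

section Condition

variable {N : ℕ} {Φ : ℝ → ℝ} {R : ℝ} {μ : EuclideanSpace ℝ (Fin N) → ℝ}

theorem extInverse_of_ne_top {y : ℝ≥0∞} (hy : y ≠ ∞) :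
    extInverse Φ R y = ENNReal.ofReal (Function.invFunOn Φ (Ici R) y.toReal) := if_neg hy

/-- The shift `R` in the hypothesis is exchanged for the larger `C`. Where `μ ≤ C`, `Φ(μ + C) ≤
Φ(2C) ≤ Φ(ζ)`; elsewhere `Φ(μ + C) ≤ Φ(2μ)` and doubling applies. -/
theorem average_shift_le (hc : ConvexOn ℝ (Ici R) Φ) (hm : StrictMonoOn Φ (Ici R)) (hR : 0 < R)
    (hΦR : R ≤ Φ R) (hμ : ∀ y, 0 ≤ μ y) {C C₂ ζ : ℝ}
    (hC : R ≤ C) (hC₂ : 1 ≤ C₂) (hdouble : ∀ z, C ≤ z → Φ (2 * z) ≤ C₂ * Φ z) (hζ : 2 * C ≤ ζ)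
    {x : EuclideanSpace ℝ (Fin N)} {σ : ℝ} (hσ : 0 < σ)
    (h : extInverse Φ R (⨍⁻ y in Metric.ball x σ, ENNReal.ofReal (Φ (μ y + R)) ∂volume) ≤
      ENNReal.ofReal ζ) :
    ⨍⁻ y in Metric.ball x σ, ENNReal.ofReal (Φ (μ y + C)) ∂volume ≤
      ENNReal.ofReal ((1 + C₂) * Φ ζ) := by
  have hζR : R ≤ ζ := by linarith
  set ν := (volume : Measure (EuclideanSpace ℝ (Fin N))).restrict (Metric.ball x σ) with hν
  have : IsFiniteMeasure ν := ⟨by rw [hν, Measure.restrict_apply_univ]; exact measure_ball_lt_top⟩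
  have : NeZero ν := ⟨by
    intro h0
    have := congrArg (fun m : Measure _ => m univ) h0
    simp only [hν, Measure.restrict_apply_univ, Measure.coe_zero, Pi.zero_apply] at this
    exact (Metric.measure_ball_pos _ _ hσ).ne' this⟩
  have hΦpos : ∀ z, R ≤ z → 0 < Φ z := fun z hz =>
    hR.trans_le (hΦR.trans (hm.monotoneOn self_mem_Ici hz hz))
  set a := ⨍⁻ y, ENNReal.ofReal (Φ (μ y + R)) ∂ν with ha
  have haR : ENNReal.ofReal (Φ R) ≤ a := by
    calc ENNReal.ofReal (Φ R) = ⨍⁻ _, ENNReal.ofReal (Φ R) ∂ν := (laverage_const ν _).symm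
      _ ≤ a := by
        rw [ha, laverage, laverage]
        refine lintegral_mono fun y => ENNReal.ofReal_le_ofReal ?_
        have := hμ y
        exact hm.monotoneOn self_mem_Ici (mem_Ici.2 (by linarith)) (by linarith)
  have hat : a ≠ ∞ := by
    intro h0
    rw [h0, extInverse, if_pos rfl] at h
    exact absurd h (by simp)
  have haζ : a ≤ ENNReal.ofReal (Φ ζ) := by
    rw [extInverse_of_ne_top hat, ENNReal.ofReal_le_ofReal_iff (by linarith)] at h
    have h1 : Φ R ≤ a.toReal := (ENNReal.ofReal_le_iff_le_toReal hat).1 haR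
    rw [hc.invFunOn_le_iff hm h1 hζR] at h
    exact (ENNReal.le_ofReal_iff_toReal_le hat (hΦpos ζ hζR).le).2 h
  have hpt : ∀ y, ENNReal.ofReal (Φ (μ y + C)) ≤
      ENNReal.ofReal (Φ ζ) + ENNReal.ofReal C₂ * ENNReal.ofReal (Φ (μ y + R)) := by
    intro y
    have hy := hμ y
    have h1 := hΦpos (μ y + R) (by linarith)
    rw [← ENNReal.ofReal_mul (by linarith), ← ENNReal.ofReal_add (hΦpos ζ hζR).le (by positivity)]
    refine ENNReal.ofReal_le_ofReal ?_
    rcases le_total (μ y) C with h2 | h2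
    · have h3 : Φ (μ y + C) ≤ Φ ζ :=
        hm.monotoneOn (mem_Ici.2 (by linarith)) (mem_Ici.2 hζR) (by linarith)
      have h4 : 0 ≤ C₂ * Φ (μ y + R) := by positivity
      linarith
    · have h3 : Φ (μ y + C) ≤ Φ (2 * μ y) :=
        hm.monotoneOn (mem_Ici.2 (by linarith)) (mem_Ici.2 (by linarith)) (by linarith)
      have h4 : Φ (μ y) ≤ Φ (μ y + R) :=
        hm.monotoneOn (mem_Ici.2 (by linarith)) (mem_Ici.2 (by linarith)) (by linarith)
      have h5 := hdouble _ h2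
      have h6 : C₂ * Φ (μ y) ≤ C₂ * Φ (μ y + R) := by gcongr
      have := hΦpos ζ hζR
      linarith
  calc ⨍⁻ y, ENNReal.ofReal (Φ (μ y + C)) ∂ν
      ≤ ⨍⁻ y, (ENNReal.ofReal (Φ ζ) + ENNReal.ofReal C₂ * ENNReal.ofReal (Φ (μ y + R))) ∂ν := by
        rw [laverage, laverage]; exact lintegral_mono hpt
    _ = ENNReal.ofReal (Φ ζ) + ENNReal.ofReal C₂ * a := by
        rw [laverage, lintegral_add_left measurable_const, ← laverage, laverage_const,
          lintegral_const_mul' _ _ ENNReal.ofReal_ne_top, ha, laverage]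
    _ ≤ ENNReal.ofReal (Φ ζ) + ENNReal.ofReal C₂ * ENNReal.ofReal (Φ ζ) := by gcongr
    _ = ENNReal.ofReal ((1 + C₂) * Φ ζ) := by
        have := (hΦpos ζ hζR).le
        rw [← ENNReal.ofReal_mul (by linarith), ← ENNReal.ofReal_add this (by positivity)]
        congr 1; ring

theorem isLocallyFiniteMeasure_densityMeasure {σ : ℝ} (hσ : 0 < σ)
    (h : ∀ x, ⨍⁻ y in Metric.ball x σ, ENNReal.ofReal (μ y) ∂volume ≠ ∞) :
    IsLocallyFiniteMeasure (densityMeasure μ) := by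
  refine ⟨fun x => ⟨Metric.ball x σ, Metric.ball_mem_nhds x hσ, ?_⟩⟩
  rw [densityMeasure, withDensity_apply _ measurableSet_ball, lt_top_iff_ne_top]
  intro h0
  refine h x ?_
  rw [setLAverage_eq, h0, ENNReal.top_div_of_ne_top measure_ball_lt_top.ne]

end Condition

/-! ### The supersolution and the solution below it. -/

section Supersolution

variable {N : ℕ} {θ : ℝ} {Φ : ℝ → ℝ} {R C : ℝ} {μ : EuclideanSpace ℝ (Fin N) → ℝ}

attribute [local irreducible] fracHeatKernel

theorem ofReal_le_fracHeatSemigroup (hθ : 0 < θ) (hθ2 : θ ≤ 2) (hm : StrictMonoOn Φ (Ici R))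
    (hμ : ∀ y, 0 ≤ μ y) (hμm : AEMeasurable μ) (hC : R ≤ C) {t : ℝ} (ht : 0 < t)
    (x : EuclideanSpace ℝ (Fin N)) :
    ENNReal.ofReal (Φ C) ≤ fracHeatSemigroup θ t (densityMeasure fun y => Φ (μ y + C)) x := by
  have hle : ∀ y, R ≤ μ y + C := fun y => by linarith [hμ y]
  rw [fracHeatSemigroup_densityMeasure (hm.aemeasurable_comp (hμm.add_const C) hle)]
  calc ENNReal.ofReal (Φ C) = ∫⁻ y, ENNReal.ofReal (fracHeatKernel θ (x - y) t) *
        ENNReal.ofReal (Φ C) := by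
        rw [lintegral_mul_const _ (measurable_ofReal_fracHeatKernel_sub x t),
          lintegral_fracHeatKernel_sub hθ hθ2 ht, one_mul]
    _ ≤ _ := by
        gcongr with y
        exact hm.monotoneOn hC (hle y) (by linarith [hμ y])

/-- If `F(2v(s)) ≤ B g(s) V(s)` with `V = S(·)Φ(μ + C)`, `v = Φ⁻¹(V)`, and `V(t) B ∫₀ᵗ g ≤ v(t)`,
then `2v` is a supersolution. -/
theorem duhamel_two_mul_extInverse_le (hθ : 0 < θ) (hθ2 : θ ≤ 2) (hc : ConvexOn ℝ (Ici R) Φ)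
    (hm : StrictMonoOn Φ (Ici R)) (hR : 0 < R) (hΦR : R ≤ Φ R) (hμ : ∀ y, 0 ≤ μ y)
    (hμm : AEMeasurable μ) (hC : R < C) {F g I : ℝ → ℝ} {B T : ℝ} (hB : 0 ≤ B)
    (hfin : ∀ x, ∀ t ∈ Ioo 0 T,
      fracHeatSemigroup θ t (densityMeasure fun y => Φ (μ y + C)) x ≠ ∞)
    (hF : ∀ x, ∀ t ∈ Ioo 0 T, ∀ V, V = (fracHeatSemigroup θ t
      (densityMeasure fun y => Φ (μ y + C)) x).toReal →
      F (2 * Function.invFunOn Φ (Ici R) V) ≤ B * g t * V)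
    (hg : ∀ t ∈ Ioo 0 T, ∫⁻ s in Ioo 0 t, ENNReal.ofReal (g s) ≤ ENNReal.ofReal (I t))
    (hI : ∀ x, ∀ t ∈ Ioo 0 T, ∀ V, V = (fracHeatSemigroup θ t
      (densityMeasure fun y => Φ (μ y + C)) x).toReal →
      B * I t * V ≤ Function.invFunOn Φ (Ici R) V)
    (x : EuclideanSpace ℝ (Fin N)) {t : ℝ} (ht : t ∈ Ioo 0 T) :
    duhamel θ F (densityMeasure μ) (fun z => 2 * extInverse Φ R (fracHeatSemigroup θ z.2
      (densityMeasure fun y => Φ (μ y + C)) z.1)) (x, t) ≤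
      2 * extInverse Φ R (fracHeatSemigroup θ t (densityMeasure fun y => Φ (μ y + C)) x) := by
  have hle : ∀ y, R ≤ μ y + C := fun y => by linarith [hμ y]
  have hΦm : AEMeasurable (fun y => Φ (μ y + C)) :=
    hm.aemeasurable_comp (hμm.add_const C) hle
  set m := densityMeasure fun y => Φ (μ y + C) with hmdef
  have : SFinite m := by rw [hmdef, densityMeasure]; infer_instance
  have hVC : ∀ y, ∀ s ∈ Ioo 0 T, Φ C ≤ (fracHeatSemigroup θ s m y).toReal := fun y s hs =>
    (ENNReal.ofReal_le_iff_le_toReal (hfin y s hs)).1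
      (ofReal_le_fracHeatSemigroup hθ hθ2 hm hμ hμm hC.le hs.1 y)
  have hRC : Φ R ≤ Φ C := hm.monotoneOn self_mem_Ici hC.le hC.le
  have hspec : ∀ y, ∀ s ∈ Ioo 0 T, _ := fun y s hs => hc.invFunOn_spec hm (hRC.trans (hVC y s hs))
  set V := (fracHeatSemigroup θ t m x).toReal with hV
  set v := Function.invFunOn Φ (Ici R) V with hv
  have hvC : C ≤ v := by
    have h1 := hc.monotoneOn_invFunOn hm (mem_Ici.2 hRC) (mem_Ici.2 (hRC.trans (hVC x t ht)))
      (hVC x t ht)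
    rwa [hm.invFunOn_apply hC.le] at h1
  have hv0 : 0 ≤ v := by linarith
  have hVof : ENNReal.ofReal V = fracHeatSemigroup θ t m x := ENNReal.ofReal_toReal (hfin x t ht)
  have hfirst : fracHeatSemigroup θ t (densityMeasure μ) x ≤ ENNReal.ofReal v := by
    rw [fracHeatSemigroup_densityMeasure hμm]
    refine le_trans (lintegral_mono fun y => ?_) (hc.lintegral_mul_ofReal_le hm hR (by linarith)
      (hC.trans_le hvC) (measurable_ofReal_fracHeatKernel_sub x t)
      (lintegral_fracHeatKernel_sub hθ hθ2 ht.1 x) hle ?_)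
    · gcongr
      linarith
    · rw [(hspec x t ht).2, hVof, fracHeatSemigroup_densityMeasure hΦm]
  have hsecond : ∫⁻ s in Ioo 0 t, ∫⁻ y : EuclideanSpace ℝ (Fin N),
      ENNReal.ofReal (fracHeatKernel θ (x - y) (t - s)) *
        ENNReal.ofReal (F (2 * extInverse Φ R (fracHeatSemigroup θ s m y)).toReal) ≤
      ENNReal.ofReal v := by
    -- The bound on `F` is linear in `V(s)`, so the semigroup property turns it into `V(t)` and
    -- leaves only a time integral.
    have hinner : ∀ s ∈ Ioo 0 t, ∫⁻ y : EuclideanSpace ℝ (Fin N),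
        ENNReal.ofReal (fracHeatKernel θ (x - y) (t - s)) *
          ENNReal.ofReal (F (2 * extInverse Φ R (fracHeatSemigroup θ s m y)).toReal) ≤
        ENNReal.ofReal (B * g s) * ENNReal.ofReal V := by
      intro s hs
      have hsT : s ∈ Ioo 0 T := ⟨hs.1, hs.2.trans ht.2⟩
      rw [hVof, ← lintegral_fracHeatKernel_mul_fracHeatSemigroup hθ hθ2 hs.1 hs.2 m x,
        ← lintegral_const_mul' _ _ ENNReal.ofReal_ne_top]
      refine lintegral_mono fun y => ?_
      rw [mul_left_comm]
      refine mul_le_mul_right ?_ _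
      have h0 : 0 ≤ Function.invFunOn Φ (Ici R) (fracHeatSemigroup θ s m y).toReal :=
        hR.le.trans (hspec y s hsT).1
      rw [extInverse_of_ne_top (hfin y s hsT), ENNReal.toReal_mul, ENNReal.toReal_ofReal h0,
        ENNReal.toReal_ofNat]
      nth_rewrite 2 [← ENNReal.ofReal_toReal (hfin y s hsT)]
      rw [← ENNReal.ofReal_mul' ENNReal.toReal_nonneg]
      exact ENNReal.ofReal_le_ofReal (hF y s hsT _ rfl)
    calc _ ≤ ∫⁻ s in Ioo 0 t, ENNReal.ofReal (B * g s) * ENNReal.ofReal V :=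
          setLIntegral_mono_ae' measurableSet_Ioo (ae_of_all _ hinner)
      _ = ENNReal.ofReal B * (∫⁻ s in Ioo 0 t, ENNReal.ofReal (g s)) * ENNReal.ofReal V := by
          simp only [ENNReal.ofReal_mul hB]
          rw [lintegral_mul_const' _ _ ENNReal.ofReal_ne_top,
            lintegral_const_mul' _ _ ENNReal.ofReal_ne_top]
      _ ≤ ENNReal.ofReal B * ENNReal.ofReal (I t) * ENNReal.ofReal V := by
          gcongr
          exact hg t ht
      _ = ENNReal.ofReal (B * I t * V) := by
          rw [← ENNReal.ofReal_mul hB, ← ENNReal.ofReal_mul' ENNReal.toReal_nonneg]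
      _ ≤ ENNReal.ofReal v := ENNReal.ofReal_le_ofReal (hI x t ht V rfl)
  rw [extInverse_of_ne_top (hfin x t ht), two_mul (ENNReal.ofReal _)]
  exact add_le_add hfirst hsecond

theorem exists_isSolutionP_of_supersolution {F : ℝ → ℝ} (hFc : ContinuousOn F (Ici 0))
    (hFm : MonotoneOn F (Ici 0)) {m : Measure (EuclideanSpace ℝ (Fin N))} [SFinite m]
    (hm : IsLocallyFiniteMeasure m) {T : ℝ}
    {w : EuclideanSpace ℝ (Fin N) × ℝ → ℝ≥0∞} (hw : ∀ y, ∀ s ∈ Ioo 0 T, w (y, s) ≠ ∞)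
    (hsuper : ∀ x, ∀ t ∈ Ioo 0 T, duhamel θ F m w (x, t) ≤ w (x, t)) :
    ∃ u : EuclideanSpace ℝ (Fin N) × ℝ → ℝ, IsSolutionP θ F m T u ∧
      ∀ x, ∀ t ∈ Ioo 0 T, ENNReal.ofReal (u (x, t)) ≤ w (x, t) := by
  obtain ⟨U, hUm, hUw, hU⟩ := exists_duhamel_eq_of_supersolution hFc hFm m hw hsuper
  have hfin : ∀ x, ∀ t ∈ Ioo 0 T, ENNReal.ofReal (U (x, t)).toReal = U (x, t) := fun x t ht =>
    ENNReal.ofReal_toReal (ne_top_of_le_ne_top (hw x t ht) (hUw x t ht))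
  refine ⟨fun z => (U z).toReal, ⟨hm, fun x t _ => ENNReal.toReal_nonneg,
    hUm.ennreal_toReal.aemeasurable, ?_⟩, fun x t ht => (hfin x t ht).trans_le (hUw x t ht)⟩
  filter_upwards [ae_restrict_mem (MeasurableSet.univ.prod measurableSet_Ioo)] with z hz
  rw [hfin z.1 z.2 hz.2, hU z.1 z.2 hz.2]
  rfl

end Supersolution

/-! ### Choice of constants and conclusion. -/

theorem theorem4p2
    (N : ℕ) (hN : 1 ≤ N) (θ : ℝ) (hθ0 : 0 < θ) (hθ2 : θ ≤ 2)
    -- `F` is increasing, nonnegative and continuous on `[0,∞)`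
    (F : ℝ → ℝ) (hFc : ContinuousOn F (Ici 0)) (hFm : MonotoneOn F (Ici 0))
    (hF0 : ∀ τ, 0 ≤ τ → 0 ≤ F τ)
    (R α : ℝ) (hR : 0 < R) (hα : 0 < α)
    -- `G`, `H` and `Φ` are functions on `[R,∞)`
    (G H Φ : ℝ → ℝ)
    (hGc : ContinuousOn G (Ici R)) (hGpos : ∀ τ, R ≤ τ → 0 < G τ)
    (hHc : ContDiffOn ℝ 1 H (Ici R)) (hHpos : ∀ τ, R ≤ τ → 0 < H τ)
    (hB1 : AsympEq (fun τ => τ ^ (-(1 + θ / N)) * F τ) G)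
    (hB2i : ∀ a b : ℝ, 1 ≤ a → 0 < b → AsympEq (fun τ => G (a * τ ^ b)) G)
    (hB2ii : ∀ δ : ℝ, 0 < δ → Tendsto (fun τ => τ ^ (-δ) * G τ) atTop (𝓝 0))
    (hB3i : AsympEq (deriv H) (fun τ => τ⁻¹ * G τ))
    (hB3ii : AsympEq (fun τ => G (τ * (H τ)⁻¹)) G)
    (hB3iii : Tendsto H atTop atTop)
    (hB3iv : ∀ δ : ℝ, 0 < δ → Tendsto (fun τ => τ ^ (-δ) * H τ) atTop (𝓝 0))
    (hB4m : StrictMonoOn Φ (Ici R)) (hB4c : ConvexOn ℝ (Ici R) Φ)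
    -- `H` is evaluated on `[Φ(R),∞)` below, so this interval lies in its domain `[R,∞)`
    (hB4R : R ≤ Φ R)
    (hB4inv : ∀ τ, Φ R ≤ τ → Function.invFunOn Φ (Ici R) τ = τ * H τ ^ (-α))
    (η : ℝ) (hη0 : 0 < η) (hη1 : η < θ / N)
    (hB5 : MonotoneOn (fun τ => τ ^ η * H τ ^ (-α) * G τ) (Ioi R)) :
    ∃ ε : ℝ, 0 < ε ∧ ∃ C : ℝ, 0 < C ∧ R ≤ C ∧
      ∀ μ : EuclideanSpace ℝ (Fin N) → ℝ, (∀ x, 0 ≤ μ x) → AEMeasurable μ volume →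
        (∀ᶠ σ in 𝓝[>] (0 : ℝ),
          (⨆ x, extInverse Φ R (⨍⁻ y in Metric.ball x σ, ENNReal.ofReal (Φ (μ y + R)) ∂volume))
            ≤ ENNReal.ofReal (ε * σ ^ (-(N : ℝ)) * H σ⁻¹ ^ (-((N : ℝ) / θ)))) →
        ∃ T : ℝ, 0 < T ∧ T ≤ R⁻¹ ∧ ∃ u : EuclideanSpace ℝ (Fin N) × ℝ → ℝ,
          IsSolutionP θ F (densityMeasure μ) T u ∧
          ∀ x : EuclideanSpace ℝ (Fin N), ∀ t ∈ Ioo 0 T,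
            ENNReal.ofReal (u (x, t)) ≤
              2 * extInverse Φ R
                (fracHeatSemigroup θ t (densityMeasure (fun y => Φ (μ y + C))) x) ∧
            2 * extInverse Φ R
                (fracHeatSemigroup θ t (densityMeasure (fun y => Φ (μ y + C))) x) ≤
              ENNReal.ofReal (C * t ^ (-((N : ℝ) / θ)) * H t⁻¹ ^ (-((N : ℝ) / θ))) := by
  have hN0 : (0 : ℝ) < N := by exact_mod_cast hN
  have hd0 : (0 : ℝ) < (N : ℝ) / θ := by positivity
  have hdq : (N : ℝ) / θ * (θ / N) = 1 := by field_simp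
  have hδ0 : 0 < (θ / N - η) / 2 := by linarith
  have hG : PowerComparable G := PowerComparable.of_asympEq hGc hGpos fun b hb => by
    simpa using hB2i 1 b le_rfl hb
  have hH : PowerComparable H := PowerComparable.of_asympEq_deriv hGpos hG hHc hB3i hB3iii
  obtain ⟨A₀, hA₀R, hA₀1, hHmono, hH'pos, hHd⟩ := exists_monotoneOn_of_asympEq_deriv hGpos hHc hB3i
  obtain ⟨C₁, hC₁, A₁, hreact⟩ := exists_reaction_bound hα (by positivity : 0 < θ / (N : ℝ)) hd0 hdq
    hη1 hGpos hG hHc hB1 hB3i hB3iii hB3iv hB5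
  obtain ⟨C₂, hC₂, A₂, hdoub⟩ := exists_doubling hα hB4c hB4m hR hB4inv hH hB3iii hB3iv hHmono
  -- the constant `K₀` of the averaging estimate
  set Kc : ℝ≥0∞ := ENNReal.ofReal (2 ^ N) +
    ENNReal.ofReal (fracHeatKernel θ (0 : EuclideanSpace ℝ (Fin N)) 1) *
      volume (Metric.ball (0 : EuclideanSpace ℝ (Fin N)) 2) with hKc
  have hKct : Kc ≠ ∞ := ENNReal.add_ne_top.2 ⟨ENNReal.ofReal_ne_top,
    ENNReal.mul_ne_top ENNReal.ofReal_ne_top measure_ball_lt_top.ne⟩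
  have hK₀ : 1 ≤ Kc.toReal := by
    rw [← ENNReal.ofReal_le_iff_le_toReal hKct, hKc]
    exact (ENNReal.ofReal_le_ofReal (one_le_pow₀ one_le_two)).trans le_self_add
  set K₁ := Kc.toReal * (1 + C₂) with hK₁
  have hK₁1 : 1 ≤ K₁ := one_le_mul_of_one_le_of_one_le hK₀ (by linarith)
  have hθi : 0 < 1 / θ := by positivity
  -- The window must contain `τ^(1/θ)`: the ball condition at radius `t^(1/θ)` involves
  -- `H(t^(-1/θ))`, the conclusion `H(1/t)`.
  obtain ⟨c₃, hc₃, hHcmp⟩ := hH (θ + 1 / θ + 1) (by linarith)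
  set D := K₁ * c₃ ^ ((N : ℝ) / θ) with hD
  have hD0 : 0 < D := by positivity
  obtain ⟨z₁, hz₁R, hz₁⟩ := hB4c.surjOn_Ici_of_strictMonoOn hB4m (mem_Ici.2 (le_max_right A₁ (Φ R)))
  obtain ⟨z₂, hz₂R, hz₂⟩ := hB4c.surjOn_Ici_of_strictMonoOn hB4m (mem_Ici.2 (le_max_right A₀ (Φ R)))
  rw [mem_Ici] at hz₁R hz₂R
  -- `C ≥ z₁` makes `V ≥ Φ(C)` large enough for the reaction bound, `C ≥ A₂` gives doubling, `C > R`
  -- lets Jensen's inequality apply at `v ≥ C`, and `C ≥ 2` absorbs the factor `2` in the final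
  -- estimate.
  set C := max (max z₁ A₂) (max (R + 1) 2) with hC
  have hCz₁ : z₁ ≤ C := (le_max_left _ _).trans (le_max_left _ _)
  have hCA₂ : A₂ ≤ C := (le_max_right _ _).trans (le_max_left _ _)
  have hCR1 : R + 1 ≤ C := (le_max_left _ _).trans (le_max_right _ _)
  have hC2 : 2 ≤ C := (le_max_right _ _).trans (le_max_right _ _)
  have hCR : R < C := by linarith
  have hΦCA₁ : A₁ ≤ Φ C := by
    refine le_trans ?_ (hB4m.monotoneOn hz₁R hCR.le hCz₁)
    rw [hz₁]; exact le_max_left _ _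
  -- With this `e` the factor from the time integral is at most `C₁^(-α)`, which pays for passing
  -- from `H(1/t)` to `H(V)`.
  obtain ⟨e, he0, he1, heα⟩ : ∃ e : ℝ, 0 < e ∧ e ≤ 1 ∧
      C₁ * e ^ ((θ / N - η) / 2) / α ≤ C₁ ^ (-α) := by
    have hX : 0 < α * C₁ ^ (-α) / C₁ := by positivity
    refine ⟨min 1 ((α * C₁ ^ (-α) / C₁) ^ (1 / ((θ / N - η) / 2))), by positivity,
      min_le_left _ _, ?_⟩
    have h1 : (min 1 ((α * C₁ ^ (-α) / C₁) ^ (1 / ((θ / N - η) / 2)))) ^ ((θ / N - η) / 2) ≤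
        α * C₁ ^ (-α) / C₁ := by
      calc _ ≤ ((α * C₁ ^ (-α) / C₁) ^ (1 / ((θ / N - η) / 2))) ^ ((θ / N - η) / 2) := by
            gcongr; exact min_le_right _ _
        _ = _ := by rw [← Real.rpow_mul hX.le, one_div_mul_cancel hδ0.ne', Real.rpow_one]
    rw [div_le_iff₀ hα]
    calc _ ≤ C₁ * (α * C₁ ^ (-α) / C₁) := by gcongr
      _ = _ := by field_simp
  -- `D` collects the losses from ball averaging, from the shift to `C` and from comparing
  -- `H(t^(-1/θ))` with `H(1/t)`.
  set ε := e / D with hε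
  have hε0 : 0 < ε := by positivity
  refine ⟨ε, hε0, C, by linarith, hCR.le, fun μ hμ hμm hyp => ?_⟩
  set ζ : ℝ → ℝ := fun σ => ε * σ ^ (-(N : ℝ)) * H σ⁻¹ ^ (-((N : ℝ) / θ)) with hζ
  -- smallness of the time interval
  have hσlim : Tendsto (fun t : ℝ => t ^ (1 / θ)) (𝓝[>] 0) (𝓝[>] 0) := by
    refine tendsto_nhdsWithin_iff.2 ⟨?_, ?_⟩
    · have := (Real.continuous_rpow_const hθi.le).tendsto 0
      rw [Real.zero_rpow hθi.ne'] at this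
      exact this.mono_left nhdsWithin_le_nhds
    · filter_upwards [self_mem_nhdsWithin] with t ht using Real.rpow_pos_of_pos ht _
  -- `ζ(σ) → ∞` as `σ → 0`, since the power of `H` costs at most half of the exponent `N`.
  have hζlim : ∀ᶠ σ in 𝓝[>] (0 : ℝ), max (2 * C) z₂ ≤ ζ σ := by
    have h1 : ∀ᶠ ρ in atTop, max (2 * C) z₂ ≤ ε * (ρ ^ (N : ℝ)) * H ρ ^ (-((N : ℝ) / θ)) := by
      have h2 := (tendsto_rpow_atTop (y := (N : ℝ) / 2) (by positivity)).const_mul_atTop hε0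
      filter_upwards [h2.eventually_ge_atTop (max (2 * C) z₂), hB3iii.eventually_ge_atTop 1,
        eventually_le_rpow hB3iv (δ := θ / 2) (by positivity), eventually_gt_atTop 0]
        with ρ h3 h4 h5 h6
      have h7 := (rpow_half_le_mul_rpow_neg (V := ρ ^ (N : ℝ)) (by positivity) h4 hd0 (by
        rw [← Real.rpow_mul h6.le]
        convert h5 using 2
        field_simp)).1
      rw [← Real.rpow_mul h6.le, mul_one_div] at h7
      rw [mul_assoc]
      exact h3.trans (by gcongr)
    filter_upwards [tendsto_inv_nhdsGT_zero.eventually h1, self_mem_nhdsWithin] with σ h2 h3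
    have h4 : σ ^ (-(N : ℝ)) = σ⁻¹ ^ (N : ℝ) := by
      rw [Real.rpow_neg (le_of_lt h3), Real.inv_rpow (le_of_lt h3)]
    simp only [hζ, h4]
    exact h2
  have hev : ∀ᶠ t in 𝓝[>] (0 : ℝ), _ := (hσlim.eventually (hyp.and hζlim)).and
    (tendsto_inv_nhdsGT_zero.eventually
      ((eventually_ge_atTop (max A₀ A₁)).and (hHcmp.and (eventually_ge_atTop 1))))
  obtain ⟨T₀, hT₀, hsub⟩ := mem_nhdsGT_iff_exists_Ioo_subset.1 hev
  set T := min T₀ R⁻¹ with hT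
  have hT0 : 0 < T := lt_min hT₀ (by positivity)
  -- bounds at a fixed time
  have havg : ∀ t ∈ Ioo 0 T, ∀ x, ⨍⁻ y in Metric.ball x (t ^ (1 / θ)),
      ENNReal.ofReal (Φ (μ y + C)) ∂volume ≤ ENNReal.ofReal ((1 + C₂) * Φ (ζ (t ^ (1 / θ)))) := by
    intro t ht x
    obtain ⟨⟨h1, h2⟩, -⟩ := hsub ⟨ht.1, ht.2.trans_le (min_le_left _ _)⟩
    exact average_shift_le hB4c hB4m hR hB4R hμ hCR.le hC₂ (fun z hz => (hdoub z (hCA₂.trans hz)).1)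
      ((le_max_left _ _).trans h2) (Real.rpow_pos_of_pos ht.1 _) ((le_iSup _ x).trans h1)
  have hΦm : AEMeasurable (fun y => Φ (μ y + C)) :=
    hB4m.aemeasurable_comp (hμm.add_const C) fun y => by linarith [hμ y]
  have hVle : ∀ x, ∀ t ∈ Ioo 0 T, fracHeatSemigroup θ t (densityMeasure fun y => Φ (μ y + C)) x ≤
      ENNReal.ofReal (K₁ * Φ (ζ (t ^ (1 / θ)))) := by
    intro x t ht
    rw [fracHeatSemigroup_densityMeasure hΦm]
    refine (lintegral_fracHeatKernel_mul_le_of_average_le hθ0 hθ2 ht.1 hΦm.ennreal_ofReal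
      (havg t ht) x).trans_eq ?_
    rw [hK₁, mul_assoc, ENNReal.ofReal_mul ENNReal.toReal_nonneg, ENNReal.ofReal_toReal hKct]
  have hfin : ∀ x, ∀ t ∈ Ioo 0 T,
      fracHeatSemigroup θ t (densityMeasure fun y => Φ (μ y + C)) x ≠ ∞ := fun x t ht =>
    ne_top_of_le_ne_top ENNReal.ofReal_ne_top (hVle x t ht)
  have hbound : ∀ x, ∀ t ∈ Ioo 0 T, ∀ V, V = (fracHeatSemigroup θ t
      (densityMeasure fun y => Φ (μ y + C)) x).toReal → Φ C ≤ V ∧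
      Function.invFunOn Φ (Ici R) V ≤ e * (t⁻¹ ^ ((N : ℝ) / θ) * H t⁻¹ ^ (-((N : ℝ) / θ))) := by
    rintro x t ht V rfl
    obtain ⟨⟨-, h2⟩, h3, h4, h5⟩ := hsub ⟨ht.1, ht.2.trans_le (min_le_left _ _)⟩
    have ht0 : 0 < t⁻¹ := inv_pos.2 ht.1
    have h6 : Φ C ≤ (fracHeatSemigroup θ t (densityMeasure fun y => Φ (μ y + C)) x).toReal :=
      (ENNReal.ofReal_le_iff_le_toReal (hfin x t ht)).1
        (ofReal_le_fracHeatSemigroup hθ0 hθ2 hB4m hμ hμm hCR.le ht.1 x)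
    refine ⟨h6, ?_⟩
    have hζR : R ≤ ζ (t ^ (1 / θ)) := hz₂R.trans ((le_max_right _ _).trans h2)
    have hΦζ : A₀ ≤ Φ (ζ (t ^ (1 / θ))) := by
      refine le_trans ?_ (hB4m.monotoneOn hz₂R hζR ((le_max_right _ _).trans h2))
      rw [hz₂]; exact le_max_left _ _
    have h7 := invFunOn_le_mul hα hB4c hB4m hR hHpos hB4inv hA₀R.le hHmono hK₁1 hζR hΦζ
      ((hB4m.monotoneOn self_mem_Ici hCR.le hCR.le).trans h6)
      (ENNReal.toReal_le_of_le_ofReal (by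
        have := hR.trans_le (hA₀R.le.trans hΦζ)
        positivity) (hVle x t ht))
    refine h7.trans ?_
    have hσinv : (t ^ (1 / θ))⁻¹ = t⁻¹ ^ (1 / θ) := (Real.inv_rpow ht.1.le _).symm
    have hσN : (t ^ (1 / θ)) ^ (-(N : ℝ)) = t⁻¹ ^ ((N : ℝ) / θ) := by
      rw [← Real.rpow_mul ht.1.le, Real.inv_rpow ht.1.le, ← Real.rpow_neg ht.1.le]
      congr 1; ring
    have hθM : 1 / (θ + 1 / θ + 1) ≤ 1 / θ := by
      gcongr
      linarith
    have h8 := (h4 (t⁻¹ ^ (1 / θ)) (Real.rpow_le_rpow_of_exponent_le h5 hθM)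
      (Real.rpow_le_rpow_of_exponent_le h5 (by linarith))).2
    have hHt0 : 0 < H t⁻¹ := hHpos _ (hA₀R.le.trans ((le_max_left _ _).trans h3))
    have hHσ0 : 0 < H (t⁻¹ ^ (1 / θ)) :=
      (mul_pos_iff_of_pos_left (zero_lt_one.trans_le hc₃)).1 (hHt0.trans_le h8)
    have h9 : H (t⁻¹ ^ (1 / θ)) ^ (-((N : ℝ) / θ)) ≤
        c₃ ^ ((N : ℝ) / θ) * H t⁻¹ ^ (-((N : ℝ) / θ)) := by
      have hc₃0 : 0 < c₃ := by linarith
      calc H (t⁻¹ ^ (1 / θ)) ^ (-((N : ℝ) / θ)) ≤ (c₃⁻¹ * H t⁻¹) ^ (-((N : ℝ) / θ)) :=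
            Real.rpow_le_rpow_of_nonpos (by positivity) ((inv_mul_le_iff₀ hc₃0).2 h8) (by linarith)
        _ = _ := by
            rw [Real.mul_rpow (by positivity) hHt0.le, Real.inv_rpow hc₃0.le,
              ← Real.rpow_neg hc₃0.le, neg_neg]
    simp only [hζ, hσinv, hσN]
    calc K₁ * (ε * t⁻¹ ^ ((N : ℝ) / θ) * H (t⁻¹ ^ (1 / θ)) ^ (-((N : ℝ) / θ)))
        ≤ K₁ * (ε * t⁻¹ ^ ((N : ℝ) / θ) *
            (c₃ ^ ((N : ℝ) / θ) * H t⁻¹ ^ (-((N : ℝ) / θ)))) := by gcongr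
      _ = (ε * D) * (t⁻¹ ^ ((N : ℝ) / θ) * H t⁻¹ ^ (-((N : ℝ) / θ))) := by rw [hD]; ring
      _ = _ := by rw [hε, div_mul_cancel₀ _ hD0.ne']
  have hRC : Φ R ≤ Φ C := hB4m.monotoneOn self_mem_Ici hCR.le hCR.le
  have hreact' : ∀ x, ∀ t ∈ Ioo 0 T, ∀ V, V = (fracHeatSemigroup θ t
      (densityMeasure fun y => Φ (μ y + C)) x).toReal →
      F (2 * Function.invFunOn Φ (Ici R) V) ≤ C₁ * e ^ ((θ / N - η) / 2) * V *
        (t⁻¹ ^ 2 * deriv H t⁻¹ * H t⁻¹ ^ (-1 - α)) ∧ H V ≤ C₁ * H t⁻¹ := by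
    intro x t ht V hV
    obtain ⟨h1, h2⟩ := hbound x t ht V hV
    obtain ⟨-, h3, -⟩ := hsub ⟨ht.1, ht.2.trans_le (min_le_left _ _)⟩
    rw [hB4inv V (hRC.trans h1)] at h2 ⊢
    exact hreact V t⁻¹ e (hΦCA₁.trans h1) ((le_max_right _ _).trans h3) he0 he1 h2
  have htA₀ : ∀ t ∈ Ioo 0 T, A₀ ≤ t⁻¹ := fun t ht =>
    (le_max_left _ _).trans (hsub ⟨ht.1, ht.2.trans_le (min_le_left _ _)⟩).2.1
  have hsuper : ∀ x, ∀ t ∈ Ioo 0 T, _ := fun x t ht =>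
    duhamel_two_mul_extInverse_le (F := F) (B := C₁ * e ^ ((θ / N - η) / 2))
      (g := fun s => s⁻¹ ^ 2 * deriv H s⁻¹ * H s⁻¹ ^ (-1 - α)) (I := fun t => H t⁻¹ ^ (-α) / α)
      hθ0 hθ2 hB4c hB4m hR hB4R hμ hμm hCR (by positivity) hfin
      (fun x t ht V hV => (hreact' x t ht V hV).1.trans_eq (by ring))
      (fun t ht => lintegral_deriv_comp_inv_le hα ht.1 (htA₀ t ht)
        (fun τ hτ => hHpos τ (hA₀R.le.trans hτ)) hHd hH'pos hB3iii)
      (fun x t ht V hV => by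
        have hΦV := (hbound x t ht V hV).1
        have hV0 : 0 < V := hR.trans_le (hB4R.trans (hRC.trans hΦV))
        have hHV := (hreact' x t ht V hV).2
        have hHt0 : 0 < H t⁻¹ := hHpos _ (hA₀R.le.trans (htA₀ t ht))
        have hHV0 : 0 < H V := hHpos V (hB4R.trans (hRC.trans hΦV))
        rw [hB4inv V (hRC.trans hΦV)]
        calc C₁ * e ^ ((θ / N - η) / 2) * (H t⁻¹ ^ (-α) / α) * V
            = (C₁ * e ^ ((θ / N - η) / 2) / α) * H t⁻¹ ^ (-α) * V := by ring
          _ ≤ C₁ ^ (-α) * H t⁻¹ ^ (-α) * V := by gcongr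
          _ = (C₁ * H t⁻¹) ^ (-α) * V := by rw [Real.mul_rpow (by linarith) hHt0.le]
          _ ≤ H V ^ (-α) * V := by
              gcongr ?_ * _
              exact Real.rpow_le_rpow_of_nonpos hHV0 hHV (by linarith)
          _ = V * H V ^ (-α) := mul_comm _ _) x ht
  -- Finite averages of `Φ(μ + C)` suffice, because `μ ≤ μ + C ≤ Φ(μ + C)`.
  have hloc : IsLocallyFiniteMeasure (densityMeasure μ) := by
    have hhalf : T / 2 ∈ Ioo 0 T := ⟨by linarith, by linarith⟩
    refine isLocallyFiniteMeasure_densityMeasure (Real.rpow_pos_of_pos hhalf.1 (1 / θ)) fun x => ?_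
    refine ne_top_of_le_ne_top (ne_top_of_le_ne_top ENNReal.ofReal_ne_top (havg _ hhalf x)) ?_
    rw [laverage, laverage]
    refine lintegral_mono fun y => ENNReal.ofReal_le_ofReal ?_
    have := hμ y
    have h2 := (hdoub (μ y + C) (by linarith)).2
    linarith
  have : SFinite (densityMeasure μ) := by rw [densityMeasure]; infer_instance
  have hwfin : ∀ x, ∀ t ∈ Ioo 0 T, 2 * extInverse Φ R
      (fracHeatSemigroup θ t (densityMeasure fun y => Φ (μ y + C)) x) ≠ ∞ := fun x t ht => by
    rw [extInverse_of_ne_top (hfin x t ht)]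
    exact ENNReal.mul_ne_top ENNReal.ofNat_ne_top ENNReal.ofReal_ne_top
  obtain ⟨u, hu, huw⟩ := exists_isSolutionP_of_supersolution (θ := θ) hFc hFm hloc
    (w := fun z => 2 * extInverse Φ R (fracHeatSemigroup θ z.2
      (densityMeasure fun y => Φ (μ y + C)) z.1)) hwfin hsuper
  refine ⟨T, hT0, min_le_right _ _, u, hu, fun x t ht => ⟨huw x t ht, ?_⟩⟩
  have hHt0 : 0 < H t⁻¹ := hHpos _ (hA₀R.le.trans (htA₀ t ht))
  have hb := (hbound x t ht _ rfl).2
  rw [extInverse_of_ne_top (hfin x t ht), ← ENNReal.ofReal_ofNat, ← ENNReal.ofReal_mul two_pos.le]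
  refine ENNReal.ofReal_le_ofReal ?_
  have ht0 := ht.1
  rw [mul_assoc, Real.rpow_neg ht.1.le, ← Real.inv_rpow ht.1.le]
  have hX : 0 ≤ t⁻¹ ^ ((N : ℝ) / θ) * H t⁻¹ ^ (-((N : ℝ) / θ)) := by positivity
  calc _ ≤ 2 * (1 * (t⁻¹ ^ ((N : ℝ) / θ) * H t⁻¹ ^ (-((N : ℝ) / θ)))) := by
        gcongr
        exact hb.trans (by gcongr)
    _ ≤ _ := by rw [one_mul]; gcongr
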